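/- A Boolean function $f(x_1,\dots,x_n)$ is \emph{read-once} over a set $B$ of Boolean functions (a basis) if it is expressed by a formula over $B$ in the variables $x_1,\dots,x_n$ in which no variable appears more than once. For $f$ read-once over $B$ and depending on all of its $n$ variables, a set $M\subseteq\{0,1\}^n$ is a \emph{checking test} for $f$ if for every read-once function $g(x_1,\dots,x_n)\neq f$ over $B$ (possibly with irrelevant variables) there is $\alpha\in M$ with $f(\alpha)\neq g(\alpha)$; $T_B(f)$ is the least cardinality of a checking test for $f$. Let $B_l$ be the basis of all Boolean functions of at most $l$ variables. For a set $\mathbf w$ of $l$ variables, a \emph{relevance hypercube} of $f$ for $\mathbf w$ is a set $H$ of $2^l$ vectors, obtained by fixing the variables outside $\mathbf w$ to constants, such that the restriction of $f$ to $H$ depends on all variables of $\mathbf w$. \textbf{Corollary.} (1) Let $1\le l\le n$ and let $f$ be a read-once function over $B_l$ depending on all of its $n$ variables. Choose one relevance hypercube of $f$ for each $l$-element set of variables for which such a hypercube exists. Then the union of the chosen hypercubes is a checking test for $f$ (with respect to $B_l$) and has at most $2^l\binom nl$ elements. In particular, $$T_{B_l}(f)\le 2^l\binom nl .$$ (2)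 For every $l \ge 0$ there is a constant $C$ such that $T_{B_l}(f)\le C\,n^l$ for every $n\ge1$ and every read-once function $f$ over $B_l$ depending on all of its $n$ variables. (3) For every finite basis $B$, with $l$ the largest arity of a function in $B$ ($l=0$ if $B$ is empty), there is a constant $C$ such that $T_B(f)\le C\,n^l$ for every $n\ge1$ and every read-once function $f$ over $B$ depending on all of its $n$ variables. -/

import Mathlib

namespace ReadOnce

/-- Boolean functions of the variables `x i`, `i : Fin n`. -/
abbrev BoolFn (n : ℕ) : Type := (Fin n → Bool) → Bool

/-- A Boolean function together with its arity; a basis is a set of these. -/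
abbrev Gate : Type := Σ m : ℕ, BoolFn m

/-- The basis `B_l` of all Boolean functions of (at most) `l` variables. -/
def fullBasis (l : ℕ) : Set Gate := {h | h.1 ≤ l}

/-- Formulas over the basis `B` in the variables `x i`, `i : Fin n`. -/
inductive Formula (B : Set Gate) (n : ℕ) : Type where
  | var (i : Fin n) : Formula B n
  | app (h : Gate) (hB : h ∈ B) (args : Fin h.1 → Formula B n) : Formula B n

/-- The value of a formula at an input vector. -/
def Formula.eval {B : Set Gate} {n : ℕ} (x : Fin n → Bool) : Formula B n → Bool
  | .var i => x i
  | .app h _ args => h.2 (fun k => (args k).eval x)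

/-- The number of occurrences of the variable `x i` in a formula. -/
def Formula.occurrences {B : Set Gate} {n : ℕ} (i : Fin n) : Formula B n → ℕ
  | .var j => if j = i then 1 else 0
  | .app _ _ args => ∑ k, (args k).occurrences i

/-- `f` is read-once over `B`: some formula over `B` in which no variable appears more than once
expresses `f`. -/
def IsReadOnce (B : Set Gate) {n : ℕ} (f : BoolFn n) : Prop :=
  ∃ F : Formula B n, (∀ i, F.occurrences i ≤ 1) ∧ ∀ x, F.eval x = f x

/-- The restriction of `f` to the set `H` of vectors depends on the variable `x i`. -/
def DependsOnIn {n : ℕ} (f : BoolFn n) (H : Finset (Fin n → Bool)) (i : Fin n) : Prop :=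
  ∃ α ∈ H, ∃ β ∈ H, (∀ j, j ≠ i → α j = β j) ∧ f α ≠ f β

/-- `f` depends on all its variables. -/
def DependsOnAll {n : ℕ} (f : BoolFn n) : Prop :=
  ∀ i, DependsOnIn f Finset.univ i

/-- `M` distinguishes `f` from all other read-once functions over `B` of the same variables. -/
def IsCheckingTest (B : Set Gate) {n : ℕ} (f : BoolFn n) (M : Finset (Fin n → Bool)) : Prop :=
  ∀ g : BoolFn n, IsReadOnce B g → g ≠ f → ∃ α ∈ M, f α ≠ g α

/-- The checking test complexity `T_B(f)`: the least cardinality of a checking test. -/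
noncomputable def testComplexity (B : Set Gate) {n : ℕ} (f : BoolFn n) : ℕ :=
  sInf {k | ∃ M : Finset (Fin n → Bool), IsCheckingTest B f M ∧ M.card = k}

/-- The infimum defining `testComplexity` is over a nonempty set. -/
theorem isCheckingTest_univ (B : Set Gate) {n : ℕ} (f : BoolFn n) :
    IsCheckingTest B f Finset.univ := by
  intro g _ hne
  by_contra h
  push Not at h
  exact hne (funext fun α => (h α (Finset.mem_univ α)).symm)

/-- The set of vectors that agree with `p` outside the components in `w`
(it has `2 ^ w.card` elements). -/
def subcube {n : ℕ} (w : Finset (Fin n)) (p : Fin n → Bool) : Finset (Fin n → Bool) :=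
  Finset.univ.filter fun α => ∀ i, i ∉ w → α i = p i

/-- `H` is a relevance hypercube of `f` for the set `w` of variables. -/
def IsRelevanceHypercube {n : ℕ} (f : BoolFn n) (w : Finset (Fin n))
    (H : Finset (Fin n → Bool)) : Prop :=
  (∃ p, H = subcube w p) ∧ ∀ i ∈ w, DependsOnIn f H i

open Classical in
/-- The `l`-element sets of variables for which `f` has a relevance hypercube. -/
noncomputable def cubeSets {n : ℕ} (l : ℕ) (f : BoolFn n) : Finset (Finset (Fin n)) :=
  (Finset.powersetCard l Finset.univ).filter fun w => ∃ H, IsRelevanceHypercube f w H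

end ReadOnce

/-! A module of f is a set of variables that enters f through a single Boolean value (`Mod`); a gate
is prime if it has no module with at least two but not all of its variables (`Prime`). A read-once
function with at least two essential variables is a prime gate of arity between 2 and l applied to
read-once functions of disjoint variables (`RO.exists_nf`), and each argument is a module. Fixing
all but one variable of every argument turns the arguments into literals, so the gate shows up, up
to negations, on a relevance hypercube (`Dec.sep`); smaller relevant sets extend to relevant sets of
size l (`exists_superset_res`). The difficulty is that g agrees with f on one hypercube per set
only, with fixed values that cannot be chosen.

Uniqueness (`eq_of_ro_of_agree`) is by induction on the number of variables. If f has more than l of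
them, then g has a module M with 2 ≤ |M| ≤ l (`RO.exists_mod`); take a smallest one. The crux is
that M is a module of f as well (`Mod.of_agree`). Moreover M is relevant on some hypercube of f
(`Agree.sep_module`), so on an agreed hypercube containing M in its directions both functions are
seen to carry the same value on M. Collapsing M to one variable reduces the number of variables.

For the crux, let r be the lowest subfunction of f containing M, so that M meets two arguments of
its gate. If this gate has arity at least three, primality forces M to be all variables of r. If it
is binary and |M| ≥ 3, the arguments of r cut out smaller modules of g inside M, against minimality.
There remains M = {a, b} and r = op(ψ, φ) with a in ψ and b in φ (`mod_pair_of_agree`). Let w be the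
variables naming the arguments of the gate of ψ, among them a. If |w| < l, there is room for b, and
the overlap of w with {a, b} either contradicts primality or, for |w| = 2, lets r be reassociated so
that a and b lie in a smaller subfunction. If |w| = l ≥ 3, the hypercubes obtained by exchanging one
argument for b contradict the primality of the gate (`not_pairMod_of_prime`). If l = 2, the types of
binary gates, sum or conjunction, are read off squares and compared (`exists_reassoc_of_two`). -/

namespace ReadOnce

set_option linter.unusedSectionVars false

/-! ### Essential variables, restrictions to subcubes, modules -/

section Essential

variable {V : Type*} [Fintype V] [DecidableEq V]

/-- Boolean functions of variables indexed by `V`. -/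
abbrev Fn (V : Type*) : Type _ := (V → Bool) → Bool

open Classical in
/-- The set of essential variables of `f`. -/
noncomputable def ess (f : Fn V) : Finset V :=
  Finset.univ.filter fun i => ∃ x b, f (Function.update x i b) ≠ f x

theorem mem_ess {f : Fn V} {i : V} : i ∈ ess f ↔ ∃ x b, f (Function.update x i b) ≠ f x := by
  simp [ess]

theorem eq_of_agree {f : Fn V} {x y : V → Bool} (h : ∀ i ∈ ess f, x i = y i) : f x = f y := by
  have key : ∀ s : Finset V, f (s.piecewise x y) = f y := by
    intro s
    induction s using Finset.induction_on with
    | empty => simp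
    | insert j s hj ih =>
      rw [Finset.piecewise_insert]
      by_cases hj' : j ∈ ess f
      · rw [h j hj']
        have : Function.update (s.piecewise x y) j (y j) = s.piecewise x y := by
          funext k
          by_cases hk : k = j
          · subst hk; simp [hj]
          · simp [hk]
        rw [this, ih]
      · rw [← ih]
        by_contra hne
        exact hj' (mem_ess.2 ⟨_, _, hne⟩)
  simpa using key Finset.univ

theorem mem_ess_of_ne {f : Fn V} {i : V} {x y : V → Bool} (h : f x ≠ f y)
    (hxy : ∀ j, j ≠ i → x j = y j) : i ∈ ess f := by
  by_contra hi
  exact h (eq_of_agree fun j hj => hxy j fun e => hi (e ▸ hj))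

theorem exists_mem_ess_of_ne {f : Fn V} {x y : V → Bool} (h : f x ≠ f y) :
    ∃ i ∈ ess f, x i ≠ y i := by
  by_contra! hc
  exact h (eq_of_agree hc)

theorem ess_subset_iff {f : Fn V} {A : Finset V} :
    ess f ⊆ A ↔ ∀ x y, (∀ i ∈ A, x i = y i) → f x = f y := by
  constructor
  · intro h x y hxy
    exact eq_of_agree fun i hi => hxy i (h hi)
  · intro h i hi
    by_contra hiA
    obtain ⟨x, b, hne⟩ := mem_ess.1 hi
    refine hne (h _ _ fun j hj => ?_)
    rw [Function.update_of_ne]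
    rintro rfl
    exact hiA hj

theorem disjoint_ess_iff {f : Fn V} {A : Finset V} :
    Disjoint (ess f) A ↔ ∀ x y, (∀ i, i ∉ A → x i = y i) → f x = f y := by
  rw [Finset.disjoint_left]
  constructor
  · intro h x y hxy
    exact eq_of_agree fun i hi => hxy i (h hi)
  · intro h i hi hiA
    obtain ⟨x, b, hne⟩ := mem_ess.1 hi
    refine hne (h _ _ fun j hj => ?_)
    rw [Function.update_of_ne]
    rintro rfl
    exact hj hiA

/-- An essential variable can be exhibited with prescribed values. -/
theorem exists_ne_of_mem_ess {f : Fn V} {i : V} (h : i ∈ ess f) :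
    ∃ x, f (Function.update x i false) ≠ f (Function.update x i true) := by
  obtain ⟨x, b, hne⟩ := mem_ess.1 h
  refine ⟨x, fun he => hne ?_⟩
  have hx : f x = f (Function.update x i (x i)) := by simp
  rw [hx]
  cases b <;> cases x i <;> simp [he]

/-- An essential variable can be turned into a literal equal to `f`. -/
theorem exists_literal {f : Fn V} {i : V} (h : i ∈ ess f) :
    ∃ x s, ∀ b, f (Function.update x i (b ^^ s)) = b := by
  obtain ⟨x, hne⟩ := exists_ne_of_mem_ess h
  refine ⟨x, f (Function.update x i false), fun b => ?_⟩
  revert hne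
  cases b <;> cases h0 : f (Function.update x i false) <;>
    cases h1 : f (Function.update x i true) <;> simp [h0, h1]

theorem ess_comp_subset (h : Fn V) (φ : V → Fn V) :
    ess (fun x => h fun i => φ i x) ⊆ (ess h).biUnion fun i => ess (φ i) := by
  rw [ess_subset_iff]
  intro x y hxy
  refine eq_of_agree fun i hi => eq_of_agree fun j hj => hxy j ?_
  exact Finset.mem_biUnion.2 ⟨i, hi, hj⟩

theorem eq_of_ess_eq_empty {f : Fn V} (h : ess f = ∅) (x y : V → Bool) : f x = f y :=
  eq_of_agree fun i hi => by simp [h] at hi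

theorem exists_eq_of_ess_nonempty {f : Fn V} (h : (ess f).Nonempty) (b : Bool) : ∃ x, f x = b := by
  obtain ⟨i, hi⟩ := h
  obtain ⟨x, s, hx⟩ := exists_literal hi
  exact ⟨_, hx b⟩

theorem ess_xor (f : Fn V) (s : Bool) : ess (fun x => f x ^^ s) = ess f := by
  ext i
  simp [mem_ess]

/-- The restriction of `f` to the subcube through `p` with free variables `w`. -/
def res (f : Fn V) (w : Finset V) (p : V → Bool) : Fn V := fun x => f (w.piecewise x p)

theorem ess_res_subset (f : Fn V) (w : Finset V) (p : V → Bool) :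
    ess (res f w p) ⊆ w ∩ ess f := by
  rw [ess_subset_iff]
  intro x y hxy
  refine eq_of_agree (f := f) fun i hi => ?_
  by_cases hiw : i ∈ w
  · simp [hiw, hxy i (Finset.mem_inter.2 ⟨hiw, hi⟩)]
  · simp [hiw]

theorem ess_res_subset_left (f : Fn V) (w : Finset V) (p : V → Bool) : ess (res f w p) ⊆ w :=
  (ess_res_subset f w p).trans Finset.inter_subset_left

theorem ess_res_subset_right (f : Fn V) (w : Finset V) (p : V → Bool) :
    ess (res f w p) ⊆ ess f :=
  (ess_res_subset f w p).trans Finset.inter_subset_right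

theorem res_res {f : Fn V} {w w' : Finset V} (h : w' ⊆ w) (p q : V → Bool) :
    res (res f w p) w' q = res f w' (w.piecewise q p) := by
  funext x
  simp only [res]
  congr 1
  funext i
  by_cases hi : i ∈ w'
  · simp [hi, h hi]
  · by_cases hi' : i ∈ w <;> simp [hi, hi']

theorem ess_res_mono {f : Fn V} {w w' : Finset V} (h : w' ⊆ w) (p : V → Bool) :
    ess (res f w' p) ⊆ ess (res f w p) := by
  have : res f w' p = res (res f w p) w' p := by
    rw [res_res h]
    congr 1
    funext i
    by_cases hi : i ∈ w <;> simp [hi]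
  rw [this]
  exact ess_res_subset_right _ _ _

theorem res_of_ess_subset {f : Fn V} {w : Finset V} (h : ess f ⊆ w) (p : V → Bool) :
    res f w p = f := by
  funext x
  refine eq_of_agree (f := f) fun i hi => ?_
  simp [h hi]

/-- A subcube on which all free variables are essential can be enlarged. -/
theorem exists_insert_res {f : Fn V} {w : Finset V} {p : V → Bool} (hw : w ⊆ ess (res f w p))
    (hne : ∃ i ∈ ess f, i ∉ w) : ∃ i, i ∉ w ∧ ∃ p', insert i w ⊆ ess (res f (insert i w) p') := by
  -- Move the base point one coordinate at a time. The first step outside `w` that changes the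
  -- restriction makes its coordinate `i` essential, while `w` stays essential since the restriction
  -- before the step is still the original one. If no step changes it, `f` ignores everything
  -- outside `w`.
  by_cases hstep : ∃ p₁ i b, i ∉ w ∧ res f w p₁ = res f w p ∧
      res f w (Function.update p₁ i b) ≠ res f w p₁
  · obtain ⟨p₁, i, b, hi, he, hd⟩ := hstep
    refine ⟨i, hi, p₁, ?_⟩
    rw [Finset.insert_subset_iff]
    constructor
    · obtain ⟨x, hx⟩ := Function.ne_iff.1 hd
      have h1 : res f w p₁ x = res f (insert i w) p₁ (w.piecewise x p₁) := by
        simp only [res]; congr 1; funext j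
        by_cases hj : j ∈ w <;> by_cases hji : j = i <;> simp [hj, hji]
      have h2 : res f w (Function.update p₁ i b) x =
          res f (insert i w) p₁ (w.piecewise x (Function.update p₁ i b)) := by
        simp only [res]; congr 1; funext j
        by_cases hj : j ∈ w <;> by_cases hji : j = i <;> simp [hj, hji]
      rw [h1, h2] at hx
      refine mem_ess_of_ne hx fun j hj => ?_
      by_cases hjw : j ∈ w <;> simp [hjw, hj]
    · rw [← he] at hw
      exact hw.trans (ess_res_mono (Finset.subset_insert _ _) _)
  · push Not at hstep
    exfalso
    have key : ∀ (q : V → Bool) (s : Finset V), res f w (s.piecewise q p) = res f w p := by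
      intro q s
      induction s using Finset.induction_on with
      | empty => simp
      | insert j s hj ih =>
        rw [Finset.piecewise_insert]
        by_cases hjw : j ∈ w
        · rw [← ih]
          funext x
          simp only [res]; congr 1; funext k
          by_cases hk : k ∈ w
          · simp [hk]
          · have : k ≠ j := fun e => hk (e ▸ hjw)
            simp [hk, this]
        · rw [hstep _ j _ hjw ih, ih]
    have key' : ∀ q, res f w q = res f w p := fun q => by simpa using key q Finset.univ
    obtain ⟨i, hi, hiw⟩ := hne
    obtain ⟨x, b, hx⟩ := mem_ess.1 hi
    apply hx
    have e1 : f (Function.update x i b) = res f w (Function.update x i b) x := by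
      simp only [res]; congr 1; funext k
      by_cases hk : k ∈ w
      · have : k ≠ i := fun e => hiw (e ▸ hk)
        simp [hk, this]
      · simp [hk]
    have e2 : f x = res f w x x := by
      simp only [res]; congr 1; funext k
      by_cases hk : k ∈ w <;> simp [hk]
    rw [e1, e2, key', key' x]

/-- Iterates `exists_insert_res`. The fixed values may change on the way; only the relevance of the
variables is kept. -/
theorem exists_superset_res {f : Fn V} {w : Finset V} {p : V → Bool} (hw : w ⊆ ess (res f w p))
    {m : ℕ} (h1 : w.card ≤ m) (h2 : m ≤ (ess f).card) :
    ∃ w', w ⊆ w' ∧ w'.card = m ∧ ∃ p', w' ⊆ ess (res f w' p') := by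
  induction m, h1 using Nat.le_induction with
  | base => exact ⟨w, le_rfl, rfl, p, hw⟩
  | succ m hm ih =>
    obtain ⟨w', hww', hc, p', hp'⟩ := ih (by omega)
    have hne : ∃ i ∈ ess f, i ∉ w' := by
      by_contra! hcon
      have := Finset.card_le_card (show ess f ⊆ w' from hcon)
      omega
    obtain ⟨i, hi, p'', hp''⟩ := exists_insert_res hp' hne
    exact ⟨insert i w', hww'.trans (Finset.subset_insert _ _),
      by rw [Finset.card_insert_of_notMem hi, hc], p'', hp''⟩

/-- Every function with at least two essential variables has, for each variable `i`, another
variable `t` that can be fixed so that all the remaining ones stay essential. -/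
theorem exists_strong {f : Fn V} {i : V} (hi : i ∈ ess f) (h2 : 2 ≤ (ess f).card) :
    ∃ t ∈ ess f, t ≠ i ∧ ∃ p, (ess f).erase t ⊆ ess (res f ((ess f).erase t) p) := by
  obtain ⟨x, hx⟩ := exists_ne_of_mem_ess hi
  have h0 : ({i} : Finset V) ⊆ ess (res f {i} x) := by
    rw [Finset.singleton_subset_iff]
    have e : ∀ b, f (Function.update x i b) = res f {i} x (Function.update x i b) := by
      intro b
      simp only [res]; congr 1; funext k
      by_cases hk : k = i <;> simp [hk]
    rw [e, e] at hx
    exact mem_ess_of_ne hx fun j hj => by simp [hj]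
  -- The relevant edge in direction `i` grows until exactly one essential variable is missing; that
  -- one is `t`.
  obtain ⟨w', hw', hc, p', hp'⟩ := exists_superset_res h0
    (m := (ess f).card - 1) (by simp; omega) (by omega)
  have hsub : w' ⊆ ess f := hp'.trans (ess_res_subset_right _ _ _)
  have hiw : i ∈ w' := hw' (by simp)
  obtain ⟨t, ht, htw⟩ : ∃ t ∈ ess f, t ∉ w' := by
    by_contra! hcon
    have := Finset.card_le_card (show ess f ⊆ w' from hcon)
    omega
  have hw'e : w' = (ess f).erase t := by
    apply Finset.eq_of_subset_of_card_le
    · intro j hj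
      exact Finset.mem_erase.2 ⟨fun e => htw (e ▸ hj), hsub hj⟩
    · rw [Finset.card_erase_of_mem ht, hc]
  exact ⟨t, ht, fun e => htw (e ▸ hiw), p', hw'e ▸ hp'⟩

/-- `M` is a module of `f`: the variables in `M` enter `f` through one Boolean value only. -/
def Mod (f : Fn V) (M : Finset V) : Prop :=
  ∃ (v : Fn V) (F : Bool → Fn V), ess v ⊆ M ∧ (∀ b, Disjoint (ess (F b)) M) ∧
    ∀ x, f x = F (v x) x

/-- Coordinates of `σ y` in `M` see only `I`, the others see only the complement of `I`, so
composing value and context with `σ` exhibits the new module. Most transfers of modules below are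
instances of this change of variables. -/
theorem Mod.subst {f h : Fn V} {M I : Finset V} (hM : Mod f M) (σ : (V → Bool) → V → Bool)
    (s : Bool) (hh : ∀ y, h y = (f (σ y) ^^ s))
    (h1 : ∀ j ∈ M, ∀ y y', (∀ i ∈ I, y i = y' i) → σ y j = σ y' j)
    (h2 : ∀ j, j ∉ M → ∀ y y', (∀ i, i ∉ I → y i = y' i) → σ y j = σ y' j) : Mod h I := by
  obtain ⟨v, F, hv, hF, hf⟩ := hM
  refine ⟨fun y => v (σ y), fun b y => F b (σ y) ^^ s, ?_, fun b => ?_, fun x => ?_⟩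
  · rw [ess_subset_iff]
    intro x y hxy
    exact eq_of_agree fun i hi => h1 i (hv hi) _ _ hxy
  · rw [disjoint_ess_iff]
    intro x y hxy
    have : F b (σ x) = F b (σ y) :=
      disjoint_ess_iff.1 (hF b) _ _ fun i hi => h2 i hi _ _ hxy
    simp [this]
  · simp [hh, hf]

theorem Mod.res {f : Fn V} {M : Finset V} (hM : Mod f M) (w : Finset V) (p : V → Bool) :
    Mod (res f w p) M := by
  refine hM.subst (fun x => w.piecewise x p) false (fun y => by simp [ReadOnce.res]) ?_ ?_
  · intro j hj y y' h
    by_cases hjw : j ∈ w <;> simp [hjw, h j hj]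
  · intro j hj y y' h
    by_cases hjw : j ∈ w <;> simp [hjw, h j hj]

theorem Mod.trans {f v : Fn V} {M I : Finset V} {F : Bool → Fn V} (hI : I ⊆ M)
    (hF : ∀ b, Disjoint (ess (F b)) M) (hf : ∀ x, f x = F (v x) x) (hv : Mod v I) : Mod f I := by
  obtain ⟨u, G, hu, hG, hvG⟩ := hv
  refine ⟨u, fun b x => F (G b x) x, hu, fun b => ?_, fun x => by rw [hf, hvG]⟩
  rw [disjoint_ess_iff]
  intro x y hxy
  have e1 : G b x = G b y := disjoint_ess_iff.1 (hG b) _ _ hxy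
  have e2 : F (G b y) x = F (G b y) y :=
    disjoint_ess_iff.1 (hF _) _ _ fun i hi => hxy i fun h => hi (hI h)
  simp only [e1, e2]

/-- `h` has no module of intermediate size among its essential variables. -/
def Prime (h : Fn V) : Prop :=
  ∀ I, Mod h I → I ⊆ ess h → 2 ≤ I.card → I = ess h

end Essential

/-! ### Read-once decompositions with a prime gate -/

section Decomposition

variable {V : Type*} [Fintype V] [DecidableEq V]

/-- Read-once functions over the functions of at most `l` variables; the arguments of a gate are
indexed by a set `w` of variables. -/
inductive RO (l : ℕ) : Fn V → Prop
  | lit (i : V) : RO l (fun x => x i)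
  | node (f : Fn V) (w : Finset V) (h : Fn V) (φ : V → Fn V) (hc : w.card ≤ l) (hw : ess h ⊆ w)
      (hφ : ∀ i ∈ w, RO l (φ i))
      (hd : ∀ i ∈ w, ∀ j ∈ w, i ≠ j → Disjoint (ess (φ i)) (ess (φ j)))
      (hf : ∀ x, f x = h fun i => φ i x) : RO l f

theorem RO.const (l : ℕ) (b : Bool) : RO l (fun _ : V → Bool => b) :=
  RO.node _ ∅ (fun _ => b) (fun i x => x i) (by simp)
    (by rw [ess_subset_iff]; simp) (by simp) (by simp) (by simp)

theorem RO.res {l : ℕ} {f : Fn V} (hf : RO l f) (w : Finset V) (p : V → Bool) :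
    RO l (res f w p) := by
  induction hf with
  | lit i =>
    by_cases hi : i ∈ w
    · have : ReadOnce.res (fun x : V → Bool => x i) w p = fun x => x i := by
        funext x; simp [ReadOnce.res, hi]
      rw [this]; exact RO.lit i
    · have : ReadOnce.res (fun x : V → Bool => x i) w p = fun _ => p i := by
        funext x; simp [ReadOnce.res, hi]
      rw [this]; exact RO.const l _
  | node f w' h φ hc hw hφ hd hf ih =>
    refine RO.node _ w' h (fun i => ReadOnce.res (φ i) w p) hc hw ih ?_ ?_
    · intro i hi j hj hij
      exact (hd i hi j hj hij).mono (ess_res_subset_right _ _ _) (ess_res_subset_right _ _ _)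
    · intro x; simp [ReadOnce.res, hf]

theorem exists_glue (w : Finset V) (A : V → Finset V)
    (hd : ∀ i ∈ w, ∀ j ∈ w, i ≠ j → Disjoint (A i) (A j)) (z : V → V → Bool) (q : V → Bool) :
    ∃ x : V → Bool, (∀ i ∈ w, ∀ j ∈ A i, x j = z i j) ∧
      ∀ j, (∀ i ∈ w, j ∉ A i) → x j = q j := by
  classical
  refine ⟨fun j => if h : ∃ i ∈ w, j ∈ A i then z h.choose j else q j, ?_, ?_⟩
  · intro i hi j hj
    have h : ∃ i ∈ w, j ∈ A i := ⟨i, hi, hj⟩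
    simp only [h, dif_pos]
    have hs := h.choose_spec
    by_contra hne
    have hne' : h.choose ≠ i := fun e => hne (by rw [e])
    exact Finset.disjoint_left.1 (hd _ hs.1 i hi hne') hs.2 hj
  · intro j hj
    have h : ¬ ∃ i ∈ w, j ∈ A i := by
      rintro ⟨i, hi, hji⟩; exact hj i hi hji
    simp only [h, dif_neg, not_false_eq_true]

/-- For a variable `j` of the argument `i`, turn `φ i` into a literal in `j` and give the other
arguments, which are nonconstant, the values at which `h` is sensitive to `i`; disjointness lets
these choices coexist. -/
theorem ess_comp {h : Fn V} {φ : V → Fn V}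
    (hd : ∀ i ∈ ess h, ∀ j ∈ ess h, i ≠ j → Disjoint (ess (φ i)) (ess (φ j)))
    (hne : ∀ i ∈ ess h, (ess (φ i)).Nonempty) :
    ess (fun x => h fun i => φ i x) = (ess h).biUnion fun i => ess (φ i) := by
  refine (ess_comp_subset h φ).antisymm ?_
  intro j hj
  obtain ⟨i, hi, hji⟩ := Finset.mem_biUnion.1 hj
  obtain ⟨y, hy⟩ := exists_ne_of_mem_ess hi
  obtain ⟨z, s, hz⟩ := exists_literal hji
  have hex : ∀ k, ∃ x, k ∈ ess h → φ k x = y k := by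
    intro k
    by_cases hk : k ∈ ess h
    · obtain ⟨x, hx⟩ := exists_eq_of_ess_nonempty (hne k hk) (y k)
      exact ⟨x, fun _ => hx⟩
    · exact ⟨y, fun h => absurd h hk⟩
  choose Z hZ using hex
  obtain ⟨x, hx, -⟩ := exists_glue (ess h) (fun i => ess (φ i)) hd (Function.update Z i z) z
  have e : ∀ b, (h fun k => φ k (Function.update x j (b ^^ s))) = h (Function.update y i b) := by
    intro b
    refine eq_of_agree fun k hk => ?_
    by_cases hki : k = i
    · subst hki
      rw [Function.update_self, ← hz b]
      refine eq_of_agree fun m hm => ?_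
      by_cases hmj : m = j
      · subst hmj; simp [hz]
      · simp [hmj, hx k hk m hm]
    · rw [Function.update_of_ne hki, ← hZ k hk]
      refine eq_of_agree fun m hm => ?_
      have hmj : m ≠ j := by
        rintro rfl
        exact Finset.disjoint_left.1 (hd k hk i hi hki) hm hji
      simp [hmj, hx k hk m hm, hki]
  rw [← e, ← e] at hy
  exact mem_ess_of_ne hy fun m hm => by simp [hm]

/-- A module can be normalized so that one of its variables carries its value. -/
theorem Mod.normalize {f : Fn V} {M : Finset V} (hM : Mod f M) {a : V} (ha : a ∈ M)
    (haf : a ∈ ess f) : ∃ (u : Fn V) (F : Bool → Fn V) (c : V → Bool), ess u ⊆ M ∧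
      (∀ b, Disjoint (ess (F b)) M) ∧ (∀ x, f x = F (u x) x) ∧
      ∀ x, (∀ j ∈ M, j ≠ a → x j = c j) → u x = x a := by
  obtain ⟨v, F, hv, hF, hf⟩ := hM
  have hav : a ∈ ess v := by
    obtain ⟨x, hx⟩ := exists_ne_of_mem_ess haf
    rw [hf, hf] at hx
    have e : ∀ b, F b (Function.update x a false) = F b (Function.update x a true) := by
      intro b
      refine disjoint_ess_iff.1 (hF b) _ _ fun i hi => ?_
      have : i ≠ a := fun e => hi (e ▸ ha)
      simp [this]
    have hne : v (Function.update x a false) ≠ v (Function.update x a true) := by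
      intro h
      rw [h, e] at hx
      exact hx rfl
    exact mem_ess_of_ne hne fun j hj => by simp [hj]
  obtain ⟨c, s, hc⟩ := exists_literal hav
  refine ⟨fun x => v x ^^ s, fun b => F (b ^^ s), c, ?_, fun b => hF _, ?_, ?_⟩
  · rw [ess_xor]; exact hv
  · intro x; simp [hf]
  · intro x hx
    have h1 := hc (x a ^^ s)
    have h2 : v x = v (Function.update c a (x a ^^ s ^^ s)) := by
      refine eq_of_agree fun j hj => ?_
      by_cases hja : j = a
      · subst hja; simp
      · simp [hja, hx j (hv hj) hja]
    show (v x ^^ s) = x a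
    rw [h2, h1]; simp

/-- Freezing the other variables of `M` at `c` makes `u` equal to `x a`, so the collapsed function
is a restriction of `f`. Conversely, whatever `u` contributes to a change of `f` can be reproduced
by setting the variable `a`. -/
theorem ess_collapse {f u : Fn V} {F : Bool → Fn V} {M : Finset V} {a : V} {c : V → Bool}
    (ha : a ∈ M) (haf : a ∈ ess f) (hu : ess u ⊆ M) (hF : ∀ b, Disjoint (ess (F b)) M)
    (hf : ∀ x, f x = F (u x) x) (huc : ∀ x, (∀ j ∈ M, j ≠ a → x j = c j) → u x = x a) :
    ess (fun x => F (x a) x) = insert a (ess f \ M) := by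
  have hFe : ∀ b x y, (∀ i, i ∉ M → x i = y i) → F b x = F b y :=
    fun b x y h => disjoint_ess_iff.1 (hF b) _ _ h
  have hres : (fun x => F (x a) x) = res f (insert a (Finset.univ \ M)) c := by
    funext x
    simp only [res]
    rw [hf, huc]
    · simp only [Finset.mem_insert, true_or, Finset.piecewise_eq_of_mem]
      refine hFe _ _ _ fun i hi => ?_
      simp [hi]
    · intro j hj hja
      simp [hj, hja]
  apply Finset.Subset.antisymm
  · intro i hi
    rw [hres] at hi
    have := ess_res_subset _ _ _ hi
    simp only [Finset.mem_inter, Finset.mem_insert, Finset.mem_sdiff, Finset.mem_univ,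
      true_and] at this ⊢
    tauto
  · intro i hi
    rw [Finset.mem_insert, Finset.mem_sdiff] at hi
    obtain rfl | ⟨hif, hiM⟩ := hi
    · obtain ⟨x, hx⟩ := exists_ne_of_mem_ess haf
      rw [hf, hf, hFe _ (Function.update x i false) x, hFe _ (Function.update x i true) x] at hx
      · have hne : u (Function.update x i false) ≠ u (Function.update x i true) :=
          fun h => hx (by rw [h])
        have hx' : F false x ≠ F true x := by
          revert hx hne
          cases u (Function.update x i false) <;> cases u (Function.update x i true) <;>
            simp [eq_comm]
        refine mem_ess_of_ne (x := Function.update x i false) (y := Function.update x i true) ?_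
          fun j hj => by simp [hj]
        simp only [Function.update_self]
        rwa [hFe _ (Function.update x i false) x, hFe _ (Function.update x i true) x]
        all_goals
          intro j hj
          have : j ≠ i := fun e => hj (e ▸ ha)
          simp [this]
      all_goals
        intro j hj
        have : j ≠ i := fun e => hj (e ▸ ha)
        simp [this]
    · obtain ⟨x, hx⟩ := exists_ne_of_mem_ess hif
      have hue : u (Function.update x i true) = u (Function.update x i false) := by
        refine eq_of_agree fun j hj => ?_
        have : j ≠ i := fun e => hiM (e ▸ hu hj)
        simp [this]
      rw [hf, hf, hue] at hx
      set b := u (Function.update x i false)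
      have hia : i ≠ a := fun e => hiM (e ▸ ha)
      refine mem_ess_of_ne (x := Function.update (Function.update x a b) i false)
        (y := Function.update (Function.update x a b) i true) ?_ fun j hj => by simp [hj]
      simp only [Function.update_of_ne hia.symm, Function.update_self]
      have e : ∀ b', F b (Function.update (Function.update x a b) i b') =
          F b (Function.update x i b') := by
        intro b'
        refine hFe b _ _ fun j hj => ?_
        have : j ≠ a := fun e => hj (e ▸ ha)
        by_cases hji : j = i
        · subst hji; simp
        · simp [hji, this]
      rw [e, e]
      exact hx

/-- A decomposition of `f` into a gate `h` of arity at most `l` applied to read-once functions of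
disjoint sets of variables. -/
structure Pre (l : ℕ) (f : Fn V) (w : Finset V) (h : Fn V) (φ : V → Fn V) : Prop where
  eq : ∀ x, f x = h fun i => φ i x
  ess_eq : ess h = w
  disj : ∀ i ∈ w, ∀ j ∈ w, i ≠ j → Disjoint (ess (φ i)) (ess (φ j))
  ne : ∀ i ∈ w, (ess (φ i)).Nonempty
  ro : ∀ i ∈ w, RO l (φ i)
  two_le : 2 ≤ w.card
  card_le : w.card ≤ l

theorem Pre.ess_eq_biUnion {l : ℕ} {f : Fn V} {w : Finset V} {h : Fn V} {φ : V → Fn V}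
    (D : Pre l f w h φ) : ess f = w.biUnion fun i => ess (φ i) := by
  have := ess_comp (h := h) (φ := φ) (by rw [D.ess_eq]; exact D.disj)
    (by rw [D.ess_eq]; exact D.ne)
  rw [D.ess_eq] at this
  rw [← this]
  congr 1
  funext x
  exact D.eq x

/-- Constant arguments are absorbed into the gate. If a single relevant argument is left, `f` is
that argument up to negation, and the decomposition is found below it. -/
theorem RO.exists_pre {l : ℕ} {f : Fn V} (hf : RO l f) (h2 : 2 ≤ (ess f).card) :
    ∃ w h φ, Pre l f w h φ := by
  induction hf with
  | lit i =>
    exfalso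
    have : ess (fun x : V → Bool => x i) ⊆ {i} := by
      rw [ess_subset_iff]; intro x y h; exact h i (by simp)
    have := Finset.card_le_card this
    simp at this
    omega
  | node f w h φ hc hw hφ hd hf ih =>
    classical
    let g : Fn V := fun y => h fun i => if (ess (φ i)).Nonempty then y i else φ i (fun _ => false)
    have hfg : ∀ x, f x = g fun i => φ i x := by
      intro x
      rw [hf]
      refine eq_of_agree fun i _ => ?_
      by_cases hi : (ess (φ i)).Nonempty
      · simp [hi]
      · simp only [hi, if_false]
        exact eq_of_ess_eq_empty (Finset.not_nonempty_iff_eq_empty.1 hi) _ _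
    have hgw : ∀ i ∈ ess g, i ∈ w ∧ (ess (φ i)).Nonempty := by
      intro i hi
      obtain ⟨y, hy⟩ := exists_ne_of_mem_ess hi
      obtain ⟨j, hj, hne⟩ := exists_mem_ess_of_ne (f := h) hy
      have : j = i := by
        by_contra hji; simp [hji] at hne
      subst this
      refine ⟨hw hj, ?_⟩
      by_contra hn; simp only [hn, if_false] at hne; exact hne rfl
    have hsub : ess g ⊆ w := fun i hi => (hgw i hi).1
    rcases Nat.lt_or_ge (ess g).card 2 with hlt | hge
    · have hef : ess f ⊆ (ess g).biUnion fun i => ess (φ i) := by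
        have : f = fun x => g fun i => φ i x := funext hfg
        rw [this]; exact ess_comp_subset _ _
      obtain h0 | h1 : (ess g).card = 0 ∨ (ess g).card = 1 := by omega
      · rw [Finset.card_eq_zero.1 h0] at hef
        have := Finset.card_le_card hef
        simp at this
        simp [this] at h2
      · obtain ⟨i, hi⟩ := Finset.card_eq_one.1 h1
        rw [hi, Finset.singleton_biUnion] at hef
        have hiw := hgw i (by simp [hi])
        obtain ⟨w', h', φ', D⟩ := ih i hiw.1 (h2.trans (Finset.card_le_card hef))
        obtain ⟨y, s, hy⟩ := exists_literal (f := g) (i := i) (by simp [hi])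
        have hfi : ∀ x, f x = (φ i x ^^ s) := by
          intro x
          have h3 := hy (φ i x ^^ s)
          rw [← h3, hfg]
          refine eq_of_agree fun j hj => ?_
          rw [hi, Finset.mem_singleton] at hj
          subst hj; simp
        refine ⟨w', fun y => h' y ^^ s, φ', ⟨?_, ?_, D.disj, D.ne, D.ro, D.two_le, D.card_le⟩⟩
        · intro x; rw [hfi, D.eq]
        · rw [ess_xor]; exact D.ess_eq
    · exact ⟨ess g, g, φ, ⟨hfg, rfl, fun i hi j hj => hd i (hsub hi) j (hsub hj),
        fun i hi => (hgw i hi).2, fun i hi => hφ i (hsub hi), hge,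
        (Finset.card_le_card hsub).trans hc⟩⟩

/-- A module `I` of intermediate size splits the gate into an inner gate on `I`, placed at the
representative `a`, and an outer gate in which `I` is collapsed to `a`. The outer gate has fewer
arguments, so the process ends at a prime one. -/
theorem Pre.exists_prime {l : ℕ} {f : Fn V} {w : Finset V} {h : Fn V} {φ : V → Fn V}
    (D : Pre l f w h φ) : ∃ w h φ, Pre l f w h φ ∧ Prime h := by
  induction hn : w.card using Nat.strong_induction_on generalizing w h φ with
  | _ n ih =>
  subst hn
  by_cases hp : Prime h
  · exact ⟨w, h, φ, D, hp⟩
  unfold Prime at hp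
  push Not at hp
  obtain ⟨I, hI, hIw, hI2, hIne⟩ := hp
  rw [D.ess_eq] at hIw hIne
  obtain ⟨a, ha⟩ : I.Nonempty := Finset.card_pos.1 (by omega)
  obtain ⟨u, H, c, hu, hH, hh, huc⟩ := hI.normalize ha (by rw [D.ess_eq]; exact hIw ha)
  have hess := ess_collapse ha (by rw [D.ess_eq]; exact hIw ha) hu hH hh huc
  rw [D.ess_eq] at hess
  have hanot : a ∉ w \ I := by simp [ha]
  have hcard : (insert a (w \ I)).card = w.card - I.card + 1 := by
    rw [Finset.card_insert_of_notMem hanot, Finset.card_sdiff_of_subset hIw]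
  have hIlt : I.card < w.card :=
    Finset.card_lt_card (Finset.ssubset_iff_subset_ne.2 ⟨hIw, hIne⟩)
  have huφ : ess (fun x => u fun i => φ i x) ⊆ I.biUnion fun i => ess (φ i) :=
    (ess_comp_subset u φ).trans (Finset.biUnion_subset_biUnion_of_subset_left _ hu)
  have hdj : ∀ j ∈ w \ I, Disjoint (ess (fun x => u fun i => φ i x)) (ess (φ j)) := by
    intro j hj
    rw [Finset.mem_sdiff] at hj
    refine Finset.disjoint_of_subset_left huφ ?_
    rw [Finset.disjoint_biUnion_left]
    intro i hi
    exact D.disj i (hIw hi) j hj.1 fun e => hj.2 (e ▸ hi)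
  have hua : a ∈ ess u := by
    have h1 := huc (Function.update c a false) fun j _ hj => by simp [hj]
    have h2 := huc (Function.update c a true) fun j _ hj => by simp [hj]
    refine mem_ess_of_ne (x := Function.update c a false) (y := Function.update c a true) ?_
      fun j hj => by simp [hj]
    simp [h1, h2]
  refine ih _ (w := insert a (w \ I)) (h := fun y => H (y a) y)
    (φ := Function.update φ a (fun x => u fun i => φ i x)) (by omega) ?_ rfl
  refine ⟨?_, hess, ?_, ?_, ?_, by omega, ?_⟩
  · intro x
    rw [D.eq, hh]
    simp only [Function.update_self]
    refine disjoint_ess_iff.1 (hH _) _ _ fun i hi => ?_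
    have : i ≠ a := fun e => hi (e ▸ ha)
    simp [this]
  · intro i hi j hj hij
    rw [Finset.mem_insert] at hi hj
    rcases hi with rfl | hi
    · rcases hj with rfl | hj
      · exact absurd rfl hij
      · simpa [hij.symm] using hdj j hj
    · have hia : i ≠ a := fun e => hanot (e ▸ hi)
      rcases hj with rfl | hj
      · simpa [hia] using (hdj i hi).symm
      · have hja : j ≠ a := fun e => hanot (e ▸ hj)
        simpa [hia, hja] using
          D.disj i (Finset.mem_sdiff.1 hi).1 j (Finset.mem_sdiff.1 hj).1 hij
  · intro i hi
    by_cases hia : i = a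
    · subst hia
      simp only [Function.update_self]
      rw [ess_comp]
      · obtain ⟨j, hj⟩ := D.ne i (hIw ha)
        exact ⟨j, Finset.mem_biUnion.2 ⟨i, hua, hj⟩⟩
      · intro i hi j hj
        exact D.disj i (hIw (hu hi)) j (hIw (hu hj))
      · exact fun j hj => D.ne j (hIw (hu hj))
    · simp only [Finset.mem_insert, hia, false_or, Finset.mem_sdiff] at hi
      simpa [hia] using D.ne i hi.1
  · intro i hi
    by_cases hia : i = a
    · subst hia
      simp only [Function.update_self]
      exact RO.node _ I u φ (by have := D.card_le; omega) hu (fun j hj => D.ro j (hIw hj))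
        (fun i hi j hj => D.disj i (hIw hi) j (hIw hj)) (fun x => rfl)
    · simp only [Finset.mem_insert, hia, false_or, Finset.mem_sdiff] at hi
      simpa [hia] using D.ro i hi.1
  · have := D.card_le; omega

/-- A decomposition with a prime gate whose arguments are named after one of their variables. -/
structure NF (l : ℕ) (f : Fn V) (w : Finset V) (h : Fn V) (φ : V → Fn V) : Prop
    extends Pre l f w h φ where
  mem : ∀ i ∈ w, i ∈ ess (φ i)
  prime : Prime h

/-- When an argument is named after one of its own variables, the gate and the function live on the
same variables, and modules of the one can be intersected with those of the other. The freedom in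
`t` is used to put prescribed variables among the names. -/
theorem Pre.rename {l : ℕ} {f : Fn V} {w : Finset V} {h : Fn V} {φ : V → Fn V}
    (D : Pre l f w h φ) (hp : Prime h) (t : V → V) (ht : ∀ i ∈ w, t i ∈ ess (φ i)) :
    ∃ h' φ', NF l f (w.image t) h' φ' ∧ ∀ i ∈ w, φ' (t i) = φ i := by
  classical
  have hinj : Set.InjOn t w := by
    intro i hi j hj hij
    by_contra hne
    exact Finset.disjoint_left.1 (D.disj i hi j hj hne) (ht i hi) (hij ▸ ht j hj)
  obtain ⟨r, hr⟩ : ∃ r : V → V, ∀ i ∈ w, r (t i) = i := by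
    refine ⟨fun j => if h : ∃ i ∈ w, t i = j then h.choose else j, fun i hi => ?_⟩
    have h : ∃ k ∈ w, t k = t i := ⟨i, hi, rfl⟩
    simp only [h, dif_pos]
    exact hinj h.choose_spec.1 hi h.choose_spec.2
  have hφ : ∀ i ∈ w, φ (r (t i)) = φ i := fun i hi => by rw [hr i hi]
  have hess : ess (fun y => h fun i => y (t i)) = w.image t := by
    have h1 : (fun y : V → Bool => h fun i => y (t i)) =
        fun y => h fun i => (fun i (x : V → Bool) => x (t i)) i y := rfl
    have h2 : ∀ i, ess (fun x : V → Bool => x (t i)) = {t i} := by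
      intro i
      apply Finset.Subset.antisymm
      · rw [ess_subset_iff]; intro x y hxy; exact hxy _ (by simp)
      · rw [Finset.singleton_subset_iff]
        exact mem_ess_of_ne (x := Function.update (fun _ => false) (t i) false)
          (y := Function.update (fun _ => false) (t i) true) (by simp) fun j hj => by simp [hj]
    rw [h1, ess_comp]
    · simp only [h2, D.ess_eq]
      ext j
      simp only [Finset.mem_biUnion, Finset.mem_singleton, Finset.mem_image, eq_comm]
    · intro i hi j hj hij
      rw [D.ess_eq] at hi hj
      simp only [h2, Finset.disjoint_singleton]
      exact fun e => hij (hinj hi hj e)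
    · intro i _
      simp [h2]
  refine ⟨fun y => h fun i => y (t i), fun j => φ (r j),
    ⟨⟨?_, hess, ?_, ?_, ?_, ?_, ?_⟩, ?_, ?_⟩, hφ⟩
  · intro x
    rw [D.eq]
    refine eq_of_agree fun i hi => ?_
    simp only [hφ i (D.ess_eq ▸ hi)]
  · intro i hi j hj hij
    obtain ⟨i, hi', rfl⟩ := Finset.mem_image.1 hi
    obtain ⟨j, hj', rfl⟩ := Finset.mem_image.1 hj
    simp only [hφ i hi', hφ j hj']
    exact D.disj i hi' j hj' fun e => hij (by rw [e])
  · intro i hi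
    obtain ⟨i, hi', rfl⟩ := Finset.mem_image.1 hi
    simp only [hφ i hi']; exact D.ne i hi'
  · intro i hi
    obtain ⟨i, hi', rfl⟩ := Finset.mem_image.1 hi
    simp only [hφ i hi']; exact D.ro i hi'
  · rw [Finset.card_image_of_injOn hinj]; exact D.two_le
  · rw [Finset.card_image_of_injOn hinj]; exact D.card_le
  · intro i hi
    obtain ⟨i, hi', rfl⟩ := Finset.mem_image.1 hi
    simp only [hφ i hi']; exact ht i hi'
  · intro I hI hIs hI2
    rw [hess] at hIs ⊢
    have hJ : Mod h (w.filter fun i => t i ∈ I) := by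
      refine hI.subst (fun y j => if j ∈ w.image t then y (r j) else false) false ?_ ?_ ?_
      · intro y
        simp only [Bool.xor_false]
        refine eq_of_agree fun i hi => ?_
        rw [D.ess_eq] at hi
        simp only [Finset.mem_image_of_mem t hi, if_true, hr i hi]
      · intro j hj y y' hyy
        obtain ⟨i, hi, rfl⟩ := Finset.mem_image.1 (hIs hj)
        simp only [Finset.mem_image_of_mem t hi, if_true, hr i hi]
        exact hyy i (by simp [hi, hj])
      · intro j hj y y' hyy
        by_cases hjw : j ∈ w.image t
        · obtain ⟨i, hi, rfl⟩ := Finset.mem_image.1 hjw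
          simp only [hjw, if_true, hr i hi]
          exact hyy i (by simp [hj])
        · simp [hjw]
    have himg : (w.filter fun i => t i ∈ I).image t = I := by
      ext j
      simp only [Finset.mem_image, Finset.mem_filter]
      constructor
      · rintro ⟨i, ⟨-, hi⟩, rfl⟩; exact hi
      · intro hj
        obtain ⟨i, hi, rfl⟩ := Finset.mem_image.1 (hIs hj)
        exact ⟨i, ⟨hi, hj⟩, rfl⟩
    have := hp _ hJ (by rw [D.ess_eq]; exact Finset.filter_subset _ _) (by
      rw [← himg] at hI2
      exact hI2.trans Finset.card_image_le)
    rw [D.ess_eq] at this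
    rw [← himg, this]

theorem RO.exists_nf {l : ℕ} {f : Fn V} (hf : RO l f) (h2 : 2 ≤ (ess f).card) :
    ∃ w h φ, NF l f w h φ := by
  obtain ⟨w, h, φ, D⟩ := hf.exists_pre h2
  obtain ⟨w, h, φ, D, hp⟩ := D.exists_prime
  have hex : ∀ i, ∃ j, i ∈ w → j ∈ ess (φ i) := by
    intro i
    by_cases hi : i ∈ w
    · obtain ⟨j, hj⟩ := D.ne i hi
      exact ⟨j, fun _ => hj⟩
    · exact ⟨i, fun h => absurd h hi⟩
  choose t ht using hex
  obtain ⟨h', φ', D', -⟩ := D.rename hp t ht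
  exact ⟨_, h', φ', D'⟩

/-- The representative of one argument of the gate can be chosen freely. -/
theorem NF.rename_one {l : ℕ} {f : Fn V} {w : Finset V} {h : Fn V} {φ : V → Fn V}
    (D : NF l f w h φ) {i j : V} (hi : i ∈ w) (hj : j ∈ ess (φ i)) :
    ∃ h' φ', NF l f (insert j (w.erase i)) h' φ' ∧ φ' j = φ i ∧ ∀ k ∈ w.erase i, φ' k = φ k := by
  obtain ⟨h', φ', D', hφ⟩ := D.toPre.rename D.prime (Function.update id i j) (by
    intro k hk
    by_cases hki : k = i
    · subst hki; simpa using hj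
    · simpa [hki] using D.mem k hk)
  have himg : w.image (Function.update id i j) = insert j (w.erase i) := by
    ext k
    simp only [Finset.mem_image, Finset.mem_insert, Finset.mem_erase]
    constructor
    · rintro ⟨m, hm, rfl⟩
      by_cases hmi : m = i
      · subst hmi; simp
      · right; simp [hmi, hm]
    · rintro (rfl | ⟨hki, hk⟩)
      · exact ⟨i, hi, by simp⟩
      · exact ⟨k, hk, by simp [hki]⟩
  rw [himg] at D'
  refine ⟨h', φ', D', ?_, ?_⟩
  · simpa using hφ i hi
  · intro k hk
    rw [Finset.mem_erase] at hk
    simpa [hk.1] using hφ k hk.2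

theorem RO.exists_nf_mem {l : ℕ} {f : Fn V} (hf : RO l f) (h2 : 2 ≤ (ess f).card) {a : V}
    (ha : a ∈ ess f) : ∃ w h φ, NF l f w h φ ∧ a ∈ w := by
  obtain ⟨w, h, φ, D⟩ := hf.exists_nf h2
  rw [D.toPre.ess_eq_biUnion] at ha
  obtain ⟨i, hi, hai⟩ := Finset.mem_biUnion.1 ha
  obtain ⟨h', φ', D', -⟩ := D.rename_one hi hai
  exact ⟨_, h', φ', D', by simp⟩

theorem NF.card_ess_lt {l : ℕ} {f : Fn V} {w : Finset V} {h : Fn V} {φ : V → Fn V}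
    (D : NF l f w h φ) {i : V} (hi : i ∈ w) : (ess (φ i)).card < (ess f).card := by
  obtain ⟨j, hj, hji⟩ := Finset.exists_mem_ne (s := w) (by have := D.two_le; omega) i
  rw [D.toPre.ess_eq_biUnion]
  apply Finset.card_lt_card
  rw [Finset.ssubset_iff_of_subset (Finset.subset_biUnion_of_mem (fun i => ess (φ i)) hi)]
  exact ⟨j, Finset.mem_biUnion.2 ⟨j, hj, D.mem j hj⟩, fun hji' =>
    Finset.disjoint_left.1 (D.disj i hi j hj hji.symm) hji' (D.mem j hj)⟩

end Decomposition

/-! ### Gates seen on relevance hypercubes; first transfer of modules from `g` to `f` -/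

section Projections

variable {V : Type*} [Fintype V] [DecidableEq V]

/-- All but one variable of each of several functions of disjoint variables can be fixed so that
they become literals. -/
theorem exists_literals {w : Finset V} {χ : V → Fn V}
    (hd : ∀ i ∈ w, ∀ j ∈ w, i ≠ j → Disjoint (ess (χ i)) (ess (χ j)))
    (hm : ∀ i ∈ w, i ∈ ess (χ i)) (e : V → Bool) :
    ∃ q s : V → Bool, (∀ i ∈ w, ∀ b x, x i = (b ^^ s i) →
      (∀ j ∈ ess (χ i), j ≠ i → x j = q j) → χ i x = b) ∧
      ∀ j, (∀ i ∈ w, j ∉ ess (χ i)) → q j = e j := by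
  have hex : ∀ i, ∃ (z : V → Bool) (s : Bool), i ∈ w →
      ∀ b, χ i (Function.update z i (b ^^ s)) = b := by
    intro i
    by_cases hi : i ∈ w
    · obtain ⟨z, s, h⟩ := exists_literal (hm i hi)
      exact ⟨z, s, fun _ => h⟩
    · exact ⟨e, false, fun h => absurd h hi⟩
  choose Z s hZ using hex
  obtain ⟨q, hq, hqe⟩ := exists_glue w (fun i => ess (χ i)) hd Z e
  refine ⟨q, s, fun i hi b x hxi hx => ?_, hqe⟩
  rw [← hZ i hi b]
  refine eq_of_agree fun j hj => ?_
  by_cases hji : j = i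
  · subst hji; simpa using hxi
  · simp [hji, hx j hj hji, hq i hi j hj]

theorem Mod.inter {f : Fn V} {A w : Finset V} (hA : Mod f A) (hw : ess f ⊆ w) :
    Mod f (A ∩ w) := by
  refine hA.subst (fun y j => if j ∈ w then y j else false) false ?_ ?_ ?_
  · intro y
    simp only [Bool.xor_false]
    exact eq_of_agree fun i hi => by simp [hw hi]
  · intro j hj y y' h
    by_cases hjw : j ∈ w
    · simp [hjw, h j (Finset.mem_inter.2 ⟨hj, hjw⟩)]
    · simp [hjw]
  · intro j hj y y' h
    by_cases hjw : j ∈ w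
    · simp [hjw, h j (fun h => hj (Finset.mem_inter.1 h).1)]
    · simp [hjw]

theorem Mod.of_xor {f : Fn V} {A : Finset V} {s : Bool} (h : Mod (fun x => f x ^^ s) A) :
    Mod f A :=
  h.subst id s (by simp) (fun j hj y y' h => h j hj) (fun j hj y y' h => h j hj)

theorem Prime.xor {f : Fn V} (hf : Prime f) (s : Bool) : Prime (fun x => f x ^^ s) := by
  intro I hI hIs hI2
  rw [ess_xor] at hIs ⊢
  exact hf I hI.of_xor hIs hI2

theorem Prime.subset {f : Fn V} {A : Finset V} (hf : Prime f) (hA : Mod f A)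
    (h2 : 2 ≤ (A ∩ ess f).card) : ess f ⊆ A := by
  have := hf _ (hA.inter subset_rfl) Finset.inter_subset_right h2
  rw [← this]; exact Finset.inter_subset_left

/-- `r` is a subfunction of `f` entering `f` through its value only. -/
def Part (f r : Fn V) : Prop :=
  ess r ⊆ ess f ∧ ∃ F : Bool → Fn V, (∀ b, Disjoint (ess (F b)) (ess r)) ∧ ∀ x, f x = F (r x) x

theorem Part.refl (f : Fn V) : Part f f :=
  ⟨subset_rfl, fun b _ => b, fun b => by rw [disjoint_ess_iff]; simp, fun _ => rfl⟩

theorem Part.trans {f r u : Fn V} (h1 : Part f r) (h2 : Part r u) : Part f u := by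
  obtain ⟨hs, F, hF, hf⟩ := h1
  obtain ⟨hs', G, hG, hr⟩ := h2
  refine ⟨hs'.trans hs, fun b x => F (G b x) x, fun b => ?_, fun x => by rw [hf, hr]⟩
  rw [disjoint_ess_iff]
  intro x y hxy
  have e1 : G b x = G b y := disjoint_ess_iff.1 (hG b) _ _ hxy
  have e2 : F (G b y) x = F (G b y) y :=
    disjoint_ess_iff.1 (hF _) _ _ fun i hi => hxy i fun h => hi (hs' h)
  simp only [e1, e2]

theorem Part.mod {f r : Fn V} (h : Part f r) : Mod f (ess r) := by
  obtain ⟨-, F, hF, hf⟩ := h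
  exact ⟨r, F, subset_rfl, hF, hf⟩

theorem Part.exists_relevant {f r : Fn V} (h : Part f r) (hne : (ess r).Nonempty) :
    ∃ F : Bool → Fn V, (∀ b, Disjoint (ess (F b)) (ess r)) ∧ (∀ x, f x = F (r x) x) ∧
      ∃ e, F false e ≠ F true e := by
  obtain ⟨hs, F, hF, hf⟩ := h
  refine ⟨F, hF, hf, ?_⟩
  obtain ⟨i, hi⟩ := hne
  obtain ⟨x, hx⟩ := exists_ne_of_mem_ess (hs hi)
  have hFe : ∀ b, F b (Function.update x i true) = F b (Function.update x i false) := by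
    intro b
    refine disjoint_ess_iff.1 (hF b) _ _ fun j hj => ?_
    have : j ≠ i := fun e => hj (e ▸ hi)
    simp [this]
  rw [hf, hf, hFe] at hx
  refine ⟨Function.update x i false, ?_⟩
  revert hx
  cases r (Function.update x i false) <;> cases r (Function.update x i true) <;> simp [eq_comm]

/-- Outside `r`, freeze the inputs at a point where the context is sensitive to the value of `r`;
there `f` is `r` up to negation. -/
theorem Part.sep {f r : Fn V} (h : Part f r) {T : Finset V} {p : V → Bool}
    (hT : T ⊆ ess (res r T p)) : ∃ p', T ⊆ ess (res f T p') := by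
  rcases T.eq_empty_or_nonempty with rfl | hne
  · exact ⟨p, by simp⟩
  have hTr : T ⊆ ess r := hT.trans (ess_res_subset_right _ _ _)
  obtain ⟨F, hF, hf, e, he⟩ := h.exists_relevant (hne.mono hTr)
  refine ⟨(ess r).piecewise p e, ?_⟩
  have : res f T ((ess r).piecewise p e) = fun x => res r T p x ^^ F false e := by
    funext x
    simp only [res]
    rw [hf]
    have e1 : r (T.piecewise x ((ess r).piecewise p e)) = r (T.piecewise x p) := by
      refine eq_of_agree fun j hj => ?_
      by_cases hjT : j ∈ T <;> simp [hjT, hj]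
    rw [e1, disjoint_ess_iff.1 (hF _) _ e]
    · revert he
      cases r (T.piecewise x p) <;> cases F false e <;> cases F true e <;> simp
    · intro i hi
      have : i ∉ T := fun h => hi (hTr h)
      simp [this, hi]
  rw [this, ess_xor]
  exact hT

/-- With everything outside `r` frozen, the context is a function of one bit. It is not constant,
hence the identity or the negation. -/
theorem Part.res {f r : Fn V} (h : Part f r) {T : Finset V} (hTr : T ⊆ ess r) {p : V → Bool}
    (hne : (ess (res f T p)).Nonempty) :
    ∃ s, ∀ x, ReadOnce.res f T p x = (ReadOnce.res r T p x ^^ s) := by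
  obtain ⟨-, F, hF, hf⟩ := h
  have key : ∀ x, ReadOnce.res f T p x = F (ReadOnce.res r T p x) p := by
    intro x
    simp only [ReadOnce.res]
    rw [hf]
    refine disjoint_ess_iff.1 (hF _) _ _ fun i hi => ?_
    have : i ∉ T := fun h => hi (hTr h)
    simp [this]
  obtain ⟨i, hi⟩ := hne
  obtain ⟨x, hx⟩ := exists_ne_of_mem_ess hi
  rw [key, key] at hx
  refine ⟨F false p, fun y => ?_⟩
  rw [key]
  revert hx
  cases ReadOnce.res r T p (Function.update x i false) <;>
    cases ReadOnce.res r T p (Function.update x i true) <;> cases ReadOnce.res r T p y <;>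
    cases F false p <;> cases F true p <;> simp

/-- A gate applied to functions of disjoint variables, named after one of their variables. -/
structure Dec (f : Fn V) (w : Finset V) (h : Fn V) (χ : V → Fn V) : Prop where
  eq : ∀ x, f x = h fun i => χ i x
  ess_eq : ess h = w
  disj : ∀ i ∈ w, ∀ j ∈ w, i ≠ j → Disjoint (ess (χ i)) (ess (χ j))
  mem : ∀ i ∈ w, i ∈ ess (χ i)

theorem NF.dec {l : ℕ} {f : Fn V} {w : Finset V} {h : Fn V} {φ : V → Fn V}
    (D : NF l f w h φ) : Dec f w h φ :=
  ⟨D.eq, D.ess_eq, D.disj, D.mem⟩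

theorem Dec.ess_biUnion {f : Fn V} {w : Finset V} {h : Fn V} {χ : V → Fn V}
    (D : Dec f w h χ) : ess f = w.biUnion fun i => ess (χ i) := by
  have := ess_comp (h := h) (φ := χ) (by rw [D.ess_eq]; exact D.disj)
    (by rw [D.ess_eq]; exact fun i hi => ⟨i, D.mem i hi⟩)
  rw [D.ess_eq] at this
  rw [← this]
  congr 1
  funext x
  exact D.eq x

theorem Dec.part {f : Fn V} {w : Finset V} {h : Fn V} {χ : V → Fn V} (D : Dec f w h χ) {i : V}
    (hi : i ∈ w) : Part f (χ i) := by
  refine ⟨?_, fun b x => h (Function.update (fun k => χ k x) i b), fun b => ?_, fun x => ?_⟩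
  · rw [D.ess_biUnion]
    exact Finset.subset_biUnion_of_mem (fun i => ess (χ i)) hi
  · rw [disjoint_ess_iff]
    intro x y hxy
    refine eq_of_agree fun k hk => ?_
    rw [D.ess_eq] at hk
    by_cases hki : k = i
    · subst hki; simp
    · simp only [Function.update_of_ne hki]
      exact eq_of_agree fun j hj => hxy j (Finset.disjoint_left.1 (D.disj k hk i hi hki) hj)
  · rw [D.eq]
    congr 1
    funext k
    by_cases hki : k = i
    · subst hki; simp
    · simp [hki]

/-- Once all variables except the names are frozen so that the arguments are literals, what remains
is the gate with some inputs negated. -/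
theorem Dec.sep {f : Fn V} {w : Finset V} {h : Fn V} {χ : V → Fn V} (D : Dec f w h χ) :
    ∃ p, w ⊆ ess (res f w p) := by
  obtain ⟨q, s, hq, -⟩ := exists_literals D.disj D.mem (fun _ => false)
  refine ⟨q, fun i hi => ?_⟩
  obtain ⟨y, hy⟩ := exists_ne_of_mem_ess (D.ess_eq ▸ hi : i ∈ ess h)
  have e : ∀ b, res f w q (fun j => Function.update y i b j ^^ s j) =
      h (Function.update y i b) := by
    intro b
    simp only [res]
    rw [D.eq]
    refine eq_of_agree fun k hk => ?_
    rw [D.ess_eq] at hk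
    refine hq k hk _ _ (by simp [hk]) fun j hj hjk => ?_
    have : j ∉ w := fun hjw =>
      Finset.disjoint_left.1 (D.disj k hk j hjw (Ne.symm hjk)) hj (D.mem j hjw)
    simp [this]
  rw [← e, ← e] at hy
  exact mem_ess_of_ne hy fun j hj => by simp [hj]

/-- Modules of a function are inherited by a gate, if the variables naming its arguments are
essential. -/
theorem Mod.gate {R h : Fn V} {F : Bool → Fn V} {w M : Finset V} {χ : V → Fn V} {A : V → Finset V}
    (hR : ∀ x, R x = F (h fun i => χ i x) x) (hA : ∀ i ∈ w, ess (χ i) ⊆ A i)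
    (hF : ∀ b, ∀ i ∈ w, Disjoint (ess (F b)) (A i))
    (hd : ∀ i ∈ w, ∀ j ∈ w, i ≠ j → Disjoint (A i) (A j)) (hm : ∀ i ∈ w, i ∈ A i)
    (hh : ess h ⊆ w) (hw : w ⊆ ess R) (hM : Mod R M) : Mod h (M ∩ w) := by
  rcases w.eq_empty_or_nonempty with rfl | ⟨a, ha⟩
  · exact ⟨fun _ => false, fun _ => h, by rw [ess_subset_iff]; simp, by simp, fun _ => rfl⟩
  have hrel : ∀ i ∈ w, i ∈ ess (χ i) ∧ ∃ e, F false e ≠ F true e := by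
    intro i hi
    obtain ⟨x, hx⟩ := exists_ne_of_mem_ess (hw hi)
    have hFe : ∀ b, F b (Function.update x i true) = F b (Function.update x i false) := by
      intro b
      refine disjoint_ess_iff.1 (hF b i hi) _ _ fun j hj => ?_
      have : j ≠ i := fun e => hj (e ▸ hm i hi)
      simp [this]
    rw [hR, hR, hFe] at hx
    have hne : (h fun k => χ k (Function.update x i false)) ≠
        (h fun k => χ k (Function.update x i true)) := fun e => hx (by rw [e])
    constructor
    · obtain ⟨k, hk, hkne⟩ := exists_mem_ess_of_ne hne
      have hkw := hh hk
      have : i ∈ ess (χ k) := mem_ess_of_ne hkne fun j hj => by simp [hj]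
      by_cases hki : k = i
      · exact hki ▸ this
      · exact absurd (hm i hi)
          (Finset.disjoint_left.1 (hd k hkw i hi hki) (hA k hkw this))
    · refine ⟨Function.update x i false, fun he => hx ?_⟩
      revert he
      cases (h fun k => χ k (Function.update x i false)) <;>
        cases (h fun k => χ k (Function.update x i true)) <;> simp [eq_comm]
  obtain ⟨-, e, he⟩ := hrel a ha
  obtain ⟨q, s, hq, hqe⟩ := exists_literals (w := w) (χ := χ)
    (fun i hi j hj hij => (hd i hi j hj hij).mono (hA i hi) (hA j hj)) (fun i hi => (hrel i hi).1)
    e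
  -- On the blocks `A i` keep the values that produce literals, elsewhere the point `e` at which the
  -- context is sensitive; on such inputs `R` is the gate up to negations.
  obtain ⟨q', hq', hq'e⟩ := exists_glue w A hd (fun _ => q) e
  refine hM.subst (fun y j => if j ∈ w then y j ^^ s j else q' j) (F false e) ?_ ?_ ?_
  · intro y
    rw [hR]
    have e1 : (h fun i => χ i fun j => if j ∈ w then y j ^^ s j else q' j) = h y := by
      refine eq_of_agree fun i hi => ?_
      have hiw := hh hi
      refine hq i hiw _ _ (by simp [hiw]) fun j hj hji => ?_
      have : j ∉ w := fun hjw =>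
        Finset.disjoint_left.1 (hd i hiw j hjw (Ne.symm hji)) (hA i hiw hj) (hm j hjw)
      simp [this, hq' i hiw j (hA i hiw hj)]
    rw [e1]
    have e2 : ∀ b, F b (fun j => if j ∈ w then y j ^^ s j else q' j) = F b e := by
      intro b
      refine eq_of_agree fun j hj => ?_
      have hjA : ∀ i ∈ w, j ∉ A i := fun i hi => Finset.disjoint_left.1 (hF b i hi) hj
      have : j ∉ w := fun hjw => hjA j hjw (hm j hjw)
      simp [this, hq'e j hjA]
    rw [e2]
    revert he
    cases h y <;> cases F false e <;> cases F true e <;> simp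
  · intro j hj y y' hyy
    by_cases hjw : j ∈ w
    · simp [hjw, hyy j (Finset.mem_inter.2 ⟨hj, hjw⟩)]
    · simp [hjw]
  · intro j hj y y' hyy
    by_cases hjw : j ∈ w
    · simp [hjw, hyy j (fun h => hj (Finset.mem_inter.1 h).1)]
    · simp [hjw]

/-- `f` and `g` agree on at least one relevance hypercube of `f` for each set of `l` variables that
has one. -/
def Agree (l : ℕ) (f g : Fn V) : Prop :=
  ∀ w : Finset V, w.card = l → (∃ p, w ⊆ ess (res f w p)) →
    ∃ p, w ⊆ ess (res f w p) ∧ res f w p = res g w p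

theorem Agree.extend {l : ℕ} {f g : Fn V} (h : Agree l f g) (hl : l ≤ (ess f).card)
    {T : Finset V} (hT : ∃ p, T ⊆ ess (res f T p)) (hTl : T.card ≤ l) :
    ∃ w p, T ⊆ w ∧ w.card = l ∧ w ⊆ ess (res f w p) ∧ res f w p = res g w p := by
  obtain ⟨p, hp⟩ := hT
  obtain ⟨w, hTw, hwc, hw⟩ := exists_superset_res hp hTl hl
  obtain ⟨p', hp', he⟩ := h w hwc hw
  exact ⟨w, p', hTw, hwc, hp', he⟩

/-- The hypercube on which `w` sees the gate extends to dimension `l`, where `f` and `g` agree. The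
module of `g` survives the restriction, and the restricted function is also one built from the gate
of `f`, so `Mod.gate` applies. -/
theorem Agree.mod_gate {l : ℕ} {f g r h : Fn V} {w M : Finset V} {χ : V → Fn V}
    (hfg : Agree l f g) (hl : l ≤ (ess f).card) (hr : Part f r) (D : Dec r w h χ)
    (hw : w.card ≤ l) (hM : Mod g M) : Mod h (M ∩ w) := by
  obtain ⟨p₀, hp₀⟩ := D.sep
  obtain ⟨w', p, hww', -, hp, he⟩ := hfg.extend hl (hr.sep hp₀) hw
  obtain ⟨-, F, hF, hf⟩ := hr
  have hR : ∀ x, res f w' p x = res (F (h fun i => res (χ i) w' p x)) w' p x := by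
    intro x
    simp only [res]
    rw [hf, D.eq]
  refine Mod.gate (R := res f w' p) (F := fun b => res (F b) w' p) (A := fun i => ess (χ i)) hR
    (fun i _ => ess_res_subset_right _ _ _) (fun b i hi => ?_) D.disj D.mem D.ess_eq.subset
    (hww'.trans hp) (he ▸ hM.res w' p)
  refine (hF b).mono (ess_res_subset_right _ _ _) ?_
  rw [D.ess_biUnion]
  exact Finset.subset_biUnion_of_mem (fun i => ess (χ i)) hi

/-- All variables of a relevance hypercube on which a read-once function is prime of maximal arity
feed different arguments of one gate. -/
theorem prime_res_of_ro {l : ℕ} (hl : 2 ≤ l) {G : Fn V} (hG : RO l G) {w : Finset V} (hwl : w.card = l)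
    {p p' : V → Bool} (hp : w ⊆ ess (res G w p)) (hprime : Prime (res G w p))
    (hp' : w ⊆ ess (res G w p')) : Prime (res G w p') := by
  induction hn : (ess G).card using Nat.strong_induction_on generalizing G with
  | _ n ih =>
  subst hn
  have hwG : w ⊆ ess G := hp.trans (ess_res_subset_right _ _ _)
  have hwne : w.Nonempty := Finset.card_pos.1 (by omega)
  obtain ⟨w₀, h₀, φ₀, D₀⟩ := hG.exists_nf
    (by have := Finset.card_le_card hwG; omega)
  by_cases hcase : ∃ i ∈ w₀, w ⊆ ess (φ₀ i)
  · obtain ⟨i, hi, hwi⟩ := hcase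
    have hpart := D₀.dec.part hi
    obtain ⟨s, hs⟩ := hpart.res hwi (hwne.mono hp)
    obtain ⟨s', hs'⟩ := hpart.res hwi (hwne.mono hp')
    have e1 : res G w p = fun x => res (φ₀ i) w p x ^^ s := funext hs
    have e2 : res G w p' = fun x => res (φ₀ i) w p' x ^^ s' := funext hs'
    rw [e1] at hprime
    rw [e1, ess_xor] at hp
    rw [e2, ess_xor] at hp'
    rw [e2]
    refine (ih _ (D₀.card_ess_lt hi) (D₀.ro i hi) hp ?_ hp' rfl).xor s'
    have := hprime.xor s
    simpa using this
  · have hess : ess (res G w p) = w := (ess_res_subset_left _ _ _).antisymm hp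
    -- An argument of the gate is a module. Containing two variables of `w`, it would contain all of
    -- `w` by primality of the restriction at `p`, which is the excluded case.
    have hone : ∀ i ∈ w₀, ∀ j ∈ w, ∀ k ∈ w, j ∈ ess (φ₀ i) → k ∈ ess (φ₀ i) → j = k := by
      intro i hi j hj k hk hji hki
      by_contra hjk
      refine hcase ⟨i, hi, ?_⟩
      have hsub := hprime.subset ((D₀.dec.part hi).mod.res w p) ?_
      · rwa [hess] at hsub
      · rw [hess]
        have : ({j, k} : Finset V) ⊆ ess (φ₀ i) ∩ w := by
          intro m hm
          simp only [Finset.mem_insert, Finset.mem_singleton] at hm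
          rcases hm with rfl | rfl
          · exact Finset.mem_inter.2 ⟨hji, hj⟩
          · exact Finset.mem_inter.2 ⟨hki, hk⟩
        have := Finset.card_le_card this
        rwa [Finset.card_pair hjk] at this
    have hex : ∀ j, ∃ i, j ∈ w → i ∈ w₀ ∧ j ∈ ess (φ₀ i) := by
      intro j
      by_cases hj : j ∈ w
      · have := hwG hj
        rw [D₀.dec.ess_biUnion] at this
        obtain ⟨i, hi, hji⟩ := Finset.mem_biUnion.1 this
        exact ⟨i, fun _ => ⟨hi, hji⟩⟩
      · exact ⟨j, fun h => absurd h hj⟩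
    choose r hr using hex
    have hrinj : Set.InjOn r w := by
      intro j hj k hk hjk
      exact hone (r j) (hr j hj).1 j hj k hk (hr j hj).2 (hjk ▸ (hr k hk).2)
    -- Here the dimension matters: `w` has `l` elements and the gate at most `l` arguments, so the
    -- injection `r` is onto. Hence `w` can name the arguments, and modules of any relevant
    -- restriction to `w` pass to the prime gate.
    have himg : w.image r = w₀ := by
      apply Finset.eq_of_subset_of_card_le
      · intro i hi
        obtain ⟨j, hj, rfl⟩ := Finset.mem_image.1 hi
        exact (hr j hj).1
      · rw [Finset.card_image_of_injOn hrinj, hwl]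
        exact D₀.card_le
    have hex' : ∀ i, ∃ j, i ∈ w₀ → j ∈ w ∧ r j = i := by
      intro i
      by_cases hi : i ∈ w₀
      · rw [← himg] at hi
        obtain ⟨j, hj, hji⟩ := Finset.mem_image.1 hi
        exact ⟨j, fun _ => ⟨hj, hji⟩⟩
      · exact ⟨i, fun h => absurd h hi⟩
    choose t ht using hex'
    obtain ⟨h₁, φ₁, D, -⟩ := D₀.toPre.rename D₀.prime t (by
      intro i hi
      have := (hr _ (ht i hi).1).2
      rwa [(ht i hi).2] at this)
    have himg' : w₀.image t = w := by
      ext j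
      rw [Finset.mem_image]
      constructor
      · rintro ⟨i, hi, rfl⟩; exact (ht i hi).1
      · intro hj
        refine ⟨r j, (hr j hj).1, ?_⟩
        have := ht (r j) (hr j hj).1
        exact hrinj this.1 hj this.2
    rw [himg'] at D
    intro I hI hIs hI2
    have hess' : ess (res G w p') = w := (ess_res_subset_left _ _ _).antisymm hp'
    rw [hess'] at hIs ⊢
    have hmod : Mod h₁ (I ∩ w) := by
      refine Mod.gate (R := res G w p') (F := fun b _ => b) (χ := fun i => res (φ₁ i) w p')
        (A := fun i => ess (φ₁ i)) ?_ (fun i _ => ess_res_subset_right _ _ _) ?_ D.disj D.mem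
        D.ess_eq.subset hp' hI
      · intro x
        simp only [res]
        rw [D.eq]
      · intro b i _
        rw [disjoint_ess_iff]; simp
    rw [Finset.inter_eq_left.2 hIs] at hmod
    have := D.prime I hmod (by rw [D.ess_eq]; exact hIs) hI2
    rw [this, D.ess_eq]

/-- A module of `g` meeting two arguments of a prime gate of `f` of arity at least three contains
all variables below the gate. -/
theorem Agree.ess_subset_of_prime {l : ℕ} {f g r h : Fn V} {w M : Finset V} {φ : V → Fn V}
    (hfg : Agree l f g) (hl : l ≤ (ess f).card) (hM : Mod g M) (hr : Part f r)
    (D : NF l r w h φ) (h3 : 3 ≤ w.card) {i₁ i₂ a₁ a₂ : V} (hi₁ : i₁ ∈ w) (hi₂ : i₂ ∈ w)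
    (hne : i₁ ≠ i₂) (ha₁M : a₁ ∈ M) (ha₂M : a₂ ∈ M) (ha₁ : a₁ ∈ ess (φ i₁))
    (ha₂ : a₂ ∈ ess (φ i₂)) : ess r ⊆ M := by
  have key : ∀ (w : Finset V) (h : Fn V) (φ : V → Fn V), NF l r w h φ →
      2 ≤ (M ∩ w).card → w ⊆ M := by
    intro w h φ D h2
    have := D.prime.subset (hfg.mod_gate hl hr D.dec D.card_le hM)
      (by rw [D.ess_eq, Finset.inter_assoc, Finset.inter_self]; exact h2)
    rw [D.ess_eq] at this
    exact this.trans Finset.inter_subset_left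
  obtain ⟨h', φ', D', hφ'⟩ := D.toPre.rename D.prime
    (Function.update (Function.update id i₁ a₁) i₂ a₂) (by
      intro k hk
      by_cases h2 : k = i₂
      · subst h2; simpa using ha₂
      · by_cases h1 : k = i₁
        · subst h1; simpa [h2] using ha₁
        · simpa [h1, h2] using D.mem k hk)
  set t := Function.update (Function.update id i₁ a₁) i₂ a₂ with ht
  have ht1 : t i₁ = a₁ := by simp [ht, hne]
  have ht2 : t i₂ = a₂ := by simp [ht]
  have hane : a₁ ≠ a₂ := by
    rintro rfl
    exact Finset.disjoint_left.1 (D.disj i₁ hi₁ i₂ hi₂ hne) ha₁ ha₂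
  have hw' : w.image t ⊆ M := by
    apply key _ _ _ D'
    have : ({a₁, a₂} : Finset V) ⊆ M ∩ w.image t := by
      intro m hm
      simp only [Finset.mem_insert, Finset.mem_singleton] at hm
      rcases hm with rfl | rfl
      · exact Finset.mem_inter.2 ⟨ha₁M, Finset.mem_image.2 ⟨i₁, hi₁, ht1⟩⟩
      · exact Finset.mem_inter.2 ⟨ha₂M, Finset.mem_image.2 ⟨i₂, hi₂, ht2⟩⟩
    have := Finset.card_le_card this
    rwa [Finset.card_pair hane] at this
  have hinj : Set.InjOn t w := by
    intro i hi j hj hij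
    by_contra hne
    have h1 := D'.mem (t i) (Finset.mem_image_of_mem t hi)
    rw [hφ' i hi] at h1
    have h2 := D'.mem (t j) (Finset.mem_image_of_mem t hj)
    rw [hφ' j hj] at h2
    exact Finset.disjoint_left.1 (D.disj i hi j hj hne) h1 (hij ▸ h2)
  have hc' : 3 ≤ (w.image t).card := by rwa [Finset.card_image_of_injOn hinj]
  -- Exchange one representative for an arbitrary variable `j` of the same argument. As the arity is
  -- at least three, two other representatives remain in `M`, and primality forces `j` into `M`.
  intro j hj
  rw [D'.dec.ess_biUnion] at hj
  obtain ⟨i, hi, hji⟩ := Finset.mem_biUnion.1 hj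
  obtain ⟨h'', φ'', D'', -⟩ := D'.rename_one hi hji
  apply key _ _ _ D'' _ (Finset.mem_insert_self _ _)
  have hsub : (w.image t).erase i ⊆ M ∩ insert j ((w.image t).erase i) := by
    intro m hm
    exact Finset.mem_inter.2 ⟨hw' (Finset.mem_of_mem_erase hm), Finset.mem_insert_of_mem hm⟩
  have := Finset.card_le_card hsub
  rw [Finset.card_erase_of_mem hi] at this
  omega

/-- A set of variables which is a module wherever `f` and `g` are known to agree is separable in
`f`. -/
theorem Agree.sep_module {l : ℕ} {f g r : Fn V} {M : Finset V} (hfg : Agree l f g)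
    (hl : l ≤ (ess f).card) (hM : Mod g M) (hro : RO l r) (hr : Part f r) :
    ∃ p, M ∩ ess r ⊆ ess (res r (M ∩ ess r) p) := by
  induction hn : (ess r).card using Nat.strong_induction_on generalizing r with
  | _ n ih =>
  subst hn
  by_cases hsub : ess r ⊆ M
  · refine ⟨fun _ => false, ?_⟩
    rw [Finset.inter_eq_right.2 hsub, res_of_ess_subset subset_rfl]
  rcases Nat.lt_or_ge (ess r).card 2 with hlt | hge
  · have : M ∩ ess r = ∅ := by
      by_contra hne
      obtain ⟨i, hi⟩ := Finset.nonempty_iff_ne_empty.2 hne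
      rw [Finset.mem_inter] at hi
      refine hsub fun j hj => ?_
      rw [Finset.card_le_one.1 (by omega : (ess r).card ≤ 1) j hj i hi.2]
      exact hi.1
    exact ⟨fun _ => false, by simp [this]⟩
  obtain ⟨w, h, φ, D⟩ := hro.exists_nf hge
  by_cases hone : ∃ i ∈ w, M ∩ ess r ⊆ ess (φ i)
  · obtain ⟨i, hi, hMi⟩ := hone
    have hpart := D.dec.part hi
    obtain ⟨p, hp⟩ := ih _ (D.card_ess_lt hi) (D.ro i hi) (hr.trans hpart) rfl
    have e : M ∩ ess (φ i) = M ∩ ess r := by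
      apply Finset.Subset.antisymm
      · exact Finset.inter_subset_inter_left hpart.1
      · exact Finset.subset_inter Finset.inter_subset_left hMi
    rw [e] at hp
    exact hpart.sep hp
  push Not at hone
  have htwo : ∀ i ∈ w, ∃ j ∈ w, j ≠ i ∧ ∃ a ∈ M, a ∈ ess (φ j) := by
    intro i hi
    obtain ⟨a, ha, hai⟩ := Finset.not_subset.1 (hone i hi)
    rw [Finset.mem_inter, D.dec.ess_biUnion, Finset.mem_biUnion] at ha
    obtain ⟨haM, j, hj, haj⟩ := ha
    exact ⟨j, hj, fun e => hai (e ▸ haj), a, haM, haj⟩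
  obtain ⟨i₀, hi₀⟩ : w.Nonempty := Finset.card_pos.1 (by have := D.two_le; omega)
  obtain ⟨i₁, hi₁, -, a₁, ha₁M, ha₁⟩ := htwo i₀ hi₀
  obtain ⟨i₂, hi₂, hi₂₁, a₂, ha₂M, ha₂⟩ := htwo i₁ hi₁
  -- A larger gate met in two arguments would put all of `r` into `M`. So the gate is binary and `M`
  -- meets both arguments; separating points of the arguments can be glued, neither argument
  -- becoming constant.
  have hw2 : w.card = 2 := by
    by_contra hne
    have := D.two_le
    exact hsub (hfg.ess_subset_of_prime hl hM hr D (by omega) hi₁ hi₂ hi₂₁.symm ha₁M ha₂M ha₁ ha₂)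
  have hw : w = {i₁, i₂} := by
    refine (Finset.eq_of_subset_of_card_le ?_ ?_).symm
    · intro m hm
      simp only [Finset.mem_insert, Finset.mem_singleton] at hm
      rcases hm with rfl | rfl <;> assumption
    · rw [Finset.card_pair hi₂₁.symm, hw2]
  have hall : ∀ i ∈ w, ∃ a ∈ M, a ∈ ess (φ i) := by
    intro i hi
    rw [hw] at hi
    simp only [Finset.mem_insert, Finset.mem_singleton] at hi
    rcases hi with rfl | rfl
    · exact ⟨a₁, ha₁M, ha₁⟩
    · exact ⟨a₂, ha₂M, ha₂⟩
  have hex : ∀ i, ∃ p, i ∈ w → M ∩ ess (φ i) ⊆ ess (res (φ i) (M ∩ ess (φ i)) p) := by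
    intro i
    by_cases hi : i ∈ w
    · obtain ⟨p, hp⟩ := ih _ (D.card_ess_lt hi) (D.ro i hi) (hr.trans (D.dec.part hi)) rfl
      exact ⟨p, fun _ => hp⟩
    · exact ⟨fun _ => false, fun h => absurd h hi⟩
  choose P hP using hex
  obtain ⟨p, hp, -⟩ := exists_glue w (fun i => ess (φ i)) D.disj P (fun _ => false)
  refine ⟨p, ?_⟩
  have hpart : ∀ i ∈ w, res (φ i) (M ∩ ess r) p = res (φ i) (M ∩ ess (φ i)) (P i) := by
    intro i hi
    funext x
    refine eq_of_agree (f := φ i) fun j hj => ?_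
    have hjr : j ∈ ess r := (D.dec.part hi).1 hj
    by_cases hjM : j ∈ M <;> simp [hjM, hj, hjr, hp i hi j hj]
  have hres : res r (M ∩ ess r) p = fun x => h fun i => res (φ i) (M ∩ ess r) p x := by
    funext x
    simp only [res]
    rw [D.eq]
  rw [hres, ess_comp (h := h) (φ := fun i => res (φ i) (M ∩ ess r) p)]
  · intro j hj
    rw [Finset.mem_inter, D.dec.ess_biUnion] at hj
    obtain ⟨hjM, hj⟩ := hj
    obtain ⟨i, hi, hji⟩ := Finset.mem_biUnion.1 hj
    refine Finset.mem_biUnion.2 ⟨i, D.ess_eq.symm ▸ hi, ?_⟩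
    rw [hpart i hi]
    exact hP i hi (Finset.mem_inter.2 ⟨hjM, hji⟩)
  · rw [D.ess_eq]
    intro i hi j hj hij
    exact (D.disj i hi j hj hij).mono (ess_res_subset_right _ _ _) (ess_res_subset_right _ _ _)
  · rw [D.ess_eq]
    intro i hi
    obtain ⟨a, haM, ha⟩ := hall i hi
    rw [hpart i hi]
    exact ⟨a, hP i hi (Finset.mem_inter.2 ⟨haM, ha⟩)⟩

end Projections

/-! ### Two subfunctions combined by a binary operation inside `f` -/

section Contexts

/-- Up to negations, an operation depending on both arguments is a sum (an even number of ones) or a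
conjunction (an odd number). A conjunction has a value `c` of the second argument that blocks the
first one. -/
theorem binary_cases (op : Bool → Bool → Bool) (h1 : ∃ c, op false c ≠ op true c)
    (h2 : ∃ a, op a false ≠ op a true) :
    (∃ e, ∀ a c, op a c = (a ^^ c ^^ e)) ∨
      ∃ c, op false c = op true c ∧ op false (!c) ≠ op true (!c) := by
  revert op
  decide

/-- For `b = c` the left side is constant, so `K` is constant at the single value that `v` takes
there; for `b = !c` the left side determines `h`. Choosing `a` with `v a (!c)` equal to that single
value makes `h a` constant and `v a` insensitive to `b`. -/
theorem overlap_odd {Z : Type*} {op v : Bool → Bool → Bool} {h K : Bool → Z → Bool} {c : Bool}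
    (hc : op false c = op true c) (hc' : op false (!c) ≠ op true (!c))
    (heq : ∀ a b z, op (h a z) b = K (v a b) z) (hdep : ∃ z, h false z ≠ h true z) :
    ∃ a, v a false = v a true ∧ ∀ z z', h a z = h a z' := by
  obtain ⟨z₀, hz₀⟩ := hdep
  have hconst : ∀ a, op a c = op false c := by intro a; cases a <;> simp [hc]
  have hK : ∀ a z, K (v a c) z = op false c := fun a z => by rw [← heq, hconst]
  have hinj : ∀ a a', op a (!c) = op a' (!c) → a = a' := by
    intro a a' h
    cases a <;> cases a' <;> simp_all
  have hv : v false (!c) ≠ v true (!c) := by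
    intro he
    exact hz₀ (hinj _ _ (by rw [heq, heq, he]))
  have hv' : v true c = v false c := by
    by_contra hne
    have hall : ∀ b z, K b z = op false c := by
      intro b z
      by_cases hb : b = v false c
      · rw [hb, hK]
      · have : b = v true c := by
          revert hb hne
          cases b <;> cases v false c <;> cases v true c <;> simp
        rw [this, hK]
    exact hz₀ (hinj _ _ (by rw [heq, heq, hall, hall]))
  obtain ⟨a, ha⟩ : ∃ a, v a (!c) = v false c := by
    revert hv
    cases h1 : v false (!c) <;> cases h2 : v true (!c) <;> cases h3 : v false c <;> simp [h1, h2]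
  have hac : v a c = v false c := by cases a <;> simp [hv']
  refine ⟨a, ?_, fun z z' => hinj _ _ ?_⟩
  · cases c
    · exact hac.trans ha.symm
    · exact ha.trans hac.symm
  · rw [heq, heq, ha, hK, hK]

/-- Flipping either bit at (false, false) changes `v`, which has two values only, so `v` is the same
after either flip. Flipping `b` negates the left side; hence flipping `a` does so too, which means
that it negates `h`. -/
theorem overlap_even {Z : Type*} {op v : Bool → Bool → Bool} {h K : Bool → Z → Bool} {e : Bool}
    (hop : ∀ a c, op a c = (a ^^ c ^^ e))
    (heq : ∀ a b z, op (h a z) b = K (v a b) z) (hdep : ∃ z, h false z ≠ h true z) (z : Z) :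
    h true z = !h false z := by
  obtain ⟨z₀, hz₀⟩ := hdep
  have h00 := heq false false
  have h01 := heq false true
  have h10 := heq true false
  simp only [hop] at h00 h01 h10
  have e1 : v false false ≠ v false true := by
    intro he
    have := (h00 z₀).trans ((by rw [he]) : K (v false false) z₀ = K (v false true) z₀)
    rw [← h01] at this
    simp at this
  have e2 : v false false ≠ v true false := by
    intro he
    have := (h00 z₀).trans ((by rw [he]) : K (v false false) z₀ = K (v true false) z₀)
    rw [← h10] at this
    exact hz₀ (by simpa using this)
  have e3 : v false true = v true false := by
    revert e1 e2
    cases v false false <;> cases v false true <;> cases v true false <;> simp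
  have := h01 z
  rw [e3, ← h10] at this
  revert this
  cases h false z <;> cases h true z <;> cases e <;> simp

variable {V : Type*} [Fintype V] [DecidableEq V]

/-- `f` contains the subfunctions `ψ` and `φ`, combined, wherever `ψ` is relevant, by the binary
operation `op` up to negations. -/
structure Ctx (op : Bool → Bool → Bool) (f ψ φ : Fn V) (B : Bool → Bool → Fn V) : Prop where
  eq : ∀ x, f x = B (ψ x) (φ x) x
  disj_left : ∀ a b, Disjoint (ess (B a b)) (ess ψ)
  disj_right : ∀ a b, Disjoint (ess (B a b)) (ess φ)
  disj : Disjoint (ess ψ) (ess φ)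
  rel : ∀ e b, B false b e ≠ B true b e → ∃ s₁ s₀, ∀ a b, B a b e = (op (a ^^ s₁) b ^^ s₀)

/-- A context whose first subfunction is a gate. -/
structure GateCtx (op : Bool → Bool → Bool) (f : Fn V) (w : Finset V) (h : Fn V) (χ : V → Fn V)
    (y : V) (B : Bool → Bool → Fn V) (A : V → Finset V) : Prop where
  eq : ∀ x, f x = B (h fun i => χ i x) (χ y x) x
  ess_gate : ess h ⊆ w
  notMem : y ∉ w
  ess_sub : ∀ i ∈ insert y w, ess (χ i) ⊆ A i
  mem : ∀ i ∈ insert y w, i ∈ A i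
  disj : ∀ i ∈ insert y w, ∀ j ∈ insert y w, i ≠ j → Disjoint (A i) (A j)
  disj_ctx : ∀ a b, ∀ i ∈ insert y w, Disjoint (ess (B a b)) (A i)
  rel : ∀ e b, B false b e ≠ B true b e → ∃ s₁ s₀, ∀ a b, B a b e = (op (a ^^ s₁) b ^^ s₀)

theorem Ctx.gateCtx {op : Bool → Bool → Bool} {f ψ φ : Fn V} {B : Bool → Bool → Fn V}
    (C : Ctx op f ψ φ B) {w : Finset V} {h : Fn V} {χ : V → Fn V} (D : Dec ψ w h χ) {y : V}
    (hy : y ∈ ess φ) :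
    GateCtx op f w h (Function.update χ y φ) y B fun i => ess (Function.update χ y φ i) := by
  have hsub : ∀ i ∈ w, ess (χ i) ⊆ ess ψ := fun i hi => (D.part hi).1
  have hyw : y ∉ w := fun hyw => Finset.disjoint_left.1 C.disj (hsub y hyw (D.mem y hyw)) hy
  have hne : ∀ i ∈ w, i ≠ y := fun i hi e => hyw (e ▸ hi)
  refine ⟨fun x => ?_, D.ess_eq.subset, hyw, fun i _ => subset_rfl, ?_, ?_, ?_, C.rel⟩
  · rw [C.eq, D.eq]
    simp only [Function.update_self]
    congr 1
    refine eq_of_agree fun i hi => ?_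
    rw [D.ess_eq] at hi
    simp [hne i hi]
  · intro i hi
    rcases Finset.mem_insert.1 hi with rfl | hi
    · simpa using hy
    · simpa [hne i hi] using D.mem i hi
  · intro i hi j hj hij
    rcases Finset.mem_insert.1 hi with rfl | hi
    · rcases Finset.mem_insert.1 hj with rfl | hj
      · exact absurd rfl hij
      · simpa [hne j hj] using (C.disj.mono_left (hsub j hj)).symm
    · rcases Finset.mem_insert.1 hj with rfl | hj
      · simpa [hne i ‹i ∈ w›] using (C.disj.mono_left (hsub i ‹i ∈ w›))
      · simpa [hne i hi, hne j hj] using D.disj i hi j hj hij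
  · intro a b i hi
    rcases Finset.mem_insert.1 hi with rfl | hi
    · simpa using C.disj_right a b
    · simpa [hne i hi] using (C.disj_left a b).mono_right (hsub i hi)

section

variable {op : Bool → Bool → Bool} {f : Fn V} {w : Finset V} {h : Fn V} {χ : V → Fn V} {y : V}
  {B : Bool → Bool → Fn V} {A : V → Finset V}

theorem GateCtx.res (C : GateCtx op f w h χ y B A) (W : Finset V) (p : V → Bool) :
    GateCtx op (res f W p) w h (fun i => res (χ i) W p) y (fun a b => res (B a b) W p) A := by
  refine ⟨fun x => ?_, C.ess_gate, C.notMem,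
    fun i hi => (ess_res_subset_right _ _ _).trans (C.ess_sub i hi), C.mem, C.disj,
    fun a b i hi => (C.disj_ctx a b i hi).mono_left (ess_res_subset_right _ _ _), ?_⟩
  · simp only [ReadOnce.res]
    rw [C.eq]
  · intro e b he
    exact C.rel _ b he

theorem GateCtx.fix (C : GateCtx op f w h χ y B A) {t : V} {c : Bool} (ht : t ∈ w)
    (hc : ∀ x, χ t x = c) :
    GateCtx op f (w.erase t) (fun z => h (Function.update z t c)) χ y B A := by
  have hsub : insert y (w.erase t) ⊆ insert y w :=
    Finset.insert_subset_insert _ (Finset.erase_subset _ _)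
  refine ⟨fun x => ?_, ?_, fun hy => C.notMem (Finset.mem_of_mem_erase hy),
    fun i hi => C.ess_sub i (hsub hi), fun i hi => C.mem i (hsub hi),
    fun i hi j hj => C.disj i (hsub hi) j (hsub hj),
    fun a b i hi => C.disj_ctx a b i (hsub hi), C.rel⟩
  · rw [C.eq]
    congr 2
    funext i
    by_cases hi : i = t
    · subst hi; simp [hc]
    · simp [hi]
  · rw [ess_subset_iff]
    intro x x' hx
    refine eq_of_agree fun i hi => ?_
    by_cases hit : i = t
    · subst hit; simp
    · simp [hit, hx i (Finset.mem_erase.2 ⟨hit, C.ess_gate hi⟩)]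

/-- Freeze everything but the names: the arguments become literals, and the rest of the input sits
at a point where the context is sensitive to the gate. -/
theorem GateCtx.literal (C : GateCtx op f w h χ y B A) (hm : ∀ i ∈ insert y w, i ∈ ess (χ i))
    (hrel : ∃ e b, B false b e ≠ B true b e) :
    ∃ (q s : V → Bool) (s₁ s₀ : Bool), ∀ (z x : V → Bool),
      (∀ j, x j = if j ∈ insert y w then z j ^^ s j else q j) →
      f x = (op (h z ^^ s₁) (z y) ^^ s₀) ∧ ∀ i ∈ insert y w, χ i x = z i := by
  obtain ⟨e, b, he⟩ := hrel
  obtain ⟨s₁, s₀, hs⟩ := C.rel e b he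
  obtain ⟨q, s, hq, -⟩ := exists_literals (w := insert y w) (χ := χ)
    (fun i hi j hj hij => (C.disj i hi j hj hij).mono (C.ess_sub i hi) (C.ess_sub j hj)) hm e
  obtain ⟨q', hq', hqe'⟩ := exists_glue (insert y w) A C.disj (fun _ => q) e
  refine ⟨q', s, s₁, s₀, fun z x hx => ?_⟩
  have hχ : ∀ i ∈ insert y w, χ i x = z i := by
    intro i hi
    refine hq i hi _ _ (by rw [hx, if_pos hi]) fun j hj hji => ?_
    have hjA := C.ess_sub i hi hj
    have : j ∉ insert y w := fun hjw =>
      Finset.disjoint_left.1 (C.disj i hi j hjw (Ne.symm hji)) hjA (C.mem j hjw)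
    rw [hx, if_neg this, hq' i hi j hjA]
  refine ⟨?_, hχ⟩
  rw [C.eq, ← hs, hχ y (Finset.mem_insert_self _ _)]
  have e1 : (h fun i => χ i x) = h z :=
    eq_of_agree fun i hi => hχ i (Finset.mem_insert_of_mem (C.ess_gate hi))
  rw [e1]
  refine eq_of_agree fun j hj => ?_
  have hjA : ∀ i ∈ insert y w, j ∉ A i :=
    fun i hi => Finset.disjoint_left.1 (C.disj_ctx _ _ i hi) hj
  have : j ∉ insert y w := fun hjw => hjA j hjw (C.mem j hjw)
  rw [hx, if_neg this, hqe' j hjA]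

/-- A change of `f` caused by a variable of `w` has to pass through its own argument, the gate and
the context, so each of these is sensitive to it. -/
theorem GateCtx.of_subset_ess (C : GateCtx op f w h χ y B A) (hw : insert y w ⊆ ess f)
    (hne : w.Nonempty) :
    w ⊆ ess h ∧ (∀ i ∈ insert y w, i ∈ ess (χ i)) ∧ ∃ e b, B false b e ≠ B true b e := by
  have hB : ∀ i ∈ insert y w, ∀ x a b,
      B a b (Function.update x i true) = B a b (Function.update x i false) := by
    intro i hi x a b
    refine disjoint_ess_iff.1 (C.disj_ctx a b i hi) _ _ fun j hj => ?_
    have : j ≠ i := fun e => hj (e ▸ C.mem i hi)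
    simp [this]
  have hχ : ∀ i ∈ insert y w, ∀ k ∈ insert y w, k ≠ i → ∀ x,
      χ k (Function.update x i true) = χ k (Function.update x i false) := by
    intro i hi k hk hki x
    refine eq_of_agree fun j hj => ?_
    have : j ≠ i := by
      rintro rfl
      exact Finset.disjoint_left.1 (C.disj k hk j hi hki) (C.ess_sub k hk hj) (C.mem j hi)
    simp [this]
  have hin : ∀ i ∈ w, i ∈ ess h ∧ i ∈ ess (χ i) ∧ ∃ e b, B false b e ≠ B true b e := by
    intro i hi
    have hi' : i ∈ insert y w := Finset.mem_insert_of_mem hi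
    have hyi : y ≠ i := fun e => C.notMem (e ▸ hi)
    obtain ⟨x, hx⟩ := exists_ne_of_mem_ess (hw hi')
    rw [C.eq, C.eq, hB i hi', hχ i hi' y (Finset.mem_insert_self _ _) hyi] at hx
    have hne : (h fun k => χ k (Function.update x i false)) ≠
        h fun k => χ k (Function.update x i true) := fun e => hx (by rw [e])
    obtain ⟨k, hk, hkne⟩ := exists_mem_ess_of_ne hne
    have hki : k = i := by
      by_contra hki
      exact hkne (hχ i hi' k (Finset.mem_insert_of_mem (C.ess_gate hk)) hki x).symm
    subst hki
    refine ⟨hk, mem_ess_of_ne hkne fun j hj => by simp [hj], Function.update x k false,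
      χ y (Function.update x k false), fun he => hx ?_⟩
    revert he
    cases (h fun i => χ i (Function.update x k false)) <;>
      cases (h fun i => χ i (Function.update x k true)) <;> simp [eq_comm]
  obtain ⟨a, ha⟩ := hne
  refine ⟨fun i hi => (hin i hi).1, fun i hi => ?_, (hin a ha).2.2⟩
  rcases Finset.mem_insert.1 hi with rfl | hi'
  · obtain ⟨x, hx⟩ := exists_ne_of_mem_ess (hw hi)
    rw [C.eq, C.eq, hB i hi] at hx
    have e1 : (h fun k => χ k (Function.update x i true)) =
        h fun k => χ k (Function.update x i false) := by
      refine eq_of_agree fun k hk => ?_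
      have hkw := C.ess_gate hk
      exact hχ i hi k (Finset.mem_insert_of_mem hkw) (fun e => C.notMem (e ▸ hkw)) x
    rw [e1] at hx
    have hne : χ i (Function.update x i false) ≠ χ i (Function.update x i true) :=
      fun e => hx (by rw [e])
    exact mem_ess_of_ne hne fun j hj => by simp [hj]
  · exact (hin i hi').2.1

theorem GateCtx.sep (C : GateCtx op f w h χ y B A) (hm : ∀ i ∈ insert y w, i ∈ ess (χ i))
    (hrel : ∃ e b, B false b e ≠ B true b e) (hh : w ⊆ ess h) (hne : w.Nonempty)
    (h1 : ∃ c, op false c ≠ op true c) (h2 : ∃ a, op a false ≠ op a true) :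
    ∃ p, insert y w ⊆ ess (ReadOnce.res f (insert y w) p) := by
  obtain ⟨q, s, s₁, s₀, hq⟩ := C.literal hm hrel
  refine ⟨q, fun i hi => ?_⟩
  have key : ∀ z, ReadOnce.res f (insert y w) q (fun j => z j ^^ s j) =
      (op (h z ^^ s₁) (z y) ^^ s₀) := by
    intro z
    refine (hq z _ fun j => ?_).1
    by_cases hj : j ∈ insert y w
    · rw [Finset.piecewise_eq_of_mem _ _ _ hj, if_pos hj]
    · rw [Finset.piecewise_eq_of_notMem _ _ _ hj, if_neg hj]
  obtain ⟨z, z', hzz, hne⟩ : ∃ z z' : V → Bool, (∀ j, j ≠ i → z j = z' j) ∧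
      op (h z ^^ s₁) (z y) ≠ op (h z' ^^ s₁) (z' y) := by
    rcases Finset.mem_insert.1 hi with rfl | hiw
    · obtain ⟨a, ha⟩ := h2
      obtain ⟨z, hz⟩ := exists_eq_of_ess_nonempty (hne.mono hh) (a ^^ s₁)
      have hz' : ∀ b, h (Function.update z i b) = (a ^^ s₁) := by
        intro b
        rw [← hz]
        refine eq_of_agree fun j hj => ?_
        have : j ≠ i := fun e => C.notMem (e ▸ C.ess_gate hj)
        simp [this]
      refine ⟨Function.update z i false, Function.update z i true, fun j hj => by simp [hj], ?_⟩
      rw [hz', hz']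
      simpa using ha
    · obtain ⟨c, hc⟩ := h1
      obtain ⟨z, hz⟩ := exists_ne_of_mem_ess (hh hiw)
      have hyi : y ≠ i := fun e => C.notMem (e ▸ hiw)
      have hz' : ∀ b, h (Function.update (Function.update z y c) i b) =
          h (Function.update z i b) := by
        intro b
        refine eq_of_agree fun j hj => ?_
        have : j ≠ y := fun e => C.notMem (e ▸ C.ess_gate hj)
        by_cases hji : j = i
        · subst hji; simp
        · simp [this, hji]
      refine ⟨Function.update (Function.update z y c) i false,
        Function.update (Function.update z y c) i true, fun j hj => by simp [hj], ?_⟩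
      rw [hz', hz']
      simp only [Function.update_of_ne hyi, Function.update_self]
      revert hz hc
      cases h (Function.update z i false) <;> cases h (Function.update z i true) <;>
        cases s₁ <;> simp [eq_comm]
  refine mem_ess_of_ne (x := fun j => z j ^^ s j) (y := fun j => z' j ^^ s j) ?_
    fun j hj => by simp [hzz j hj]
  rw [key, key]
  simpa using hne

end

end Contexts

/-! ### A gate of `f` overlapping a two-variable module of `g` -/

section Overlap

variable {V : Type*} [Fintype V] [DecidableEq V]

/-- `g` has the two-variable module `{a, b}` with values given by `v`. -/
structure PairMod (g : Fn V) (a b : V) (v : Bool → Bool → Bool) (G : Bool → Fn V) : Prop where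
  ne : a ≠ b
  disj : ∀ c, Disjoint (ess (G c)) {a, b}
  eq : ∀ x, g x = G (v (x a) (x b)) x

theorem PairMod.congr {g : Fn V} {a b : V} {v : Bool → Bool → Bool} {G : Bool → Fn V}
    (P : PairMod g a b v G) (c : Bool) {x x' : V → Bool}
    (h : ∀ i, i ≠ a → i ≠ b → x i = x' i) : G c x = G c x' :=
  disjoint_ess_iff.1 (P.disj c) _ _ fun i hi => by
    simp only [Finset.mem_insert, Finset.mem_singleton, not_or] at hi
    exact h i hi.1 hi.2

theorem PairMod.res {g : Fn V} {a b : V} {v : Bool → Bool → Bool} {G : Bool → Fn V}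
    (P : PairMod g a b v G) {W : Finset V} (ha : a ∈ W) (hb : b ∈ W) (p : V → Bool) :
    PairMod (res g W p) a b v fun c => res (G c) W p := by
  refine ⟨P.ne, fun c => (P.disj c).mono_left (ess_res_subset_right _ _ _), fun x => ?_⟩
  simp only [ReadOnce.res]
  rw [P.eq]
  simp [ha, hb]

theorem PairMod.mod {g : Fn V} {a b : V} {v : Bool → Bool → Bool} {G : Bool → Fn V}
    (P : PairMod g a b v G) : Mod g {a, b} := by
  refine ⟨fun x => v (x a) (x b), G, ?_, P.disj, P.eq⟩
  rw [ess_subset_iff]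
  intro x y h
  rw [h a (by simp), h b (by simp)]

theorem PairMod.right_relevant {g : Fn V} {a b : V} {v : Bool → Bool → Bool} {G : Bool → Fn V}
    (P : PairMod g a b v G) (hb : b ∈ ess g) : ∃ x : V → Bool, v (x a) false ≠ v (x a) true := by
  obtain ⟨x, hx⟩ := exists_ne_of_mem_ess hb
  refine ⟨x, fun he => hx ?_⟩
  rw [P.eq, P.eq]
  simp only [Function.update_self, Function.update_of_ne P.ne, he]
  exact P.congr _ fun i hi hib => by simp [hib]

theorem PairMod.swap {g : Fn V} {a b : V} {v : Bool → Bool → Bool} {G : Bool → Fn V}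
    (P : PairMod g a b v G) : PairMod g b a (fun s t => v t s) G :=
  ⟨P.ne.symm, fun c => by rw [Finset.pair_comm]; exact P.disj c, P.eq⟩

theorem Mod.pairMod {g : Fn V} {a b : V} (hne : a ≠ b) (h : Mod g {a, b}) :
    ∃ v G, PairMod g a b v G := by
  obtain ⟨u, F, hu, hF, hg⟩ := h
  refine ⟨fun s t => u (Function.update (Function.update (fun _ => false) a s) b t), F, hne, hF,
    fun x => ?_⟩
  rw [hg]
  congr 1
  refine eq_of_agree fun i hi => ?_
  have := hu hi
  simp only [Finset.mem_insert, Finset.mem_singleton] at this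
  rcases this with rfl | rfl
  · simp [hne]
  · simp

/-- `R` is written in two ways, through its gate and through the pair `{a, b}`. With literals as
arguments these give the equation of `overlap_odd` and `overlap_even`. The sign `s` of the literal
in `a` is recorded, since results from different hypercubes are compared later. -/
theorem GateCtx.overlap {op : Bool → Bool → Bool} {R : Fn V} {w : Finset V} {h : Fn V}
    {χ : V → Fn V} {a b : V} {B : Bool → Bool → Fn V} {A : V → Finset V}
    (C : GateCtx op R w h χ b B A) (ha : a ∈ w) (hR : insert b w ⊆ ess R)
    {v : Bool → Bool → Bool} {G : Bool → Fn V} (P : PairMod R a b v G) :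
    ∃ (s : Bool) (x₀ : V → Bool), (∀ c, χ a (Function.update x₀ a (c ^^ s)) = c) ∧
      ((∃ c, op false c = op true c ∧ op false (!c) ≠ op true (!c)) →
        ∃ c, v (c ^^ s) false = v (c ^^ s) true ∧
          ∀ z z', h (Function.update z a c) = h (Function.update z' a c)) ∧
      ((∃ e, ∀ s t, op s t = (s ^^ t ^^ e)) →
        ∀ z, h (Function.update z a true) = !h (Function.update z a false)) := by
  obtain ⟨hwh, hm, hrel⟩ := C.of_subset_ess hR ⟨a, ha⟩
  obtain ⟨q, s, s₁, s₀, hq⟩ := C.literal hm hrel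
  have haT : a ∈ insert b w := Finset.mem_insert_of_mem ha
  have hbT : b ∈ insert b w := Finset.mem_insert_self _ _
  set σ : (V → Bool) → V → Bool := fun z j => if j ∈ insert b w then z j ^^ s j else q j with hσ
  have hlit : ∀ z, R (σ z) = (op (h z ^^ s₁) (z b) ^^ s₀) ∧ ∀ i ∈ insert b w, χ i (σ z) = z i :=
    fun z => hq z _ fun j => rfl
  have hhb : ∀ z t, h (Function.update z b t) = h z := by
    intro z t
    refine eq_of_agree fun j hj => ?_
    have : j ≠ b := fun e => C.notMem (e ▸ C.ess_gate hj)
    simp [this]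
  have heq : ∀ c t z, op (h (Function.update z a c) ^^ s₁) t =
      (G (v (c ^^ s a) (t ^^ s b)) (σ z) ^^ s₀) := by
    intro c t z
    have h1 := (hlit (Function.update (Function.update z a c) b t)).1
    rw [hhb, P.eq] at h1
    simp only [Function.update_self] at h1
    have ea : σ (Function.update (Function.update z a c) b t) a = (c ^^ s a) := by
      simp only [hσ, haT, if_true]
      simp [P.ne]
    have eb : σ (Function.update (Function.update z a c) b t) b = (t ^^ s b) := by
      simp only [hσ, hbT, if_true]
      simp
    have eG : ∀ k, G k (σ (Function.update (Function.update z a c) b t)) = G k (σ z) := by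
      intro k
      refine P.congr k fun i hia hib => ?_
      simp [hσ, hia, hib]
    rw [ea, eb, eG] at h1
    rw [h1]; simp
  have hdep : ∃ z, h (Function.update z a false) ≠ h (Function.update z a true) :=
    exists_ne_of_mem_ess (hwh ha)
  refine ⟨s a, σ (fun _ => false), fun c => ?_, ?_, ?_⟩
  · have := (hlit (Function.update (fun _ => false) a c)).2 a haT
    simp only [Function.update_self] at this
    have e : Function.update (σ (fun _ => false)) a (c ^^ s a) =
        σ (Function.update (fun _ => false) a c) := by
      funext j
      by_cases hja : j = a
      · subst hja; simp only [Function.update_self, hσ, haT, if_true]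
      · simp [hσ, hja]
    rw [e]
    exact this
  · rintro ⟨c, hc, hc'⟩
    have hcc : ∃ c', (fun s t => op (s ^^ s₁) t) false c' = (fun s t => op (s ^^ s₁) t) true c' ∧
        (fun s t => op (s ^^ s₁) t) false (!c') ≠ (fun s t => op (s ^^ s₁) t) true (!c') := by
      cases s₁
      · exact ⟨c, by simpa using hc, by simpa using hc'⟩
      · exact ⟨c, by simpa using hc.symm, by simpa using hc'.symm⟩
    obtain ⟨c', hc1, hc2⟩ := hcc
    obtain ⟨k, hk, hk'⟩ := overlap_odd (op := fun s t => op (s ^^ s₁) t)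
      (h := fun c z => h (Function.update z a c))
      (v := fun c t => v (c ^^ s a) (t ^^ s b)) (K := fun k z => G k (σ z) ^^ s₀) hc1 hc2 heq hdep
    refine ⟨k, ?_, hk'⟩
    revert hk
    cases s b <;> simp [eq_comm]
  · rintro ⟨e, he⟩
    refine overlap_even (op := fun s t => op (s ^^ s₁) t) (e := e ^^ s₁)
      (h := fun c z => h (Function.update z a c))
      (v := fun c t => v (c ^^ s a) (t ^^ s b)) (K := fun k z => G k (σ z) ^^ s₀) ?_ heq hdep
    intro s t
    rw [he]
    cases s <;> cases t <;> cases e <;> cases s₁ <;> rfl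

/-- The variable `i` enters `ψ` with one sign only, namely as a literal negated by `c`. -/
def Unate (ψ : Fn V) (i : V) (c : Bool) : Prop :=
  ∀ x, ψ (Function.update x i false) ≠ ψ (Function.update x i true) →
    ψ (Function.update x i false) = c

theorem Unate.eq_of_literal {ψ : Fn V} {i : V} {c s : Bool} (h : Unate ψ i c) {x : V → Bool}
    (hx : ∀ b, ψ (Function.update x i (b ^^ s)) = b) : s = c := by
  have h0 := hx false
  have h1 := hx true
  have := h x
  cases s <;> simp_all

section

variable {l : ℕ} {op : Bool → Bool → Bool} {f g ψ : Fn V} {w : Finset V} {h : Fn V}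
  {χ : V → Fn V} {a b : V} {B : Bool → Bool → Fn V} {v : Bool → Bool → Bool} {G : Bool → Fn V}

/-- Fixing the argument `t` of a gate of arity `l` leaves room for the variable `b`. -/
theorem exists_agree_erase (hfg : Agree l f g) (C : GateCtx op f w h χ b B fun i => ess (χ i))
    (hw : w.card = l) (hl : 2 ≤ l) (hh : ess h = w) (hrel : ∃ e c, B false c e ≠ B true c e)
    (h1 : ∃ c, op false c ≠ op true c) (h2 : ∃ a, op a false ≠ op a true) {t : V} (ht : t ∈ w)
    {p : V → Bool} (hp : w.erase t ⊆ ess (res h (w.erase t) p)) :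
    ∃ (q : V → Bool) (c : Bool), insert b (w.erase t) ⊆ ess (res f (insert b (w.erase t)) q) ∧
      res f (insert b (w.erase t)) q = res g (insert b (w.erase t)) q ∧
      GateCtx op (res f (insert b (w.erase t)) q) (w.erase t)
        (fun z => h (Function.update z t c)) (fun i => res (χ i) (insert b (w.erase t)) q) b
        (fun s r => res (B s r) (insert b (w.erase t)) q) fun i => ess (χ i) := by
  have hbt : b ≠ t := fun e => C.notMem (e ▸ ht)
  set T := insert b (w.erase t) with hT
  have hTw : T ⊆ insert b w := Finset.insert_subset_insert _ (Finset.erase_subset _ _)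
  have hbT : b ∉ w.erase t := fun hb => C.notMem (Finset.mem_of_mem_erase hb)
  have hTc : T.card = l := by
    rw [hT, Finset.card_insert_of_notMem hbT, Finset.card_erase_of_mem ht]; omega
  have htT : t ∈ insert b w := Finset.mem_insert_of_mem ht
  have hdt : ∀ i ∈ T, Disjoint (ess (χ i)) (ess (χ t)) := by
    intro i hi
    refine C.disj i (hTw hi) t htT ?_
    rintro rfl
    rcases Finset.mem_insert.1 hi with e | e
    · exact hbt e.symm
    · simp at e
  have hTt : Disjoint T (ess (χ t)) := by
    rw [Finset.disjoint_left]
    intro i hi hit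
    exact Finset.disjoint_left.1 (hdt i hi) (C.mem i (hTw hi)) hit
  obtain ⟨z, hz⟩ := exists_eq_of_ess_nonempty ⟨t, C.mem t htT⟩ (p t)
  have hsep : ∃ q, T ⊆ ess (res f T q) := by
    -- Freezing the variables of `χ t` at `z`, where it takes the value `p t`, removes the argument
    -- `t` from the gate and keeps the others relevant by `hp`.
    set U := Finset.univ \ ess (χ t) with hU
    have hres : ∀ u : Fn V, Disjoint (ess u) (ess (χ t)) → res u U z = u := by
      intro u hu
      refine res_of_ess_subset (fun i hi => ?_) z
      rw [hU, Finset.mem_sdiff]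
      exact ⟨Finset.mem_univ _, Finset.disjoint_left.1 hu hi⟩
    have C1 := (C.res U z).fix ht (c := p t) (by
      intro x
      simp only [res]
      rw [← hz]
      exact eq_of_agree fun i hi => by simp [hU, hi])
    obtain ⟨q, hq⟩ := C1.sep (by
        intro i hi
        rw [hres _ (hdt i hi)]
        exact C.mem i (hTw hi)) (by
        obtain ⟨e, c, he⟩ := hrel
        exact ⟨e, c, by rwa [hres _ (C.disj_ctx _ _ t htT), hres _ (C.disj_ctx _ _ t htT)]⟩) (by
        have : res h (w.erase t) p = fun z => h (Function.update z t (p t)) := by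
          funext x
          simp only [res]
          refine eq_of_agree fun i hi => ?_
          rw [hh] at hi
          by_cases hit : i = t
          · subst hit; simp
          · simp [hit, hi]
        rwa [this] at hp)
        (Finset.card_pos.1 (by rw [Finset.card_erase_of_mem ht]; omega)) h1 h2
    refine ⟨U.piecewise q z, ?_⟩
    rw [← res_res]
    · exact hq
    · intro i hi
      rw [hU, Finset.mem_sdiff]
      exact ⟨Finset.mem_univ _, Finset.disjoint_left.1 hTt hi⟩
  -- On the agreed hypercube `χ t` may be frozen at a different value, but it is constant there
  -- because `T` contains none of its variables.
  obtain ⟨q, hq, hqe⟩ := hfg T hTc hsep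
  refine ⟨q, res (χ t) T q q, hq, hqe, (C.res T q).fix ht fun x => ?_⟩
  refine eq_of_agree fun i hi => ?_
  have := ess_res_subset _ _ _ hi
  rw [Finset.mem_inter] at this
  exact absurd this.2 (Finset.disjoint_left.1 hTt this.1)

/-- If `a` could not be fixed without losing another argument, two other arguments `t₁` and `t₂`
could (`exists_strong`). On the hypercubes in which `b` replaces one of them, the overlap yields a
value of `a` under which all arguments other than `a` and the replaced one stay relevant; together
the two hypercubes cover all arguments. For a sum any value of `a` will do. For a conjunction the
two values must coincide, which is where unateness is needed. -/
theorem strong_of_agree (hfg : Agree l f g) (P : PairMod g a b v G)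
    (C : GateCtx op f w h χ b B fun i => ess (χ i))
    (hw : w.card = l) (hl : 2 ≤ l) (hh : ess h = w) (hrel : ∃ e c, B false c e ≠ B true c e)
    (h1 : ∃ c, op false c ≠ op true c) (h2 : ∃ a, op a false ≠ op a true) (ha : a ∈ w)
    (hun : (∃ c, op false c = op true c ∧ op false (!c) ≠ op true (!c)) →
      ∃ c, Unate (χ a) a c) :
    ∃ p, w.erase a ⊆ ess (res h (w.erase a) p) := by
  by_contra hns
  obtain ⟨t₁, ht₁, ht₁a, p₁, hp₁⟩ := exists_strong (hh.symm ▸ ha : a ∈ ess h) (by rw [hh]; omega)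
  obtain ⟨t₂, ht₂, ht₂₁, p₂, hp₂⟩ := exists_strong ht₁ (by rw [hh]; omega)
  rw [hh] at ht₁ ht₂ hp₁ hp₂
  have ht₂a : t₂ ≠ a := by
    rintro rfl
    exact hns ⟨p₂, hp₂⟩
  -- one value of `a` keeps all variables but `t` essential
  have key : ∃ c, ∀ t p, t ∈ w → t ≠ a → w.erase t ⊆ ess (res h (w.erase t) p) →
      ∀ i ∈ w, i ≠ t → i ≠ a → i ∈ ess fun z => h (Function.update z a c) := by
    rcases binary_cases op h1 h2 with heven | hodd
    · refine ⟨false, fun t p ht hta hp i hi hit hia => ?_⟩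
      obtain ⟨q, c, hq, hqe, C'⟩ := exists_agree_erase hfg C hw hl hh hrel h1 h2 ht hp
      have haT : a ∈ w.erase t := Finset.mem_erase.2 ⟨hta.symm, ha⟩
      have P' := P.res (Finset.mem_insert_of_mem haT) (Finset.mem_insert_self b (w.erase t)) q
      rw [← hqe] at P'
      obtain ⟨-, -, -, -, he⟩ := C'.overlap haT hq P'
      have he := he heven
      have hiT : i ∈ w.erase t := Finset.mem_erase.2 ⟨hit, hi⟩
      obtain ⟨z, hz⟩ := exists_ne_of_mem_ess ((C'.of_subset_ess hq ⟨a, haT⟩).1 hiT)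
      have hz' : h (Function.update (Function.update (Function.update z i false) t c) a false) ≠
          h (Function.update (Function.update (Function.update z i true) t c) a false) := by
        have e0 := he (Function.update z i false)
        have e1 := he (Function.update z i true)
        have hu : ∀ c', Function.update z i c' = Function.update (Function.update z i c') a (z a) := by
          intro c'
          funext j
          by_cases hj : j = a
          · subst hj; simp [hia.symm]
          · simp [hj]
        rw [hu false, hu true] at hz
        rw [Function.update_comm hta, Function.update_comm hta]
        revert hz e0 e1
        cases z a
        · exact fun h _ _ => h
        · intro h e0 e1 he
          apply h
          rw [e0, e1, he]
      refine mem_ess_of_ne hz' fun j hj => ?_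
      by_cases hjt : j = t
      · subst hjt; simp
      · simp [hjt, hj]
    · obtain ⟨k, hk⟩ := hun hodd
      -- `v` depends on its second argument, so at most one value of the first one blocks it. As `v`
      -- belongs to `g`, this value is common to all hypercubes.
      have hv : ∃ d, ∀ d', v d' false = v d' true → d' = d := by
        obtain ⟨q, c, hq, hqe, C'⟩ := exists_agree_erase hfg C hw hl hh hrel h1 h2 ht₁ hp₁
        have haT : a ∈ w.erase t₁ := Finset.mem_erase.2 ⟨ht₁a.symm, ha⟩
        have P' := P.res (Finset.mem_insert_of_mem haT) (Finset.mem_insert_self b (w.erase t₁)) q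
        rw [← hqe] at P'
        obtain ⟨x, hx⟩ := P'.right_relevant (hq (Finset.mem_insert_self _ _))
        refine ⟨!(x a), fun d' hd' => ?_⟩
        have : d' ≠ x a := by rintro rfl; exact hx hd'
        revert this
        cases d' <;> cases x a <;> simp
      obtain ⟨d, hd⟩ := hv
      refine ⟨!(d ^^ k), fun t p ht hta hp i hi hit hia => ?_⟩
      obtain ⟨q, c, hq, hqe, C'⟩ := exists_agree_erase hfg C hw hl hh hrel h1 h2 ht hp
      have haT : a ∈ w.erase t := Finset.mem_erase.2 ⟨hta.symm, ha⟩
      have haT' : a ∈ insert b (w.erase t) := Finset.mem_insert_of_mem haT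
      have P' := P.res haT' (Finset.mem_insert_self b (w.erase t)) q
      rw [← hqe] at P'
      obtain ⟨s, x₀, hx₀, ho, -⟩ := C'.overlap haT hq P'
      have hsk : s = k := by
        refine hk.eq_of_literal (x := (insert b (w.erase t)).piecewise x₀ q) fun c' => ?_
        refine Eq.trans ?_ (hx₀ c')
        simp only [res]
        congr 1
        funext j
        by_cases hj : j = a
        · subst hj
          rw [Finset.piecewise_eq_of_mem _ _ _ haT']
          simp
        · by_cases hjT : j ∈ insert b (w.erase t)
          · rw [Finset.piecewise_eq_of_mem _ _ _ hjT, Function.update_of_ne hj,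
              Finset.piecewise_eq_of_mem _ _ _ hjT, Function.update_of_ne hj]
          · rw [Finset.piecewise_eq_of_notMem _ _ _ hjT, Function.update_of_ne hj,
              Finset.piecewise_eq_of_notMem _ _ _ hjT]
      obtain ⟨c', hc', hconst⟩ := ho hodd
      have hc'd : c' = (d ^^ k) := by
        have := hd _ hc'
        rw [hsk] at this
        rw [← this]; simp
      have hiT : i ∈ w.erase t := Finset.mem_erase.2 ⟨hit, hi⟩
      obtain ⟨z, hz⟩ := exists_ne_of_mem_ess ((C'.of_subset_ess hq ⟨a, haT⟩).1 hiT)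
      have hu : ∀ c', Function.update z i c' = Function.update (Function.update z i c') a (z a) := by
        intro c'
        funext j
        by_cases hj : j = a
        · subst hj; simp [hia.symm]
        · simp [hj]
      have hza : z a = !(d ^^ k) := by
        by_contra hne
        have hza : z a = c' := by
          rw [hc'd]
          revert hne
          cases z a <;> cases (d ^^ k) <;> simp
        rw [hu false, hu true, hza] at hz
        exact hz (hconst _ _)
      rw [hu false, hu true, hza] at hz
      refine mem_ess_of_ne (x := Function.update (Function.update z i false) t c)
        (y := Function.update (Function.update z i true) t c) ?_ ?_
      · rw [Function.update_comm hta, Function.update_comm hta]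
        exact hz
      · intro j hj
        by_cases hjt : j = t
        · subst hjt; simp
        · simp [hjt, hj]
  obtain ⟨c, hc⟩ := key
  refine hns ⟨fun _ => c, fun i hi => ?_⟩
  rw [Finset.mem_erase] at hi
  have e : res h (w.erase a) (fun _ => c) = fun z => h (Function.update z a c) := by
    funext x
    simp only [res]
    refine eq_of_agree fun i hi => ?_
    rw [hh] at hi
    by_cases hia : i = a
    · subst hia; simp
    · simp [hia, hi]
  rw [e]
  by_cases hi1 : i = t₁
  · exact hc t₂ p₂ ht₂ ht₂a hp₂ i hi.2 (by rw [hi1]; exact ht₂₁.symm) hi.1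
  · exact hc t₁ p₁ ht₁ ht₁a hp₁ i hi.2 hi1 hi.1

end

end Overlap

/-! ### Prime gates of full arity `l` -/

section Full

variable {V : Type*} [Fintype V] [DecidableEq V]

theorem Part.prime_res {f r h : Fn V} {w : Finset V} {χ : V → Fn V} (hr : Part f r)
    (D : Dec r w h χ) (hpr : Prime h) {p : V → Bool} (hp : w ⊆ ess (ReadOnce.res f w p)) :
    Prime (ReadOnce.res f w p) := by
  intro I hI hIs hI2
  have hess : ess (ReadOnce.res f w p) = w := (ess_res_subset_left _ _ _).antisymm hp
  rw [hess] at hIs ⊢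
  obtain ⟨-, F, hF, hf⟩ := hr
  have hR : ∀ x, ReadOnce.res f w p x =
      ReadOnce.res (F (h fun i => ReadOnce.res (χ i) w p x)) w p x := by
    intro x
    simp only [ReadOnce.res]
    rw [hf, D.eq]
  have hM := Mod.gate (F := fun b => ReadOnce.res (F b) w p) (A := fun i => ess (χ i)) hR
    (fun i _ => ess_res_subset_right _ _ _) (fun b i hi => by
      refine (hF b).mono (ess_res_subset_right _ _ _) ?_
      rw [D.ess_biUnion]
      exact Finset.subset_biUnion_of_mem (fun i => ess (χ i)) hi) D.disj D.mem D.ess_eq.subset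
    hp hI
  rw [Finset.inter_eq_left.2 hIs] at hM
  rw [hpr I hM (D.ess_eq.symm ▸ hIs) hI2, D.ess_eq]

theorem GateCtx.mod {op : Bool → Bool → Bool} {f : Fn V} {w : Finset V} {h : Fn V}
    {χ : V → Fn V} {b : V} {B : Bool → Bool → Fn V} {A : V → Finset V}
    (C : GateCtx op f w h χ b B A) (hχ : ∀ i ∈ w, ess (χ i) ⊆ w) : Mod f w := by
  refine ⟨fun x => h fun i => χ i x, fun c x => B c (χ b x) x, ?_, fun c => ?_, C.eq⟩
  · refine (ess_comp_subset h χ).trans (Finset.biUnion_subset.2 fun i hi => hχ i (C.ess_gate hi))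
  · rw [disjoint_ess_iff]
    intro x y hxy
    have e1 : χ b x = χ b y := by
      refine eq_of_agree fun j hj => hxy j fun hjw => ?_
      exact Finset.disjoint_left.1 (C.disj b (Finset.mem_insert_self _ _) j
        (Finset.mem_insert_of_mem hjw) fun e => C.notMem (e ▸ hjw))
        (C.ess_sub b (Finset.mem_insert_self _ _) hj) (C.mem j (Finset.mem_insert_of_mem hjw))
    simp only [e1]
    refine eq_of_agree fun j hj => hxy j fun hjw => ?_
    exact Finset.disjoint_left.1 (C.disj_ctx _ _ j (Finset.mem_insert_of_mem hjw)) hj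
      (C.mem j (Finset.mem_insert_of_mem hjw))

/-- Fix `a` and use `b` in its place: on an agreed hypercube of `insert b (w.erase a)` the set
`w.erase a` is a module. In `g` the pair module allows `a` to take over the role of `b`, which gives
a relevant restriction of `g` to `w` with a module of size `l - 1 ≥ 2`. But on the agreed hypercube
of `w` itself the restriction is prime like the gate, and `prime_res_of_ro` makes every relevant
restriction of a read-once function to `w` prime. -/
theorem not_pairMod_of_prime {l : ℕ} {op : Bool → Bool → Bool} {f g ψ : Fn V} {w : Finset V}
    {h : Fn V} {χ χ' : V → Fn V} {a b : V} {B : Bool → Bool → Fn V} {v : Bool → Bool → Bool}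
    {G : Bool → Fn V} (hfg : Agree l f g) (hg : RO l g) (hψ : Part f ψ) (D : Dec ψ w h χ')
    (hpr : Prime h) (C : GateCtx op f w h χ b B fun i => ess (χ i)) (hw : w.card = l) (hl : 3 ≤ l)
    (hrel : ∃ e c, B false c e ≠ B true c e)
    (h1 : ∃ c, op false c ≠ op true c) (h2 : ∃ a, op a false ≠ op a true) (ha : a ∈ w)
    (hun : (∃ c, op false c = op true c ∧ op false (!c) ≠ op true (!c)) → ∃ c, Unate (χ a) a c)
    (P : PairMod g a b v G) : False := by
  obtain ⟨p, hp⟩ := strong_of_agree hfg P C hw (by omega) D.ess_eq hrel h1 h2 ha hun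
  obtain ⟨q, c, hq, hqe, C'⟩ := exists_agree_erase hfg C hw (by omega) D.ess_eq hrel h1 h2 ha hp
  have hbw : b ∉ w := C.notMem
  have hba : b ≠ a := P.ne.symm
  set T := insert b (w.erase a) with hT
  have hmod : Mod (res f T q) (w.erase a) := by
    refine C'.mod fun i hi j hj => ?_
    have hj' := ess_res_subset _ _ _ hj
    rw [Finset.mem_inter, hT, Finset.mem_insert] at hj'
    rcases hj'.1 with rfl | hjw
    · exfalso
      have hiw := Finset.mem_of_mem_erase hi
      exact Finset.disjoint_left.1 (C.disj i (Finset.mem_insert_of_mem hiw) j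
        (Finset.mem_insert_self _ _) fun e => hbw (e ▸ hiw)) hj'.2
        (C.mem j (Finset.mem_insert_self _ _))
    · exact hjw
  obtain ⟨p₀, hp₀⟩ := D.sep
  obtain ⟨p₁, hp₁, he₁⟩ := hfg w hw (hψ.sep hp₀)
  have hpr₁ := hψ.prime_res D hpr hp₁
  rw [he₁] at hp₁ hpr₁
  set g' := res g (Finset.univ.erase b) p₁ with hg'
  have hwb : w ⊆ Finset.univ.erase b := fun i hi => by
    simp only [Finset.mem_erase, Finset.mem_univ, and_true]
    exact fun e => hbw (e ▸ hi)
  have hg'p : ∀ r, res g' w r = res g w (Function.update r b (p₁ b)) := by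
    intro r
    rw [hg', res_res hwb]
    congr 1
    funext j
    by_cases hj : j = b
    · subst hj; simp
    · simp [hj]
  have hg'₁ : res g' w p₁ = res g w p₁ := by rw [hg'p]; simp
  rw [hqe] at hq hmod
  set R := res g T q with hR
  set Q := res g' w q with hQ
  have haT : a ∉ T := by simp [hT, hba.symm]
  have hbT : b ∈ T := Finset.mem_insert_self _ _
  have hRx : ∀ x, R x = G (v (q a) (x b)) (T.piecewise x q) := by
    intro x
    rw [hR, res, P.eq]
    simp [haT, hbT]
  have hQx : ∀ x, Q x = G (v (x a) (p₁ b)) (T.piecewise x q) := by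
    intro x
    rw [hQ, hg'p, res, P.eq]
    rw [Finset.piecewise_eq_of_mem _ _ _ ha, Finset.piecewise_eq_of_notMem _ _ _ hbw,
      Function.update_self]
    refine P.congr _ fun j hja hjb => ?_
    by_cases hjw : j ∈ w
    · simp [hjw, hT, hja]
    · simp [hjw, hT, hjb]
  have hvR : v (q a) false ≠ v (q a) true := by
    obtain ⟨x, hx⟩ := exists_ne_of_mem_ess (hq hbT)
    intro hv
    apply hx
    rw [hRx, hRx]
    simp only [Function.update_self, hv]
    exact P.congr _ fun j hja hjb => by by_cases hj : j ∈ T <;> simp [hj, hjb]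
  have hvQ : v false (p₁ b) ≠ v true (p₁ b) := by
    obtain ⟨x, hx⟩ := exists_ne_of_mem_ess (hp₁ ha)
    intro hv
    apply hx
    simp only [res]
    rw [P.eq, P.eq]
    simp only [ha, Finset.piecewise_eq_of_mem, Function.update_self,
      Finset.piecewise_eq_of_notMem _ _ _ hbw, hv]
    exact P.congr _ fun j hja hjb => by by_cases hj : j ∈ w <;> simp [hj, hja]
  -- With one argument frozen on either side, `v` is a nonconstant function of one bit in both
  -- cases, so the two differ by a sign `s`. This sign defines the substitutions between `R` and
  -- `Q`.
  obtain ⟨s, hs⟩ : ∃ s, ∀ c, v c (p₁ b) = v (q a) (c ^^ s) := by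
    revert hvR hvQ
    generalize v (q a) = v₁
    generalize (fun c => v c (p₁ b)) = v₂
    cases e1 : v false (p₁ b) <;> cases e2 : v true (p₁ b) <;> cases e3 : v₁ false <;>
      cases e4 : v₁ true <;> simp [Bool.forall_bool, Bool.exists_bool, e1, e2, e3, e4]
  have hRQ : ∀ x, R x = Q (Function.update x a (x b ^^ s)) := by
    intro x
    rw [hRx, hQx]
    simp only [Function.update_self]
    rw [hs]
    simp only [Bool.xor_assoc, Bool.xor_self, Bool.xor_false]
    exact P.congr _ fun j hja hjb => by by_cases hj : j ∈ T <;> simp [hj, hja]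
  have hQR : ∀ x, Q x = R (Function.update x b (x a ^^ s)) := by
    intro x
    rw [hRx, hQx]
    simp only [Function.update_self]
    rw [hs]
    exact P.congr _ fun j hja hjb => by by_cases hj : j ∈ T <;> simp [hj, hjb]
  have hQw : ess Q ⊆ w := ess_res_subset_left _ _ _
  have hwQ : w ⊆ ess Q := by
    intro i hi
    have hcase : ∃ k ∈ ess R, (i = a ∧ k = b) ∨ (i ≠ a ∧ k = i) := by
      by_cases hia : i = a
      · exact ⟨b, hq hbT, Or.inl ⟨hia, rfl⟩⟩
      · exact ⟨i, hq (Finset.mem_insert_of_mem (Finset.mem_erase.2 ⟨hia, hi⟩)), Or.inr ⟨hia, rfl⟩⟩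
    obtain ⟨k, hk, hki⟩ := hcase
    obtain ⟨x, hx⟩ := exists_ne_of_mem_ess hk
    rw [hRQ, hRQ] at hx
    obtain ⟨j, hj, hjne⟩ := exists_mem_ess_of_ne hx
    have hjw := hQw hj
    have hjb : j ≠ b := fun e => hbw (e ▸ hjw)
    convert hj using 1
    rcases hki with ⟨rfl, rfl⟩ | ⟨hia, rfl⟩
    · by_contra hne
      simp [Ne.symm hne, hjb] at hjne
    · have hkb : b ≠ k := fun e => hbw (e ▸ hi)
      by_contra hne
      by_cases hja : j = a
      · subst hja; simp [hkb] at hjne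
      · simp [hja, Ne.symm hne] at hjne
  have hprQ : Prime Q := prime_res_of_ro (by omega) (hg.res _ _) hw (hg'₁ ▸ hp₁) (hg'₁ ▸ hpr₁) hwQ
  have hmodQ : Mod Q (w.erase a) := by
    refine hmod.subst (fun x => Function.update x b (x a ^^ s)) false
      (fun y => by simp [hQR]) ?_ ?_
    · intro j hj y y' hyy
      have : j ≠ b := fun e => hbw (e ▸ Finset.mem_of_mem_erase hj)
      simp [this, hyy j hj]
    · intro j hj y y' hyy
      by_cases hjb : j = b
      · subst hjb; simp [hyy a (by simp)]
      · simp [hjb, hyy j hj]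
  have := hprQ.subset hmodQ (by
    rw [Finset.inter_eq_left.2 ((Finset.erase_subset _ _).trans hwQ), Finset.card_erase_of_mem ha]
    omega)
  exact Finset.notMem_erase a w (this (hwQ ha))

end Full

/-! ### Unateness below a conjunction -/

section UnateContexts

variable {V : Type*} [Fintype V] [DecidableEq V]

/-- With fewer than `l` arguments, the names and `b` fit together into an agreed hypercube, so the
overlap concerns the whole gate. -/
theorem GateCtx.overlap_of_card_lt {l : ℕ} {op : Bool → Bool → Bool} {f g : Fn V} {w : Finset V}
    {h : Fn V} {χ : V → Fn V} {a b : V} {B : Bool → Bool → Fn V} {v : Bool → Bool → Bool}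
    {G : Bool → Fn V} (C : GateCtx op f w h χ b B fun i => ess (χ i)) (hfg : Agree l f g)
    (hl : l ≤ (ess f).card) (hw : w.card < l) (hh : ess h = w)
    (hrel : ∃ e c, B false c e ≠ B true c e)
    (h1 : ∃ c, op false c ≠ op true c) (h2 : ∃ a, op a false ≠ op a true) (ha : a ∈ w)
    (P : PairMod g a b v G) :
      ((∃ c, op false c = op true c ∧ op false (!c) ≠ op true (!c)) →
        ∃ c, ∀ z z', h (Function.update z a c) = h (Function.update z' a c)) ∧
      ((∃ e, ∀ s t, op s t = (s ^^ t ^^ e)) →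
        ∀ z, h (Function.update z a true) = !h (Function.update z a false)) := by
  obtain ⟨w', p, hww', -, hp, he⟩ := hfg.extend hl
    (C.sep (fun i hi => C.mem i hi) hrel hh.symm.subset ⟨a, ha⟩ h1 h2)
    (by rw [Finset.card_insert_of_notMem C.notMem]; omega)
  have P' := P.res (hww' (Finset.mem_insert_of_mem ha)) (hww' (Finset.mem_insert_self _ _)) p
  rw [← he] at P'
  obtain ⟨s, x₀, -, ho, hev⟩ := (C.res w' p).overlap ha (hww'.trans hp) P'
  exact ⟨fun hodd => (ho hodd).imp fun _ h => h.2, hev⟩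

theorem Ctx.exists_rel {op : Bool → Bool → Bool} {f ψ φ : Fn V} {B : Bool → Bool → Fn V}
    (C : Ctx op f ψ φ B) {a : V} (ha : a ∈ ess ψ) (haf : a ∈ ess f) :
    ∃ e c, B false c e ≠ B true c e := by
  obtain ⟨x, hx⟩ := exists_ne_of_mem_ess haf
  have e : ∀ (u : Fn V), Disjoint (ess u) (ess ψ) →
      u (Function.update x a true) = u (Function.update x a false) := by
    intro u hu
    refine disjoint_ess_iff.1 hu _ _ fun j hj => ?_
    have : j ≠ a := fun e => hj (e ▸ ha)
    simp [this]
  rw [C.eq, C.eq, e _ (C.disj_left _ _), e φ C.disj.symm] at hx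
  refine ⟨Function.update x a false, φ (Function.update x a false), fun he => hx ?_⟩
  revert he
  cases ψ (Function.update x a false) <;> cases ψ (Function.update x a true) <;> simp [eq_comm]

theorem Dec.comp_update {f : Fn V} {w : Finset V} {h : Fn V} {χ : V → Fn V} (D : Dec f w h χ)
    {a : V} (ha : a ∈ w) (x : V → Bool) (c : Bool) :
    f (Function.update x a c) =
      h (Function.update (fun i => χ i x) a (χ a (Function.update x a c))) := by
  rw [D.eq]
  refine eq_of_agree fun i hi => ?_
  rw [D.ess_eq] at hi
  by_cases hia : i = a
  · subst hia; simp
  · rw [Function.update_of_ne hia]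
    refine eq_of_agree fun j hj => ?_
    have : j ≠ a := by
      rintro rfl
      exact Finset.disjoint_left.1 (D.disj i hi j ha hia) hj (D.mem j ha)
    simp [this]

/-- Where the value of `χ a` matters, the gate as a function of that argument is the identity or the
negation, which `s₁` absorbs; so `op` stays the same all the way down. -/
theorem Ctx.child {op : Bool → Bool → Bool} {f ψ φ : Fn V} {B : Bool → Bool → Fn V}
    (C : Ctx op f ψ φ B) {w : Finset V} {h : Fn V} {χ : V → Fn V} (D : Dec ψ w h χ) {a : V}
    (ha : a ∈ w) :
    Ctx op f (χ a) φ fun s r x => B (h (Function.update (fun i => χ i x) a s)) r x := by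
  have hsub : ∀ i ∈ w, ess (χ i) ⊆ ess ψ := fun i hi => (D.part hi).1
  refine ⟨fun x => ?_, fun s r => ?_, fun s r => ?_, C.disj.mono_left (hsub a ha),
    fun e r hne => ?_⟩
  · rw [C.eq, D.eq]
    congr 2
    funext i
    by_cases hi : i = a
    · subst hi; simp
    · simp [hi]
  · rw [disjoint_ess_iff]
    intro x y hxy
    have e1 : h (Function.update (fun i => χ i x) a s) =
        h (Function.update (fun i => χ i y) a s) := by
      refine eq_of_agree fun i hi => ?_
      rw [D.ess_eq] at hi
      by_cases hia : i = a
      · subst hia; simp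
      · simp only [Function.update_of_ne hia]
        exact disjoint_ess_iff.1 (D.disj i hi a ha hia) _ _ hxy
    rw [e1]
    exact disjoint_ess_iff.1 ((C.disj_left _ r).mono_right (hsub a ha)) _ _ hxy
  · rw [disjoint_ess_iff]
    intro x y hxy
    have e1 : h (Function.update (fun i => χ i x) a s) =
        h (Function.update (fun i => χ i y) a s) := by
      refine eq_of_agree fun i hi => ?_
      rw [D.ess_eq] at hi
      by_cases hia : i = a
      · subst hia; simp
      · simp only [Function.update_of_ne hia]
        exact disjoint_ess_iff.1 (C.disj.mono_left (hsub i hi)) _ _ hxy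
    rw [e1]
    exact disjoint_ess_iff.1 (C.disj_right _ r) _ _ hxy
  · set u : Bool → Bool := fun s => h (Function.update (fun i => χ i e) a s) with hu
    have hu1 : u false ≠ u true := fun he => hne (by
      simp only [hu] at he
      simp only [he])
    have hB : B false r e ≠ B true r e := by
      change B (u false) r e ≠ B (u true) r e at hne
      revert hu1 hne
      cases u false <;> cases u true <;> simp [eq_comm]
    obtain ⟨s₁, s₀, hs⟩ := C.rel e r hB
    refine ⟨u false ^^ s₁, s₀, fun s r' => ?_⟩
    change B (u s) r' e = _
    rw [hs]
    congr 2
    revert hu1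
    cases s <;> cases u false <;> cases u true <;> cases s₁ <;> simp

/-- Induction along the path to `a`. A gate of arity `l` is impossible by `not_pairMod_of_prime`,
whose unateness hypothesis is the induction hypothesis. A smaller gate is constant for one value of
its argument `a`, hence unate in it, and unateness composes. -/
theorem exists_unate {l : ℕ} {op : Bool → Bool → Bool} {f g ψ φ : Fn V} {a b : V}
    {B : Bool → Bool → Fn V} {v : Bool → Bool → Bool} {G : Bool → Fn V} (hfg : Agree l f g)
    (hl : l ≤ (ess f).card) (hl3 : 3 ≤ l) (hg : RO l g) (P : PairMod g a b v G)
    (hodd : ∃ c, op false c = op true c ∧ op false (!c) ≠ op true (!c))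
    (h2 : ∃ a, op a false ≠ op a true)
    (C : Ctx op f ψ φ B) (hψ : Part f ψ) (hro : RO l ψ) (ha : a ∈ ess ψ) (hb : b ∈ ess φ) :
    ∃ c, Unate ψ a c := by
  induction hn : (ess ψ).card using Nat.strong_induction_on generalizing ψ B with
  | _ n ih =>
  subst hn
  have h1 : ∃ c, op false c ≠ op true c := by
    obtain ⟨c, -, hc⟩ := hodd
    exact ⟨_, hc⟩
  by_cases hcard : 2 ≤ (ess ψ).card
  · obtain ⟨w, h, χ, D, haw⟩ := hro.exists_nf_mem hcard ha
    have hrel := C.exists_rel ha (hψ.1 ha)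
    obtain ⟨k, hk⟩ := ih _ (D.card_ess_lt haw) (C.child D.dec haw) (hψ.trans (D.dec.part haw))
      (D.ro a haw) (D.mem a haw) rfl
    have GC := C.gateCtx D.dec hb
    have hab : a ≠ b := P.ne
    have hk' : Unate (Function.update χ b φ a) a k := by simpa [hab] using hk
    have hwl : w.card < l := by
      refine lt_of_le_of_ne D.card_le fun hwl => ?_
      exact not_pairMod_of_prime hfg hg hψ D.dec D.prime GC hwl hl3 hrel h1 h2 haw
        (fun _ => ⟨k, hk'⟩) P
    obtain ⟨c, hc⟩ := (GC.overlap_of_card_lt hfg hl hwl D.ess_eq hrel h1 h2 haw P).1 hodd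
    set d := h (Function.update (fun _ => false) a c) with hd
    -- When `a` is false, `χ a` equals `k`. The gate is then `d` if `k = c`; otherwise it is `!d`,
    -- because a change occurs and its value at `c` is `d`.
    refine ⟨d ^^ c ^^ k, fun x hx => ?_⟩
    rw [D.dec.comp_update haw, D.dec.comp_update haw] at hx
    rw [D.dec.comp_update haw]
    have hχ : χ a (Function.update x a false) ≠ χ a (Function.update x a true) :=
      fun e => hx (by rw [e])
    have hcx := hc (fun i => χ i x) (fun _ => false)
    rw [← hd] at hcx
    have h0 := hk x hχ
    have h1 : χ a (Function.update x a true) = !k := by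
      revert hχ
      rw [h0]
      cases k <;> cases χ a (Function.update x a true) <;> simp
    rw [h0, h1] at hx
    rw [h0]
    revert hx hcx
    generalize (fun i => χ i x) = z
    clear_value d
    cases k <;> simp only [Bool.not_false, Bool.not_true] <;> cases c <;> cases d <;>
      cases h (Function.update z a false) <;>
      cases h (Function.update z a true) <;> simp
  · have he : ess ψ = {a} := by
      symm
      apply Finset.eq_of_subset_of_card_le (by simpa using ha)
      simp; omega
    refine ⟨ψ (Function.update (fun _ => false) a false), fun x _ => eq_of_agree fun i hi => ?_⟩
    rw [he, Finset.mem_singleton] at hi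
    subst hi; simp

end UnateContexts

/-! ### Binary operations up to negations -/

/-- A binary operation depending on both arguments. -/
def Rel2 (op : Bool → Bool → Bool) : Prop :=
  (∃ t, op false t ≠ op true t) ∧ ∃ s, op s false ≠ op s true

/-- A binary operation that is, up to negation, the sum modulo two. -/
def IsXor (op : Bool → Bool → Bool) : Prop := ∃ e, ∀ s t, op s t = (s ^^ t ^^ e)

theorem Rel2.swap {op : Bool → Bool → Bool} (h : Rel2 op) : Rel2 fun s t => op t s := ⟨h.2, h.1⟩

theorem IsXor.swap {op : Bool → Bool → Bool} (h : IsXor op) : IsXor fun s t => op t s := by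
  obtain ⟨e, he⟩ := h
  exact ⟨e, fun s t => by simp only [he]; cases s <;> cases t <;> rfl⟩

theorem IsXor.rel {op : Bool → Bool → Bool} (h : IsXor op) : Rel2 op := by
  obtain ⟨e, he⟩ := h
  exact ⟨⟨false, by simp [he]⟩, false, by simp [he]⟩

theorem isXor_twist_iff {op u : Bool → Bool → Bool} {s₁ s₂ s₀ : Bool}
    (h : ∀ s t, u s t = (op (s ^^ s₁) (t ^^ s₂) ^^ s₀)) : IsXor u ↔ IsXor op := by
  constructor
  · rintro ⟨e, he⟩
    refine ⟨e ^^ s₀ ^^ s₁ ^^ s₂, fun s t => ?_⟩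
    have := (h (s ^^ s₁) (t ^^ s₂)).symm.trans (he _ _)
    simp only [Bool.xor_assoc, Bool.xor_self, Bool.xor_false] at this
    revert this
    cases op s t <;> cases s <;> cases t <;> cases s₁ <;> cases s₂ <;> cases s₀ <;> cases e <;>
      decide
  · rintro ⟨e, he⟩
    refine ⟨e ^^ s₀ ^^ s₁ ^^ s₂, fun s t => ?_⟩
    rw [h, he]
    cases s <;> cases t <;> cases s₁ <;> cases s₂ <;> cases s₀ <;> cases e <;> decide

theorem exists_twist {u : Bool → Bool} (h : u false ≠ u true) : ∃ s₁, ∀ s, u s = (s ^^ s₁) := by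
  refine ⟨u false, fun s => ?_⟩
  revert h
  cases s <;> cases u false <;> cases u true <;> simp

/-! ### Reading the type of a binary gate off two-dimensional hypercubes -/

section Squares

variable {V : Type*} [Fintype V] [DecidableEq V]

/-- The restriction of `F` to the square through `p` with free variables `i` and `j`. -/
def sq (F : Fn V) (i j : V) (p : V → Bool) (s t : Bool) : Bool :=
  F (Function.update (Function.update p i s) j t)

/-- On some square, `F` is up to negation the sum of the variables `i` and `j`. -/
def XorPair (F : Fn V) (i j : V) : Prop := ∃ p, IsXor (sq F i j p)

theorem sq_swap {i j : V} (hij : i ≠ j) (F : Fn V) (p : V → Bool) :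
    sq F j i p = fun s t => sq F i j p t s := by
  funext s t
  simp only [sq]
  rw [Function.update_comm hij.symm]

theorem XorPair.symm {F : Fn V} {i j : V} (hij : i ≠ j) (h : XorPair F i j) : XorPair F j i := by
  obtain ⟨p, hp⟩ := h
  exact ⟨p, by rw [sq_swap hij]; exact hp.swap⟩

theorem res_pair {i j : V} (hij : i ≠ j) (F : Fn V) (p x : V → Bool) :
    res F {i, j} p x = sq F i j p (x i) (x j) := by
  simp only [res, sq]
  congr 1
  funext k
  by_cases hkj : k = j
  · subst hkj; simp
  · by_cases hki : k = i
    · subst hki; simp [hij]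
    · simp [hkj, hki]

theorem pair_subset_ess_iff {i j : V} (hij : i ≠ j) (F : Fn V) (p : V → Bool) :
    {i, j} ⊆ ess (res F {i, j} p) ↔ Rel2 (sq F i j p) := by
  constructor
  · intro h
    obtain ⟨x, hx⟩ := exists_ne_of_mem_ess (h (by simp : i ∈ ({i, j} : Finset V)))
    obtain ⟨y, hy⟩ := exists_ne_of_mem_ess (h (by simp : j ∈ ({i, j} : Finset V)))
    simp only [res_pair hij, Function.update_self, Function.update_of_ne hij,
      Function.update_of_ne hij.symm] at hx hy
    exact ⟨⟨_, hx⟩, _, hy⟩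
  · rintro ⟨⟨t, ht⟩, s, hs⟩ k hk
    simp only [Finset.mem_insert, Finset.mem_singleton] at hk
    rcases hk with rfl | rfl
    · refine mem_ess_of_ne (x := Function.update (fun _ => t) k false)
        (y := Function.update (fun _ => t) k true) ?_ fun m hm => by simp [hm]
      simpa [res_pair hij, hij.symm] using ht
    · refine mem_ess_of_ne (x := Function.update (fun _ => s) k false)
        (y := Function.update (fun _ => s) k true) ?_ fun m hm => by simp [hm]
      simpa [res_pair hij, hij] using hs

theorem Rel2.mem_ess {F : Fn V} {i j : V} {p : V → Bool} (h : Rel2 (sq F i j p)) :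
    i ∈ ess F ∧ j ∈ ess F := by
  obtain ⟨⟨t, ht⟩, s, hs⟩ := h
  constructor
  · refine mem_ess_of_ne ht fun k hk => ?_
    by_cases hkj : k = j
    · subst hkj; simp
    · simp [hkj, hk]
  · refine mem_ess_of_ne hs fun k hk => ?_
    simp [hk]

theorem Part.op_left {op : Bool → Bool → Bool} {ψ φ : Fn V} (hd : Disjoint (ess ψ) (ess φ))
    (hφ : (ess φ).Nonempty) (h1 : ∃ t, op false t ≠ op true t) :
    Part (fun x => op (ψ x) (φ x)) ψ := by
  refine ⟨fun i hi => ?_, fun b x => op b (φ x), fun b => ?_, fun x => rfl⟩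
  · obtain ⟨x, hx⟩ := exists_ne_of_mem_ess hi
    obtain ⟨t, ht⟩ := h1
    obtain ⟨z, hz⟩ := exists_eq_of_ess_nonempty hφ t
    have e1 : ∀ c, ψ (Function.update ((ess φ).piecewise z x) i c) =
        ψ (Function.update x i c) := by
      intro c
      refine eq_of_agree fun j hj => ?_
      have : j ∉ ess φ := Finset.disjoint_left.1 hd hj
      by_cases hji : j = i
      · subst hji; simp
      · simp [hji, this]
    have e2 : ∀ c, φ (Function.update ((ess φ).piecewise z x) i c) = t := by
      intro c
      rw [← hz]
      refine eq_of_agree fun j hj => ?_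
      have : j ≠ i := fun e => Finset.disjoint_left.1 hd hi (e ▸ hj)
      simp [this, hj]
    refine mem_ess_of_ne (x := Function.update ((ess φ).piecewise z x) i false)
      (y := Function.update ((ess φ).piecewise z x) i true) ?_ fun j hj => by simp [hj]
    simp only [e1, e2]
    revert hx ht
    cases ψ (Function.update x i false) <;> cases ψ (Function.update x i true) <;> simp [eq_comm]
  · rw [disjoint_ess_iff]
    intro x y hxy
    have : φ x = φ y := disjoint_ess_iff.1 hd.symm _ _ hxy
    simp only [this]

theorem Part.op_right {op : Bool → Bool → Bool} {ψ φ : Fn V} (hd : Disjoint (ess ψ) (ess φ))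
    (hψ : (ess ψ).Nonempty) (h2 : ∃ s, op s false ≠ op s true) :
    Part (fun x => op (ψ x) (φ x)) φ :=
  Part.op_left (op := fun s t => op t s) hd.symm hψ h2

/-- The functions `ψ` and `φ` of disjoint variables are combined by `op` inside `F`. -/
structure Lca (F : Fn V) (op : Bool → Bool → Bool) (ψ φ : Fn V) : Prop where
  part : Part F fun x => op (ψ x) (φ x)
  left : Part (fun x => op (ψ x) (φ x)) ψ
  right : Part (fun x => op (ψ x) (φ x)) φ
  disj : Disjoint (ess ψ) (ess φ)
  rel : Rel2 op

theorem Part.lca {F r ψ φ : Fn V} {op : Bool → Bool → Bool} (hr : Part F r)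
    (heq : ∀ x, r x = op (ψ x) (φ x)) (hd : Disjoint (ess ψ) (ess φ)) (hψ : (ess ψ).Nonempty)
    (hφ : (ess φ).Nonempty) (hop : Rel2 op) : Lca F op ψ φ :=
  ⟨(funext heq : r = _) ▸ hr, Part.op_left hd hφ hop.1, Part.op_right hd hψ hop.2, hd, hop⟩

theorem Lca.swap {F ψ φ : Fn V} {op : Bool → Bool → Bool} (L : Lca F op ψ φ) :
    Lca F (fun s t => op t s) φ ψ :=
  ⟨L.part, L.right, L.left, L.disj.symm, L.rel.swap⟩

theorem Part.trans_lca {F r ψ φ : Fn V} {op : Bool → Bool → Bool} (h : Part F r)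
    (L : Lca r op ψ φ) : Lca F op ψ φ :=
  ⟨h.trans L.part, L.left, L.right, L.disj, L.rel⟩

theorem Lca.ctx {F ψ φ : Fn V} {op : Bool → Bool → Bool} (L : Lca F op ψ φ) :
    ∃ B, Ctx op F ψ φ B := by
  obtain ⟨-, H, hH, hF⟩ := L.part
  refine ⟨fun s t => H (op s t), hF, fun s t => (hH _).mono_right L.left.1,
    fun s t => (hH _).mono_right L.right.1, L.disj, fun e b hne => ?_⟩
  have h2 : H false e ≠ H true e := by
    revert hne
    cases op false b <;> cases op true b <;> simp [eq_comm]
  obtain ⟨s₀, hs⟩ := exists_twist (u := fun c => H c e) h2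
  exact ⟨false, s₀, fun s t => by simpa using hs (op s t)⟩

/-- On a relevant square, each of `ψ`, `φ` and the outer context has to be a nonconstant function of
one bit. So every relevant square displays `op` up to negations, wherever it lies. -/
theorem Lca.sq {F ψ φ : Fn V} {op : Bool → Bool → Bool} (L : Lca F op ψ φ) {i j : V}
    (hi : i ∈ ess ψ) (hj : j ∈ ess φ) {p : V → Bool} (hp : Rel2 (sq F i j p)) :
    ∃ s₁ s₂ s₀, (∀ s, ψ (Function.update p i s) = (s ^^ s₁)) ∧
      (∀ t, φ (Function.update p j t) = (t ^^ s₂)) ∧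
      ∀ s t, ReadOnce.sq F i j p s t = (op (s ^^ s₁) (t ^^ s₂) ^^ s₀) := by
  obtain ⟨-, H, hH, hF⟩ := L.part
  have hij : i ≠ j := fun e => Finset.disjoint_left.1 L.disj hi (e ▸ hj)
  have key : ∀ s t, ReadOnce.sq F i j p s t =
      H (op (ψ (Function.update p i s)) (φ (Function.update p j t))) p := by
    intro s t
    simp only [ReadOnce.sq]
    rw [hF]
    have e1 : ψ (Function.update (Function.update p i s) j t) = ψ (Function.update p i s) := by
      refine eq_of_agree fun k hk => ?_
      have : k ≠ j := fun e => Finset.disjoint_left.1 L.disj hk (e ▸ hj)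
      simp [this]
    have e2 : φ (Function.update (Function.update p i s) j t) = φ (Function.update p j t) := by
      refine eq_of_agree fun k hk => ?_
      have : k ≠ i := fun e => Finset.disjoint_left.1 L.disj hi (e ▸ hk)
      by_cases hkj : k = j
      · subst hkj; simp
      · simp [hkj, this]
    simp only [e1, e2]
    refine disjoint_ess_iff.1 (hH _) _ _ fun k hk => ?_
    have h1 : k ≠ i := fun e => hk (e ▸ L.left.1 hi)
    have h2 : k ≠ j := fun e => hk (e ▸ L.right.1 hj)
    simp [h1, h2]
  obtain ⟨⟨t, ht⟩, s, hs⟩ := hp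
  rw [key, key] at ht hs
  obtain ⟨s₁, hs₁⟩ := exists_twist (u := fun s => ψ (Function.update p i s))
    fun e => ht (by rw [show ψ _ = ψ _ from e])
  obtain ⟨s₂, hs₂⟩ := exists_twist (u := fun t => φ (Function.update p j t))
    fun e => hs (by rw [show φ _ = φ _ from e])
  obtain ⟨s₀, hs₀⟩ := exists_twist (u := fun c => H c p) fun e => ht (by
    revert e
    cases op (ψ (Function.update p i false)) (φ (Function.update p j t)) <;>
      cases op (ψ (Function.update p i true)) (φ (Function.update p j t)) <;> simp [eq_comm])
  refine ⟨s₁, s₂, s₀, hs₁, hs₂, fun s t => ?_⟩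
  rw [key, ← hs₁, ← hs₂]
  exact hs₀ _

theorem Lca.exists_sq {F ψ φ : Fn V} {op : Bool → Bool → Bool} (L : Lca F op ψ φ) {i j : V}
    (hi : i ∈ ess ψ) (hj : j ∈ ess φ) : ∃ p, Rel2 (ReadOnce.sq F i j p) := by
  obtain ⟨x₁, s₁, h₁⟩ := exists_literal hi
  obtain ⟨x₂, s₂, h₂⟩ := exists_literal hj
  have hij : i ≠ j := fun e => Finset.disjoint_left.1 L.disj hi (e ▸ hj)
  obtain ⟨H, hH, hF, e, he⟩ := L.part.exists_relevant ⟨i, L.left.1 hi⟩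
  have key : ∀ s t, ReadOnce.sq F i j ((ess ψ).piecewise x₁ ((ess φ).piecewise x₂ e)) (s ^^ s₁)
      (t ^^ s₂) = H (op s t) e := by
    intro s t
    simp only [ReadOnce.sq]
    rw [hF]
    have e1 : ψ (Function.update (Function.update ((ess ψ).piecewise x₁ ((ess φ).piecewise x₂ e))
        i (s ^^ s₁)) j (t ^^ s₂)) = s := by
      refine Eq.trans ?_ (h₁ s)
      refine eq_of_agree fun k hk => ?_
      have : k ≠ j := fun e => Finset.disjoint_left.1 L.disj hk (e ▸ hj)
      by_cases hki : k = i
      · subst hki; simp [this]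
      · simp [this, hki, hk]
    have e2 : φ (Function.update (Function.update ((ess ψ).piecewise x₁ ((ess φ).piecewise x₂ e))
        i (s ^^ s₁)) j (t ^^ s₂)) = t := by
      refine Eq.trans ?_ (h₂ t)
      refine eq_of_agree fun k hk => ?_
      have h1 : k ≠ i := fun e => Finset.disjoint_left.1 L.disj hi (e ▸ hk)
      have h2 : k ∉ ess ψ := Finset.disjoint_right.1 L.disj hk
      by_cases hkj : k = j
      · subst hkj; simp
      · simp [h1, h2, hkj, hk]
    simp only [e1, e2]
    refine disjoint_ess_iff.1 (hH _) _ _ fun k hk => ?_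
    have h1 : k ∉ ess ψ := fun e => hk (L.left.1 e)
    have h2 : k ∉ ess φ := fun e => hk (L.right.1 e)
    have h3 : k ≠ i := fun e => h1 (e ▸ hi)
    have h4 : k ≠ j := fun e => h2 (e ▸ hj)
    simp [h1, h2, h3, h4]
  refine ⟨(ess ψ).piecewise x₁ ((ess φ).piecewise x₂ e), ?_⟩
  have hHn : ∀ c d, c ≠ d → H c e ≠ H d e := by
    intro c d hcd
    cases c <;> cases d <;> first | exact absurd rfl hcd | exact he | exact he.symm
  obtain ⟨⟨t, ht⟩, s, hs⟩ := L.rel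
  constructor
  · refine ⟨t ^^ s₂, ?_⟩
    have h3 := hHn _ _ ht
    rw [← key, ← key] at h3
    revert h3
    cases s₁ <;> simp [eq_comm]
  · refine ⟨s ^^ s₁, ?_⟩
    have h3 := hHn _ _ hs
    rw [← key, ← key] at h3
    revert h3
    cases s₂ <;> simp [eq_comm]

theorem Lca.xorPair_iff {F ψ φ : Fn V} {op : Bool → Bool → Bool} (L : Lca F op ψ φ) {i j : V}
    (hi : i ∈ ess ψ) (hj : j ∈ ess φ) : XorPair F i j ↔ IsXor op := by
  constructor
  · rintro ⟨p, hp⟩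
    obtain ⟨s₁, s₂, s₀, -, -, h⟩ := L.sq hi hj hp.rel
    exact (isXor_twist_iff h).1 hp
  · intro hop
    obtain ⟨p, hp⟩ := L.exists_sq hi hj
    obtain ⟨s₁, s₂, s₀, -, -, h⟩ := L.sq hi hj hp
    exact ⟨p, (isXor_twist_iff h).2 hop⟩

theorem Dec.exists_op {r h : Fn V} {a c : V} {χ : V → Fn V} (hac : a ≠ c)
    (D : Dec r {a, c} h χ) : ∃ op, (∀ y, h y = op (y a) (y c)) ∧
      (∀ x, r x = op (χ a x) (χ c x)) ∧ Rel2 op := by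
  set op : Bool → Bool → Bool := fun s t =>
    h (Function.update (Function.update (fun _ => false) a s) c t) with hop
  have hh : ∀ y, h y = op (y a) (y c) := by
    intro y
    refine eq_of_agree fun i hi => ?_
    rw [D.ess_eq] at hi
    simp only [Finset.mem_insert, Finset.mem_singleton] at hi
    rcases hi with rfl | rfl
    · simp [hac]
    · simp
  refine ⟨op, hh, fun x => by rw [D.eq, hh], ?_, ?_⟩
  · obtain ⟨y, hy⟩ := exists_ne_of_mem_ess (D.ess_eq.symm ▸ (by simp) : a ∈ ess h)
    rw [hh, hh] at hy
    simp only [Function.update_self, Function.update_of_ne hac.symm] at hy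
    exact ⟨_, hy⟩
  · obtain ⟨y, hy⟩ := exists_ne_of_mem_ess (D.ess_eq.symm ▸ (by simp) : c ∈ ess h)
    rw [hh, hh] at hy
    simp only [Function.update_self, Function.update_of_ne hac] at hy
    exact ⟨_, hy⟩

theorem Dec.lca {r h : Fn V} {a c : V} {χ : V → Fn V} (hac : a ≠ c) (D : Dec r {a, c} h χ)
    {op : Bool → Bool → Bool} (hr : ∀ x, r x = op (χ a x) (χ c x)) (hop : Rel2 op) :
    Lca r op (χ a) (χ c) :=
  (Part.refl r).lca hr (D.disj a (by simp) c (by simp) hac) ⟨a, D.mem a (by simp)⟩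
    ⟨c, D.mem c (by simp)⟩ hop

theorem NF.exists_pair {f : Fn V} {w : Finset V} {h : Fn V} {χ : V → Fn V} (D : NF 2 f w h χ)
    {a : V} (ha : a ∈ w) : ∃ c, a ≠ c ∧ w = {a, c} := by
  have hc : w.card = 2 := le_antisymm D.card_le D.two_le
  obtain ⟨c, hc', hca⟩ := Finset.exists_mem_ne (s := w) (by omega) a
  refine ⟨c, hca.symm, ?_⟩
  symm
  apply Finset.eq_of_subset_of_card_le
  · intro k hk
    simp only [Finset.mem_insert, Finset.mem_singleton] at hk
    rcases hk with rfl | rfl <;> assumption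
  · rw [Finset.card_pair hca.symm, hc]

theorem RO.exists_lca {F : Fn V} (hF : RO 2 F) {i j : V} (hij : i ≠ j) (hi : i ∈ ess F)
    (hj : j ∈ ess F) : ∃ op ψ φ, Lca F op ψ φ ∧ i ∈ ess ψ ∧ j ∈ ess φ ∧ RO 2 ψ := by
  induction hn : (ess F).card using Nat.strong_induction_on generalizing F with
  | _ n ih =>
  subst hn
  have h2 : 2 ≤ (ess F).card := by
    rw [← Finset.card_pair hij]
    refine Finset.card_le_card fun k hk => ?_
    simp only [Finset.mem_insert, Finset.mem_singleton] at hk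
    rcases hk with rfl | rfl <;> assumption
  obtain ⟨w, h, χ, D, hiw⟩ := hF.exists_nf_mem h2 hi
  obtain ⟨k, hik, rfl⟩ := D.exists_pair hiw
  by_cases hji : j ∈ ess (χ i)
  · obtain ⟨op, ψ, φ, L, h3⟩ := ih _ (D.card_ess_lt hiw) (D.ro i hiw) (D.mem i hiw) hji rfl
    exact ⟨op, ψ, φ, (D.dec.part hiw).trans_lca L, h3⟩
  · rw [D.dec.ess_biUnion] at hj
    have hjk : j ∈ ess (χ k) := by
      obtain ⟨m, hm, hjm⟩ := Finset.mem_biUnion.1 hj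
      simp only [Finset.mem_insert, Finset.mem_singleton] at hm
      rcases hm with rfl | rfl
      · exact absurd hjm hji
      · exact hjm
    obtain ⟨op, -, hr, hop⟩ := D.dec.exists_op hik
    exact ⟨op, χ i, χ k, D.dec.lca hik hr hop, D.mem i hiw, hjk, D.ro i hiw⟩

theorem RO.isXor_sq {F : Fn V} (hF : RO 2 F) {i j : V} (hij : i ≠ j) {p : V → Bool}
    (hp : Rel2 (sq F i j p)) (h : XorPair F i j) : IsXor (sq F i j p) := by
  obtain ⟨hi, hj⟩ := hp.mem_ess
  obtain ⟨op, ψ, φ, L, hiψ, hjφ, -⟩ := hF.exists_lca hij hi hj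
  obtain ⟨s₁, s₂, s₀, -, -, he⟩ := L.sq hiψ hjφ hp
  exact (isXor_twist_iff he).2 ((L.xorPair_iff hiψ hjφ).1 h)

theorem Agree.exists_sq {f g : Fn V} (hfg : Agree 2 f g) {i j : V} (hij : i ≠ j)
    {p : V → Bool} (hp : Rel2 (sq f i j p)) :
    ∃ p, Rel2 (sq f i j p) ∧ sq g i j p = sq f i j p := by
  obtain ⟨q, hq, he⟩ := hfg {i, j} (Finset.card_pair hij)
    ⟨p, (pair_subset_ess_iff hij f p).2 hp⟩
  refine ⟨q, (pair_subset_ess_iff hij f q).1 hq, ?_⟩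
  funext s t
  have := congrFun he (Function.update (Function.update (fun _ => false) i s) j t)
  rw [res_pair hij, res_pair hij] at this
  simpa [hij] using this.symm

/-- All relevant squares of a pair have the same type in a read-once function (`RO.isXor_sq`), so a
single agreed square decides the type for both functions. -/
theorem Agree.xorPair_iff {f g : Fn V} (hfg : Agree 2 f g) (hf : RO 2 f) (hg : RO 2 g) {i j : V}
    (hij : i ≠ j) (hi : i ∈ ess f) (hj : j ∈ ess f) : XorPair f i j ↔ XorPair g i j := by
  obtain ⟨op, ψ, φ, L, hiψ, hjφ, -⟩ := hf.exists_lca hij hi hj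
  obtain ⟨p₀, hp₀⟩ := L.exists_sq hiψ hjφ
  obtain ⟨p, hp, he⟩ := hfg.exists_sq hij hp₀
  constructor
  · intro h
    exact ⟨p, he ▸ hf.isXor_sq hij hp h⟩
  · intro h
    exact ⟨p, he ▸ hg.isXor_sq hij (he ▸ hp) h⟩

theorem Part.xorPair {F r : Fn V} (h : Part F r) {i j : V} (hr : XorPair r i j) :
    XorPair F i j := by
  obtain ⟨p, e₁, he₁⟩ := hr
  have hp : Rel2 (sq r i j p) := IsXor.rel ⟨e₁, he₁⟩
  obtain ⟨hi, hj⟩ := hp.mem_ess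
  obtain ⟨H, hH, hF, e, he⟩ := h.exists_relevant ⟨i, hi⟩
  obtain ⟨s₀, hs₀⟩ := exists_twist (u := fun c => H c e) he
  refine ⟨(ess r).piecewise p e, e₁ ^^ s₀, fun s t => ?_⟩
  rw [← Bool.xor_assoc, ← he₁, ← hs₀]
  simp only [sq]
  rw [hF]
  have e1 : r (Function.update (Function.update ((ess r).piecewise p e) i s) j t) =
      r (Function.update (Function.update p i s) j t) := by
    refine eq_of_agree fun k hk => ?_
    by_cases hkj : k = j
    · subst hkj; simp
    · by_cases hki : k = i
      · subst hki; simp [hkj]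
      · simp [hkj, hki, hk]
  rw [e1]
  refine disjoint_ess_iff.1 (hH _) _ _ fun k hk => ?_
  have h1 : k ≠ i := fun e => hk (e ▸ hi)
  have h2 : k ≠ j := fun e => hk (e ▸ hj)
  simp [h1, h2, hk]

/-- Any essential variable of a module can be made to carry its value, so all of them relate in the
same way to a variable outside. -/
theorem Mod.xorPair {F : Fn V} {M : Finset V} (hM : Mod F M) {i j y : V} (hi : i ∈ M) (hj : j ∈ M)
    (hjF : j ∈ ess F) (hy : y ∉ M) (h : XorPair F i y) : XorPair F j y := by
  obtain ⟨u, H, c, hu, hH, hF, huc⟩ := hM.normalize hj hjF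
  obtain ⟨p, hp⟩ := h
  have hiy : i ≠ y := fun e => hy (e ▸ hi)
  have hjy : j ≠ y := fun e => hy (e ▸ hj)
  have hHy : ∀ b q q', (∀ k, k ∉ M → q k = q' k) → H b q = H b q' :=
    fun b q q' hq => disjoint_ess_iff.1 (hH b) _ _ hq
  have key : ∀ s t, sq F i y p s t = H (u (Function.update p i s)) (Function.update p y t) := by
    intro s t
    simp only [sq]
    rw [hF]
    have e1 : u (Function.update (Function.update p i s) y t) = u (Function.update p i s) := by
      refine eq_of_agree fun k hk => ?_
      have : k ≠ y := fun e => hy (e ▸ hu hk)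
      simp [this]
    rw [e1]
    refine hHy _ _ _ fun k hk => ?_
    have : k ≠ i := fun e => hk (e ▸ hi)
    by_cases hky : k = y
    · subst hky; simp
    · simp [hky, this]
  obtain ⟨⟨t, ht⟩, -⟩ := hp.rel
  rw [key, key] at ht
  obtain ⟨s₁, hs₁⟩ := exists_twist (u := fun s => u (Function.update p i s))
    fun e => ht (by rw [show u _ = u _ from e])
  have key' : ∀ s t, sq F j y (M.piecewise c p) s t = H s (Function.update p y t) := by
    intro s t
    simp only [sq]
    rw [hF, huc]
    · simp only [Function.update_of_ne hjy, Function.update_self]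
      refine hHy _ _ _ fun k hk => ?_
      have : k ≠ j := fun e => hk (e ▸ hj)
      by_cases hky : k = y
      · subst hky; simp
      · simp [hky, this, hk]
    · intro k hk hkj
      have : k ≠ y := fun e => hy (e ▸ hk)
      simp [this, hkj, hk]
  refine ⟨M.piecewise c p, (isXor_twist_iff (s₁ := s₁) (s₂ := false) (s₀ := false)
    fun s t => ?_).2 hp⟩
  rw [key, key']
  have := hs₁ (s ^^ s₁)
  simp only [Bool.xor_assoc, Bool.xor_self, Bool.xor_false] at this ⊢
  rw [this]

/-- Conjunctions preserve unateness. If `i` enters with both signs, some gate on the path to it is a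
sum, and a variable of the other argument of that gate is the partner. -/
theorem RO.exists_xorPair {ψ : Fn V} (hψ : RO 2 ψ) {i : V} (hi : i ∈ ess ψ)
    (hun : ¬ ∃ c, Unate ψ i c) : ∃ j, j ≠ i ∧ XorPair ψ i j := by
  induction hn : (ess ψ).card using Nat.strong_induction_on generalizing ψ with
  | _ n ih =>
  subst hn
  by_cases hcard : 2 ≤ (ess ψ).card
  · obtain ⟨w, h, χ, D, hiw⟩ := hψ.exists_nf_mem hcard hi
    obtain ⟨k, hik, rfl⟩ := D.exists_pair hiw
    obtain ⟨op, hh, hr, hop⟩ := D.dec.exists_op hik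
    have L := D.dec.lca hik hr hop
    by_cases hx : IsXor op
    · exact ⟨k, hik.symm, (L.xorPair_iff (D.mem i hiw) (D.mem k (by simp))).2 hx⟩
    by_cases hχ : ∃ c, Unate (χ i) i c
    · exfalso
      obtain ⟨d, hd, hd'⟩ := (binary_cases (fun s t => op t s) hop.2 hop.1).resolve_left
        fun h => hx (IsXor.swap h)
      obtain ⟨c, hc⟩ := hχ
      refine hun ⟨op d false ^^ c ^^ d, fun x hx => ?_⟩
      have e : ∀ s, ψ (Function.update x i s) = op (χ i (Function.update x i s)) (χ k x) := by
        intro s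
        rw [hr]
        congr 1
        refine eq_of_agree fun m hm => ?_
        have : m ≠ i := by
          rintro rfl
          exact Finset.disjoint_left.1 L.disj (D.mem m hiw) hm
        simp [this]
      rw [e, e] at hx
      rw [e]
      have h0 := hc x fun he => hx (by rw [he])
      have h1 : χ i (Function.update x i true) = !c := by
        by_contra hne
        refine hx ?_
        rw [h0]
        congr 1
        revert hne
        cases c <;> cases χ i (Function.update x i true) <;> simp
      rw [h0, h1] at hx
      rw [h0]
      revert hx hd
      generalize χ k x = z
      cases c <;> cases d <;> cases z <;> simp only [Bool.not_false, Bool.not_true] <;>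
        cases op false false <;> cases op false true <;> cases op true false <;>
        cases op true true <;> simp
    · obtain ⟨j, hj, hX⟩ := ih _ (D.card_ess_lt hiw) (D.ro i hiw) (D.mem i hiw) hχ rfl
      exact ⟨j, hj, (D.dec.part hiw).xorPair hX⟩
  · exfalso
    have he : ess ψ = {i} := by
      symm
      apply Finset.eq_of_subset_of_card_le (by simpa using hi)
      simp; omega
    refine hun ⟨ψ (Function.update (fun _ => false) i false), fun x _ => eq_of_agree fun k hk => ?_⟩
    rw [he, Finset.mem_singleton] at hk
    subst hk; simp

end Squares

/-- Up to negations, `op` is a conjunction; its arguments decide it by the values `c` and `d`. -/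
def IsAnd (op : Bool → Bool → Bool) (c d : Bool) : Prop :=
  ∃ o, ∀ s t, op s t = (((s ^^ c) && (t ^^ d)) ^^ o)

theorem exists_isAnd {op : Bool → Bool → Bool} (h : Rel2 op) (hx : ¬ IsXor op) :
    ∃ c d, IsAnd op c d := by
  revert op
  unfold Rel2 IsXor IsAnd
  decide

theorem IsAnd.swap {op : Bool → Bool → Bool} {c d : Bool} (h : IsAnd op c d) :
    IsAnd (fun s t => op t s) d c := by
  obtain ⟨o, ho⟩ := h
  exact ⟨o, fun s t => by simp only [ho, Bool.and_comm]⟩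

theorem IsAnd.twist {op u : Bool → Bool → Bool} {c d s₁ s₂ s₀ : Bool} (h : IsAnd op c d)
    (hu : ∀ s t, u s t = (op (s ^^ s₁) (t ^^ s₂) ^^ s₀)) : IsAnd u (s₁ ^^ c) (s₂ ^^ d) := by
  obtain ⟨o, ho⟩ := h
  exact ⟨o ^^ s₀, fun s t => by rw [hu, ho]; simp only [Bool.xor_assoc]⟩

theorem IsAnd.unique {u : Bool → Bool → Bool} {c d c' d' : Bool} (h : IsAnd u c d)
    (h' : IsAnd u c' d') : c = c' ∧ d = d' := by
  obtain ⟨o, ho⟩ := h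
  obtain ⟨o', ho'⟩ := h'
  have h0 := (ho false false).symm.trans (ho' false false)
  have h1 := (ho false true).symm.trans (ho' false true)
  have h2 := (ho true false).symm.trans (ho' true false)
  have h3 := (ho true true).symm.trans (ho' true true)
  clear ho ho'
  revert c d o c' d' o'
  decide

theorem IsAnd.rel {u : Bool → Bool → Bool} {c d : Bool} (h : IsAnd u c d) : Rel2 u := by
  obtain ⟨o, ho⟩ := h
  exact ⟨⟨!d, by simp [ho]⟩, !c, by simp [ho]⟩

theorem IsAnd.not_isXor {u : Bool → Bool → Bool} {c d : Bool} (h : IsAnd u c d) : ¬ IsXor u := by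
  rintro ⟨e, he⟩
  obtain ⟨o, ho⟩ := h
  have h0 := (ho c d).symm.trans (he c d)
  have h1 := (ho c (!d)).symm.trans (he c (!d))
  clear ho he
  revert c d o e
  decide

/-! ### The case of binary gates only -/

section BinaryBasis

variable {V : Type*} [Fintype V] [DecidableEq V]

theorem Lca.isAnd_sq {F ψ φ : Fn V} {op : Bool → Bool → Bool} (L : Lca F op ψ φ) {i j : V}
    (hi : i ∈ ess ψ) (hj : j ∈ ess φ) {p : V → Bool} (hp : Rel2 (ReadOnce.sq F i j p)) {c d : Bool}
    (h : IsAnd op c d) : ∃ s₁ s₂, (∀ s, ψ (Function.update p i s) = (s ^^ s₁)) ∧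
      (∀ t, φ (Function.update p j t) = (t ^^ s₂)) ∧
      IsAnd (ReadOnce.sq F i j p) (s₁ ^^ c) (s₂ ^^ d) := by
  obtain ⟨s₁, s₂, s₀, h₁, h₂, he⟩ := L.sq hi hj hp
  exact ⟨s₁, s₂, h₁, h₂, h.twist he⟩

theorem Unate.eq_of_twist {ψ : Fn V} {i : V} {c s₁ : Bool} (h : Unate ψ i c) {p : V → Bool}
    (hp : ∀ s, ψ (Function.update p i s) = (s ^^ s₁)) : s₁ = c := by
  have := h p (by simp [hp])
  simpa [hp] using this

/-- Freeze `b` at `!β`, which lets `a` through `v`. The squares of `a` and `c` then show both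
deciding values for `a`: one comes from the square `p`, the other from the square `p''` with `a`
playing the role of `b`. So `a` is not unate in its side of the gate separating it from `c`, and
`RO.exists_xorPair` finds a partner on that side; the separating gate is a conjunction. -/
theorem exists_xorPair_of_isAnd {g : Fn V} {a b c : V} {v : Bool → Bool → Bool} {G : Bool → Fn V}
    (P : PairMod g a b v G) (hg : RO 2 g) (hca : c ≠ a) (hcb : c ≠ b) {p p' p'' : V → Bool}
    {α β x₁ y₁ : Bool} (hac : IsAnd (sq g a c p) α x₁) (hab : IsAnd (sq g a b p') (!α) β)
    (hbc : IsAnd (sq g b c p'') β y₁) :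
    ∃ y, y ≠ a ∧ y ≠ b ∧ y ≠ c ∧ XorPair g a y ∧ ¬ XorPair g y c := by
  have hane : a ≠ b := P.ne
  obtain ⟨v₀, hv⟩ : IsAnd v (!α) β := by
    have e : ∀ s t, sq g a b p' s t = G (v s t) p' := by
      intro s t
      simp only [sq]
      rw [P.eq]
      simp only [Function.update_self, Function.update_of_ne hane]
      exact P.congr _ fun k hka hkb => by simp [hka, hkb]
    obtain ⟨t, ht⟩ := hab.rel.1
    rw [e, e] at ht
    obtain ⟨τ, hτ⟩ := exists_twist (u := fun c => G c p') (by
      intro he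
      apply ht
      cases v false t <;> cases v true t <;> first | rfl | exact he | exact he.symm)
    have := hab.twist (u := v) (s₁ := false) (s₂ := false) (s₀ := τ) fun s t => by
      rw [e]
      simp [show ∀ c, G c p' = (c ^^ τ) from hτ]
    simpa using this
  -- The value `β` of `b` would decide `v` and make `a` irrelevant on this square. In the same way
  -- the value `!α` of `a` would decide `v` on the square of `b` and `c`.
  have hpb : p b = !β := by
    by_contra hne
    have hpb : p b = β := by revert hne; cases p b <;> cases β <;> simp
    obtain ⟨t, ht⟩ := hac.rel.1
    apply ht
    simp only [sq]
    rw [P.eq, P.eq]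
    simp only [Function.update_self, Function.update_of_ne hca.symm, Function.update_of_ne hcb.symm,
      Function.update_of_ne hane.symm, hpb, hv, Bool.xor_self, Bool.and_false]
    exact P.congr _ fun k hka hkb => by
      by_cases hkc : k = c
      · subst hkc; simp
      · simp [hka, hkc]
  have hpa : p'' a = α := by
    by_contra hne
    have hpa : p'' a = !α := by revert hne; cases p'' a <;> cases α <;> simp
    obtain ⟨t, ht⟩ := hbc.rel.1
    apply ht
    simp only [sq]
    rw [P.eq, P.eq]
    simp only [Function.update_self, Function.update_of_ne hca.symm, Function.update_of_ne hcb.symm,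
      Function.update_of_ne hane, hpa, hv, Bool.xor_self, Bool.false_and]
    exact P.congr _ fun k hka hkb => by
      by_cases hkc : k = c
      · subst hkc; simp
      · simp [hkb, hkc]
  set g' := res g (Finset.univ.erase b) (fun _ => !β) with hg'
  have hg'x : ∀ x, g' x = g (Function.update x b (!β)) := by
    intro x
    rw [hg', res]
    congr 1
    funext k
    by_cases hk : k = b
    · subst hk; simp
    · simp [hk]
  have hbg' : b ∉ ess g' := fun h => by
    have := ess_res_subset_left _ _ _ h
    simp at this
  have hsq : ∀ i j q, i ≠ b → j ≠ b → sq g' i j q = sq g i j (Function.update q b (!β)) := by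
    intro i j q hi hj
    funext s t
    simp only [sq]
    rw [hg'x, Function.update_comm hj, Function.update_comm hi]
  have hro : RO 2 g' := hg.res _ _
  have h1 : IsAnd (sq g' a c p) α x₁ := by
    rw [hsq _ _ _ hane hcb, ← hpb]
    simpa using hac
  have h2 : IsAnd (sq g' a c p'') (!α) y₁ := by
    have e : ∀ s t, sq g' a c p'' s t = sq g b c p'' (s ^^ !α ^^ β) t := by
      intro s t
      simp only [sq]
      rw [hg'x, P.eq, P.eq]
      simp only [Function.update_self, Function.update_of_ne hca.symm,
        Function.update_of_ne hcb.symm, Function.update_of_ne hane, hpa, hv]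
      have : (((s ^^ !α) && ((!β) ^^ β)) ^^ v₀) = (((α ^^ !α) && ((s ^^ !α ^^ β) ^^ β)) ^^ v₀) := by
        cases s <;> cases α <;> cases β <;> rfl
      rw [this]
      exact P.congr _ fun k hka hkb => by
        by_cases hkc : k = c
        · subst hkc; simp [hcb]
        · simp [hka, hkb, hkc]
    have := hbc.twist (u := sq g' a c p'') (s₁ := !α ^^ β) (s₂ := false) (s₀ := false)
      fun s t => by
        rw [e]
        simp only [Bool.xor_assoc, Bool.xor_false]
    simpa using this
  obtain ⟨ha, hc⟩ := h1.rel.mem_ess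
  obtain ⟨op, ψ, φ, L, haψ, hcφ, hroψ⟩ := hro.exists_lca hca.symm ha hc
  have hop : ¬ IsXor op := fun h =>
    h1.not_isXor (hro.isXor_sq hca.symm h1.rel ((L.xorPair_iff haψ hcφ).2 h))
  obtain ⟨c', d', hand⟩ := exists_isAnd L.rel hop
  obtain ⟨s₁, _, hs₁, -, hA₁⟩ := L.isAnd_sq haψ hcφ h1.rel hand
  obtain ⟨s₂, _, hs₂, -, hA₂⟩ := L.isAnd_sq haψ hcφ h2.rel hand
  have hun : ¬ ∃ k, Unate ψ a k := by
    rintro ⟨k, hk⟩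
    have e1 := (h1.unique hA₁).1
    have e2 := (h2.unique hA₂).1
    rw [hk.eq_of_twist hs₁] at e1
    rw [hk.eq_of_twist hs₂, ← e1] at e2
    simp at e2
  obtain ⟨y, hya, hX⟩ := hroψ.exists_xorPair haψ hun
  have hyψ : y ∈ ess ψ := by
    obtain ⟨q, hq⟩ := hX
    exact hq.rel.mem_ess.2
  have hyc : y ≠ c := fun e => Finset.disjoint_left.1 L.disj (e ▸ hyψ) hcφ
  have hPψ : Part g' ψ := L.part.trans L.left
  have hyb : y ≠ b := fun e => hbg' (e ▸ hPψ.1 hyψ)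
  refine ⟨y, hya, hyb, hyc, ?_, fun hcon => ?_⟩
  · obtain ⟨q, hq⟩ := hPψ.xorPair hX
    rw [hsq _ _ _ hane hyb] at hq
    exact ⟨_, hq⟩
  · obtain ⟨q, hq⟩ := L.exists_sq hyψ hcφ
    have hq' := hq
    rw [hsq _ _ _ hyb hcb] at hq'
    have := hg.isXor_sq hyc hq' hcon
    rw [← hsq _ _ _ hyb hcb] at this
    exact hop ((L.xorPair_iff hyψ hcφ).1 ⟨q, this⟩)

/-- The pair module gives `a` and `b` the same sum partners in `g`, hence in `f`, so `op` and `op₁`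
are of the same type. Two sums reassociate, and so do two conjunctions with matching signs.
Mismatched conjunctions, as in (a ∧ c) ∨ b, would by `exists_xorPair_of_isAnd` produce a sum partner
of `a` that has no place in `f`. -/
theorem exists_reassoc_of_two {f g ψ φ χ₁ χ₂ : Fn V} {op op₁ : Bool → Bool → Bool} {a b c : V}
    {v : Bool → Bool → Bool} {G : Bool → Fn V} (hfg : Agree 2 f g) (hf : RO 2 f) (hg : RO 2 g)
    (hgf : ess g ⊆ ess f) (P : PairMod g a b v G) (L : Lca f op ψ φ) (L₁ : Lca ψ op₁ χ₁ χ₂)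
    (hψ : ∀ x, ψ x = op₁ (χ₁ x) (χ₂ x)) (hro₁ : RO 2 χ₁) (hro : RO 2 φ) (ha : a ∈ ess χ₁)
    (hc : c ∈ ess χ₂) (hb : b ∈ ess φ) :
    ∃ K v' : Bool → Bool → Bool, ∀ s t u, op (op₁ s t) u = K (v' s u) t := by
  have haψ : a ∈ ess ψ := L₁.part.1 (L₁.left.1 ha)
  have hcψ : c ∈ ess ψ := L₁.part.1 (L₁.right.1 hc)
  have hPψ : Part f ψ := L.part.trans L.left
  have hPφ : Part f φ := L.part.trans L.right
  have hPχ : Part f χ₁ := hPψ.trans (L₁.part.trans L₁.left)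
  have L₂ : Lca f op₁ χ₁ χ₂ := hPψ.trans_lca L₁
  have haf : a ∈ ess f := hPψ.1 haψ
  have hcf : c ∈ ess f := hPψ.1 hcψ
  have hbf : b ∈ ess f := hPφ.1 hb
  have hab : a ≠ b := P.ne
  have hca : c ≠ a := fun e => Finset.disjoint_left.1 L₁.disj ha (e ▸ hc)
  have hcb : c ≠ b := fun e => Finset.disjoint_left.1 L.disj hcψ (e ▸ hb)
  obtain ⟨q, hq⟩ := L.exists_sq haψ hb
  obtain ⟨p', hp', hpe'⟩ := hfg.exists_sq hab hq
  obtain ⟨hag, hbg⟩ := (hpe'.symm ▸ hp' : Rel2 (sq g a b p')).mem_ess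
  have transfer : ∀ y, y ≠ a → y ≠ b → y ∈ ess f → (XorPair f a y ↔ XorPair f b y) := by
    intro y hya hyb hy
    rw [hfg.xorPair_iff hf hg hya.symm haf hy, hfg.xorPair_iff hf hg hyb.symm hbf hy]
    have hyM : y ∉ ({a, b} : Finset V) := by simp [hya, hyb]
    exact ⟨P.mod.xorPair (by simp) (by simp) hbg hyM, P.mod.xorPair (by simp) (by simp) hag hyM⟩
  have hiff : IsXor op₁ ↔ IsXor op := by
    rw [← L₂.xorPair_iff ha hc, transfer c hca hcb hcf, L.swap.xorPair_iff hb hcψ]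
    exact ⟨IsXor.swap, IsXor.swap⟩
  by_cases hx : IsXor op
  · obtain ⟨e, he⟩ := hx
    obtain ⟨e₁, he₁⟩ := hiff.2 ⟨e, he⟩
    refine ⟨fun w t => w ^^ t ^^ e₁ ^^ e, fun s u => s ^^ u, fun s t u => ?_⟩
    rw [he, he₁]
    cases s <;> cases t <;> cases u <;> cases e <;> cases e₁ <;> rfl
  obtain ⟨c₀, d₀, hand⟩ := exists_isAnd L.rel hx
  obtain ⟨c₁, d₁, hand₁⟩ := exists_isAnd L₁.rel fun h => hx (hiff.1 h)
  obtain ⟨o, ho⟩ := id hand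
  obtain ⟨o₁, ho₁⟩ := id hand₁
  -- Equality means that the output negation of the inner conjunction cancels against the input
  -- negation of the outer one, leaving a threefold conjunction.
  by_cases hcomp : o₁ = c₀
  · refine ⟨fun w t => (w && (t ^^ d₁)) ^^ o, fun s u => (s ^^ c₁) && (u ^^ d₀),
      fun s t u => ?_⟩
    rw [ho, ho₁, hcomp, Bool.xor_assoc _ c₀ c₀]
    simp only [Bool.xor_self, Bool.xor_false]
    rw [Bool.and_right_comm]
  exfalso
  have hnX : ∀ y z, y ∈ ess ψ → z ∈ ess φ → ¬ XorPair f y z := fun y z hy hz h =>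
    hx ((L.xorPair_iff hy hz).1 h)
  have hnX' : ∀ y z, y ∈ ess ψ → z ∈ ess φ → ¬ XorPair f z y := fun y z hy hz h =>
    hx (IsXor.swap ((L.swap.xorPair_iff hz hy).1 h))
  have hdis : ∀ y ∈ ess ψ, y ≠ b := fun y hy e => Finset.disjoint_left.1 L.disj hy (e ▸ hb)
  have hdis' : ∀ y ∈ ess φ, y ≠ a := fun y hy e => Finset.disjoint_left.1 L.disj haψ (e ▸ hy)
  obtain ⟨k, hk⟩ : ∃ k, Unate χ₁ a k := by
    by_contra hun
    obtain ⟨y, hya, hX⟩ := hro₁.exists_xorPair ha hun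
    have hy : y ∈ ess ψ := by
      obtain ⟨q, hq⟩ := hX
      exact L₁.part.1 (L₁.left.1 hq.rel.mem_ess.2)
    exact hnX' y b hy hb ((transfer y hya (hdis y hy) (hPψ.1 hy)).1 (hPχ.xorPair hX))
  obtain ⟨k₂, hk₂⟩ : ∃ k, Unate φ b k := by
    by_contra hun
    obtain ⟨y, hyb, hX⟩ := hro.exists_xorPair hb hun
    have hy : y ∈ ess φ := by
      obtain ⟨q, hq⟩ := hX
      exact hq.rel.mem_ess.2
    exact hnX a y haψ hy ((transfer y (hdis' y hy) hyb (hPφ.1 hy)).2 (hPφ.xorPair hX))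
  obtain ⟨q₁, hq₁⟩ := L₂.exists_sq ha hc
  obtain ⟨p, hp, hpe⟩ := hfg.exists_sq hca.symm hq₁
  obtain ⟨q₂, hq₂⟩ := L.swap.exists_sq hb hcψ
  obtain ⟨p'', hp'', hpe''⟩ := hfg.exists_sq hcb.symm hq₂
  obtain ⟨s₁, x₁, hs₁, -, hA₁⟩ := L₂.isAnd_sq ha hc hp hand₁
  obtain ⟨s₂, x₂, hs₂, hx₂, hA₂⟩ := L.isAnd_sq haψ hb hp' hand
  obtain ⟨s₃, x₃, hs₃, -, hA₃⟩ := L.swap.isAnd_sq hb hcψ hp'' hand.swap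
  rw [hk.eq_of_twist hs₁, ← hpe] at hA₁
  rw [hk₂.eq_of_twist hx₂, ← hpe'] at hA₂
  rw [hk₂.eq_of_twist hs₃, ← hpe''] at hA₃
  -- On the square of `a` and `b`, `ψ` varies with `a`, so `χ₂` does not decide `op₁` and `ψ` is
  -- `χ₁` twisted by `c₁` and `o₁`. As `o₁ ≠ c₀`, the deciding value of `a` is opposite to the one
  -- on the square of `a` and `c`.
  have hα : (s₂ ^^ c₀) = !(k ^^ c₁) := by
    have e : ∀ s, χ₂ (Function.update p' a s) = χ₂ p' := by
      intro s
      refine eq_of_agree fun m hm => ?_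
      have : m ≠ a := fun e => Finset.disjoint_left.1 L₁.disj ha (e ▸ hm)
      simp [this]
    have h0 := hs₂ false
    have h1 := hs₂ true
    rw [hψ, ho₁, e] at h0 h1
    have hne : χ₁ (Function.update p' a false) ≠ χ₁ (Function.update p' a true) := by
      intro he
      rw [he, h1] at h0
      revert h0
      cases s₂ <;> simp
    have hk0 := hk _ hne
    rw [hk0] at h0 hne
    revert h0 h1 hne hcomp
    clear * -
    generalize χ₂ p' = z
    generalize χ₁ (Function.update p' a true) = z'
    revert k c₁ d₁ o₁ s₂ c₀ z z'
    decide
  rw [hα] at hA₂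
  obtain ⟨y, hya, hyb, hyc, hX, hnXg⟩ := exists_xorPair_of_isAnd P hg hca hcb hA₁ hA₂ hA₃
  have hyg : y ∈ ess g := by
    obtain ⟨q, hq⟩ := hX
    exact hq.rel.mem_ess.2
  have hyf := hgf hyg
  have hXa : XorPair f a y := (hfg.xorPair_iff hf hg hya.symm haf hyf).2 hX
  have hXb := (transfer y hya hyb hyf).1 hXa
  have hnc : ¬ XorPair f y c := fun h => hnXg ((hfg.xorPair_iff hf hg hyc hyf hcf).1 h)
  -- Inside `ψ` or `φ`, the variable `y` would meet `b` or `a` at `op`, which is not a sum. Outside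
  -- both, the module formed by all variables of `op (ψ x) (φ x)` would make `y` a partner of `c`
  -- too.
  by_cases hyψ : y ∈ ess ψ
  · exact hnX' y b hyψ hb hXb
  by_cases hyφ : y ∈ ess φ
  · exact hnX a y haψ hyφ hXa
  have hyr : y ∉ ess fun x => op (ψ x) (φ x) := by
    intro hy
    obtain ⟨x, hx⟩ := exists_ne_of_mem_ess hy
    apply hx
    congr 1
    · exact eq_of_agree fun m hm => by
        have : m ≠ y := fun e => hyψ (e ▸ hm)
        simp [this]
    · exact eq_of_agree fun m hm => by
        have : m ≠ y := fun e => hyφ (e ▸ hm)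
        simp [this]
  exact hnc (XorPair.symm hyc.symm
    (L.part.mod.xorPair (L.left.1 haψ) (L.left.1 hcψ) hcf hyr hXa))

end BinaryBasis

/-! ### Minimal modules of `g` are modules of `f` -/

section CommonModules

variable {V : Type*} [Fintype V] [DecidableEq V]

/-- In either alternative `h` is determined by `x a` and one value computed from the other
variables, so the latter form a module of intermediate size. -/
theorem Prime.not_overlap {h : Fn V} (hp : Prime h) (h3 : 3 ≤ (ess h).card) {a : V}
    (ha : a ∈ ess h) (hov : (∃ c, ∀ z z', h (Function.update z a c) = h (Function.update z' a c)) ∨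
      ∀ z, h (Function.update z a true) = !h (Function.update z a false)) : False := by
  have hsub : ∀ c, ess (fun x => h (Function.update x a c)) ⊆ (ess h).erase a := by
    intro c
    rw [ess_subset_iff]
    intro x y hxy
    refine eq_of_agree fun i hi => ?_
    by_cases hia : i = a
    · subst hia; simp
    · simp [hia, hxy i (Finset.mem_erase.2 ⟨hia, hi⟩)]
  have hself : ∀ x, h (Function.update x a (x a)) = h x := fun x => by simp
  have hmod : Mod h ((ess h).erase a) := by
    rcases hov with ⟨c, hc⟩ | hc
    · refine ⟨fun x => h (Function.update x a (!c)), fun b x =>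
        if x a = c then h (Function.update (fun _ => false) a c) else b, hsub _, fun b => ?_,
        fun x => ?_⟩
      · rw [disjoint_ess_iff]
        intro x y hxy
        simp only [hxy a (by simp)]
      · by_cases hx : x a = c
        · simp only [hx, if_true]
          rw [← hself x, hx]
          exact hc _ _
        · simp only [hx, if_false]
          have : (!c) = x a := by revert hx; cases x a <;> cases c <;> simp
          rw [this, hself]
    · refine ⟨fun x => h (Function.update x a false), fun b x => b ^^ x a, hsub _, fun b => ?_,
        fun x => ?_⟩
      · rw [disjoint_ess_iff]
        intro x y hxy
        simp only [hxy a (by simp)]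
      · refine (hself x).symm.trans ?_
        change _ = (h (Function.update x a false) ^^ x a)
        cases x a <;> simp [hc]
  have := hp _ hmod (Finset.erase_subset _ _) (by rw [Finset.card_erase_of_mem ha]; omega)
  rw [← this] at ha
  simp at ha

/-- With the variables outside `M` frozen at a point where the value of `M` matters, the restriction
is that value up to negation. Hence `A` cuts out a module of it, which is a module of `g` by
`Mod.trans`. -/
theorem Mod.inter_of_res {g : Fn V} {M A w : Finset V} {p : V → Bool} (hM : Mod g M)
    (hMne : M.Nonempty) (hMp : M ⊆ ess (ReadOnce.res g w p)) (hA : Mod (ReadOnce.res g w p) A) :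
    Mod g (M ∩ A) := by
  obtain ⟨v, F, hv, hF, hg⟩ := hM
  obtain ⟨a, ha⟩ := hMne
  have hMw : M ⊆ w := hMp.trans (ess_res_subset_left _ _ _)
  obtain ⟨x, hx⟩ := exists_ne_of_mem_ess (hMp ha)
  have key : ∀ y, (∀ i, i ∉ M → y i = x i) →
      ReadOnce.res g w p y = F (v y) (w.piecewise x p) := by
    intro y hy
    simp only [ReadOnce.res]
    rw [hg]
    have e1 : v (w.piecewise y p) = v y := eq_of_agree fun i hi => by simp [hMw (hv hi)]
    rw [e1]
    refine disjoint_ess_iff.1 (hF _) _ _ fun i hi => ?_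
    by_cases hiw : i ∈ w <;> simp [hiw, hy i hi]
  have hne : ∀ i, i ∉ M → i ≠ a := fun i hi e => hi (e ▸ ha)
  rw [key _ fun i hi => by simp [hne i hi], key _ fun i hi => by simp [hne i hi]] at hx
  obtain ⟨τ, hτ⟩ := exists_twist (u := fun c => F c (w.piecewise x p)) (by
    revert hx
    cases v (Function.update x a false) <;> cases v (Function.update x a true) <;>
      simp [eq_comm])
  refine Mod.trans Finset.inter_subset_left hF hg ?_
  refine hA.subst (fun y => M.piecewise y x) τ (fun y => ?_) ?_ ?_
  · rw [key _ fun i hi => by simp [hi]]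
    have e1 : v (M.piecewise y x) = v y := eq_of_agree fun i hi => by simp [hv hi]
    rw [e1, show F (v y) _ = _ from hτ _]
    simp
  · intro j hj y y' hyy
    by_cases hjM : j ∈ M
    · simp [hjM, hyy j (Finset.mem_inter.2 ⟨hjM, hj⟩)]
    · simp [hjM]
  · intro j hj y y' hyy
    by_cases hjM : j ∈ M
    · simp [hjM, hyy j fun h => hj (Finset.mem_inter.1 h).2]
    · simp [hjM]

theorem ess_apply (b : V) : ess (fun x : V → Bool => x b) = {b} := by
  apply Finset.Subset.antisymm
  · rw [ess_subset_iff]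
    intro x y hxy
    exact hxy b (by simp)
  · rw [Finset.singleton_subset_iff]
    exact mem_ess_of_ne (x := Function.update (fun _ => false) b false)
      (y := Function.update (fun _ => false) b true) (by simp) fun j hj => by simp [hj]

/-- Substituting a gate into an argument of a binary operation gives a gate. -/
theorem Dec.insert_op {r ψ φ h : Fn V} {op : Bool → Bool → Bool} {w : Finset V} {χ : V → Fn V}
    {b : V} (hr : ∀ x, r x = op (ψ x) (φ x)) (hop : Rel2 op) (hd : Disjoint (ess ψ) (ess φ))
    (D : Dec ψ w h χ) (hw : w.Nonempty) (hb : b ∈ ess φ) :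
    Dec r (insert b w) (fun y => op (h y) (y b)) (Function.update χ b φ) := by
  have hsub : ∀ i ∈ w, ess (χ i) ⊆ ess ψ := fun i hi => (D.part hi).1
  have hbw : b ∉ w := fun hbw => Finset.disjoint_left.1 hd (hsub b hbw (D.mem b hbw)) hb
  have hne : ∀ i ∈ w, i ≠ b := fun i hi e => hbw (e ▸ hi)
  have hdh : Disjoint (ess h) (ess fun y : V → Bool => y b) := by
    rw [D.ess_eq, ess_apply, Finset.disjoint_singleton_right]
    exact hbw
  refine ⟨fun x => ?_, ?_, ?_, ?_⟩
  · simp only [Function.update_self]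
    rw [hr, D.eq]
    congr 1
    refine eq_of_agree fun i hi => ?_
    rw [D.ess_eq] at hi
    simp [hne i hi]
  · apply Finset.Subset.antisymm
    · rw [ess_subset_iff]
      intro x y hxy
      have e : h x = h y := eq_of_agree fun i hi =>
        hxy i (Finset.mem_insert_of_mem (D.ess_eq ▸ hi))
      simp only [e, hxy b (Finset.mem_insert_self _ _)]
    · rw [Finset.insert_subset_iff]
      constructor
      · refine (Part.op_right hdh (by rwa [D.ess_eq]) hop.2).1 ?_
        simp [ess_apply]
      · have := (Part.op_left hdh (by rw [ess_apply]; simp) hop.1).1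
        rwa [D.ess_eq] at this
  · intro i hi j hj hij
    rcases Finset.mem_insert.1 hi with rfl | hi
    · rcases Finset.mem_insert.1 hj with rfl | hj
      · exact absurd rfl hij
      · simpa [hne j hj] using (hd.mono_left (hsub j hj)).symm
    · rcases Finset.mem_insert.1 hj with rfl | hj
      · simpa [hne i ‹i ∈ w›] using (hd.mono_left (hsub i ‹i ∈ w›))
      · simpa [hne i hi, hne j hj] using D.disj i hi j hj hij
  · intro i hi
    rcases Finset.mem_insert.1 hi with rfl | hi
    · simpa using hb
    · simpa [hne i hi] using D.mem i hi

/-- The gate of `ψ` is confronted with the pair module. Of its possible arities only 2 survives, and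
then `r` can be rewritten so that `χ a` and `φ` are combined before `χ c`; the combination is a
smaller part of `f` containing both `a` and `b`, to which `ih` applies. -/
theorem mod_pair_of_agree {l : ℕ} {op : Bool → Bool → Bool} {f g r ψ φ : Fn V} {a b : V}
    {v : Bool → Bool → Bool} {G : Bool → Fn V} (hfg : Agree l f g) (hl : l ≤ (ess f).card)
    (hf : RO l f) (hg : RO l g) (hgf : ess g ⊆ ess f) (P : PairMod g a b v G) (hr : Part f r)
    (hreq : ∀ x, r x = op (ψ x) (φ x)) (hop : Rel2 op) (hd : Disjoint (ess ψ) (ess φ))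
    (hψ : RO l ψ) (hφ : RO l φ) (ha : a ∈ ess ψ) (hb : b ∈ ess φ) (h2 : 2 ≤ (ess ψ).card)
    (ih : ∀ r', Part f r' → RO l r' → a ∈ ess r' → b ∈ ess r' → (ess r').card < (ess r).card →
      Mod f {a, b}) : Mod f {a, b} := by
  have L : Lca f op ψ φ := hr.lca hreq hd ⟨a, ha⟩ ⟨b, hb⟩ hop
  have hr' : r = fun x => op (ψ x) (φ x) := funext hreq
  obtain ⟨B, C⟩ := L.ctx
  obtain ⟨w, h, χ, D, haw⟩ := hψ.exists_nf_mem h2 ha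
  have hl2 : 2 ≤ l := D.two_le.trans D.card_le
  have hPψ : Part f ψ := L.part.trans L.left
  have hab : a ≠ b := P.ne
  have hsub : ∀ i ∈ w, ess (χ i) ⊆ ess ψ := fun i hi => (D.dec.part hi).1
  have reassoc : ∀ c, a ≠ c → c ∈ w → ∀ op₁ K v' : Bool → Bool → Bool,
      (∀ x, ψ x = op₁ (χ a x) (χ c x)) → (∀ s t u, op (op₁ s t) u = K (v' s u) t) →
      Mod f {a, b} := by
    intro c hac hcw op₁ K v' hψeq hK
    have hcb : c ≠ b := fun e =>
      Finset.disjoint_left.1 hd (hsub c hcw (D.mem c hcw)) (e ▸ hb)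
    set r' : Fn V := fun x => v' (χ a x) (φ x) with hr'def
    have hrr' : ∀ x, r x = K (r' x) (χ c x) := fun x => by rw [hreq, hψeq, hK]
    have hr's : ess r' ⊆ ess (χ a) ∪ ess φ := by
      rw [ess_subset_iff]
      intro x y hxy
      have e1 : χ a x = χ a y := eq_of_agree fun i hi => hxy i (Finset.mem_union_left _ hi)
      have e2 : φ x = φ y := eq_of_agree fun i hi => hxy i (Finset.mem_union_right _ hi)
      simp only [hr'def, e1, e2]
    have hdc : Disjoint (ess (χ c)) (ess (χ a) ∪ ess φ) := by
      rw [Finset.disjoint_union_right]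
      exact ⟨D.disj c hcw a haw hac.symm, hd.mono_left (hsub c hcw)⟩
    have hsubr : ess (χ a) ∪ ess φ ⊆ ess r := by
      rw [hr']
      exact Finset.union_subset ((hsub a haw).trans L.left.1) L.right.1
    have hmem : ∀ i, i ∈ ess (χ a) ∪ ess φ → i ∈ ess r' := by
      intro i hi
      obtain ⟨x, hx⟩ := exists_ne_of_mem_ess (hsubr hi)
      have e : χ c (Function.update x i false) = χ c (Function.update x i true) := by
        refine eq_of_agree fun m hm => ?_
        have : m ≠ i := fun e => Finset.disjoint_left.1 hdc hm (e ▸ hi)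
        simp [this]
      rw [hrr', hrr', e] at hx
      exact mem_ess_of_ne (fun he => hx (by rw [he])) fun j hj => by simp [hj]
    refine ih r' (hr.trans ⟨hr's.trans hsubr, fun s x => K s (χ c x), fun s => ?_, hrr'⟩) ?_
      (hmem a (Finset.mem_union_left _ (D.mem a haw))) (hmem b (Finset.mem_union_right _ hb)) ?_
    · rw [disjoint_ess_iff]
      intro x y hxy
      have : χ c x = χ c y :=
        disjoint_ess_iff.1 (hdc.mono_right hr's) _ _ hxy
      simp only [this]
    · refine RO.node _ {a, b} (fun y => v' (y a) (y b)) (Function.update χ b φ)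
        (by rw [Finset.card_pair hab]; exact hl2) ?_ ?_ ?_ ?_
      · rw [ess_subset_iff]
        intro x y hxy
        simp only [hxy a (by simp), hxy b (by simp)]
      · intro i hi
        simp only [Finset.mem_insert, Finset.mem_singleton] at hi
        rcases hi with rfl | rfl
        · simpa [hab] using D.ro i haw
        · simpa using hφ
      · have hd' : Disjoint (ess (χ a)) (ess φ) := hd.mono_left (hsub a haw)
        intro i hi j hj hij
        simp only [Finset.mem_insert, Finset.mem_singleton] at hi hj
        rcases hi with rfl | rfl <;> rcases hj with rfl | rfl
        · exact absurd rfl hij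
        · simpa [hab] using hd'
        · simpa [hab] using hd'.symm
        · exact absurd rfl hij
      · intro x
        simp [hr'def, hab]
    · apply Finset.card_lt_card
      rw [Finset.ssubset_iff_of_subset (hr's.trans hsubr)]
      refine ⟨c, ?_, fun hc => Finset.disjoint_left.1 hdc (D.mem c hcw) (hr's hc)⟩
      rw [hr']
      exact L.left.1 (hsub c hcw (D.mem c hcw))
  have hrel := C.exists_rel ha (hPψ.1 ha)
  have GC := C.gateCtx D.dec hb
  rcases lt_or_eq_of_le D.card_le with hlt | heq
  · by_cases h3 : 3 ≤ w.card
    · exfalso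
      obtain ⟨ho, he⟩ := GC.overlap_of_card_lt hfg hl hlt D.ess_eq hrel hop.1 hop.2 haw P
      refine D.prime.not_overlap (by rwa [D.ess_eq]) (D.ess_eq.symm ▸ haw : a ∈ ess h) ?_
      rcases binary_cases op hop.1 hop.2 with h | h
      · exact Or.inr (he h)
      · exact Or.inl (ho h)
    · have hw2 : w.card = 2 := by have := D.two_le; omega
      obtain ⟨c, hcw, hca⟩ := Finset.exists_mem_ne (s := w) (by omega) a
      have hw : w = {a, c} := by
        symm
        apply Finset.eq_of_subset_of_card_le
        · intro k hk
          simp only [Finset.mem_insert, Finset.mem_singleton] at hk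
          rcases hk with rfl | rfl <;> assumption
        · rw [Finset.card_pair hca.symm, hw2]
      have hbw : b ∉ w := GC.notMem
      have hbc : b ≠ c := fun e => hbw (e ▸ hcw)
      subst hw
      obtain ⟨op₁, hh, hψeq, -⟩ := D.dec.exists_op hca.symm
      -- Merging the two binary gates gives a ternary gate, still within the bound since `w.card = 2
      -- < l`. That `{a, b}` is a module of it is exactly the reassociation wanted.
      have hm := hfg.mod_gate hl hr (Dec.insert_op hreq hop hd D.dec ⟨a, haw⟩ hb)
        (by rw [Finset.card_insert_of_notMem hbw]; omega) P.mod
      have hint : ({a, b} : Finset V) ∩ insert b {a, c} = {a, b} := by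
        apply Finset.inter_eq_left.2
        intro k hk
        simp only [Finset.mem_insert, Finset.mem_singleton] at hk ⊢
        tauto
      rw [hint] at hm
      obtain ⟨v', K, Pk⟩ := hm.pairMod hab
      refine reassoc c hca.symm hcw op₁ (fun s t => K s (Function.update (fun _ => false) c t)) v'
        hψeq fun s t u => ?_
      have := Pk.eq (Function.update (Function.update (Function.update (fun _ => false) c t) a s) b u)
      simp only [hh, Function.update_self, Function.update_of_ne hab, Function.update_of_ne hbc.symm,
        Function.update_of_ne hca] at this
      rw [this]
      exact Pk.congr _ fun i hia hib => by simp [hia, hib]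
  · by_cases hl3 : 3 ≤ l
    · exfalso
      refine not_pairMod_of_prime hfg hg hPψ D.dec D.prime GC heq hl3 hrel hop.1 hop.2 haw
        (fun hodd => ?_) P
      rw [Function.update_of_ne hab]
      exact exists_unate hfg hl hl3 hg P hodd hop.2 (C.child D.dec haw)
        (hPψ.trans (D.dec.part haw)) (D.ro a haw) (D.mem a haw) hb
    · obtain rfl : l = 2 := by omega
      obtain ⟨c, hac, rfl⟩ := D.exists_pair haw
      obtain ⟨op₁, -, hψeq, hop₁⟩ := D.dec.exists_op hac
      have hcw : c ∈ ({a, c} : Finset V) := by simp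
      obtain ⟨K, v', hK⟩ := exists_reassoc_of_two hfg hf hg hgf P L (D.dec.lca hac hψeq hop₁) hψeq
        (D.ro a haw) hφ (D.mem a haw) (D.mem c hcw) hb
      exact reassoc c hac hcw op₁ K v' hψeq hK

/-- A minimal module of `g` is a module of `f`, if `g` agrees with `f` on sufficiently many
relevance hypercubes of `f`. -/
theorem Mod.of_agree {l : ℕ} {f g r : Fn V} {M : Finset V} (hfg : Agree l f g)
    (hl : l ≤ (ess f).card) (hf : RO l f) (hg : RO l g) (hgf : ess g ⊆ ess f) (hM : Mod g M)
    (h2 : 2 ≤ M.card) (hMl : M.card ≤ l)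
    (hmin : ∀ I ⊆ M, Mod g I → 2 ≤ I.card → I = M) (hr : Part f r)
    (hro : RO l r) (hMr : M ⊆ ess r) : Mod f M := by
  induction hn : (ess r).card using Nat.strong_induction_on generalizing r with
  | _ n ih =>
  subst hn
  obtain ⟨w, h, φ, D⟩ := hro.exists_nf (h2.trans (Finset.card_le_card hMr))
  by_cases hone : ∃ i ∈ w, M ⊆ ess (φ i)
  · obtain ⟨i, hi, hMi⟩ := hone
    exact ih _ (D.card_ess_lt hi) (hr.trans (D.dec.part hi)) (D.ro i hi) hMi rfl
  have hfind : ∀ m ∈ M, ∃ i ∈ w, m ∈ ess (φ i) := by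
    intro m hm
    have := hMr hm
    rw [D.dec.ess_biUnion] at this
    simpa using this
  obtain ⟨i₁, i₂, a, b, hi₁, hi₂, hi, haM, hbM, ha, hb⟩ : ∃ i₁ i₂ a b, i₁ ∈ w ∧ i₂ ∈ w ∧
      i₁ ≠ i₂ ∧ a ∈ M ∧ b ∈ M ∧ a ∈ ess (φ i₁) ∧ b ∈ ess (φ i₂) := by
    obtain ⟨a, haM⟩ : M.Nonempty := Finset.card_pos.1 (by omega)
    obtain ⟨i₁, hi₁, ha⟩ := hfind a haM
    have : ¬ M ⊆ ess (φ i₁) := fun h => hone ⟨i₁, hi₁, h⟩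
    obtain ⟨b, hbM, hb⟩ := Finset.not_subset.1 this
    obtain ⟨i₂, hi₂, hb'⟩ := hfind b hbM
    exact ⟨i₁, i₂, a, b, hi₁, hi₂, fun e => hb (e ▸ hb'), haM, hbM, ha, hb'⟩
  by_cases h3 : 3 ≤ w.card
  · have := hfg.ess_subset_of_prime hl hM hr D h3 hi₁ hi₂ hi haM hbM ha hb
    rw [hMr.antisymm this]
    exact hr.mod
  have hw2 : w.card = 2 := by have := D.two_le; omega
  have hw : w = {i₁, i₂} := by
    symm
    apply Finset.eq_of_subset_of_card_le
    · intro k hk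
      simp only [Finset.mem_insert, Finset.mem_singleton] at hk
      rcases hk with rfl | rfl <;> assumption
    · rw [Finset.card_pair hi, hw2]
  have hab : a ≠ b := fun e => Finset.disjoint_left.1 (D.disj i₁ hi₁ i₂ hi₂ hi) ha (e ▸ hb)
  -- On an agreed hypercube with all of `M` relevant, the arguments of the binary gate cut out
  -- modules of `g` inside `M`. Minimality leaves each of them at most one element, so `M` would
  -- have at most two.
  by_cases hM3 : 3 ≤ M.card
  · exfalso
    obtain ⟨p, hp⟩ := hfg.sep_module hl hM hro hr
    rw [Finset.inter_eq_left.2 hMr] at hp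
    obtain ⟨w', q, hMw', -, hq, he⟩ := hfg.extend hl (hr.sep hp) hMl
    have hcard : ∀ k ∈ w, (M ∩ ess (φ k)).card ≤ 1 := by
      intro k hk
      by_contra hc
      have hmod := (hr.trans (D.dec.part hk)).mod.res w' q
      rw [he] at hmod
      have hI := hM.inter_of_res ⟨a, haM⟩ (hMw'.trans (he ▸ hq)) hmod
      exact hone ⟨k, hk, Finset.inter_eq_left.1 (hmin _ Finset.inter_subset_left hI (by omega))⟩
    have hun : M = (M ∩ ess (φ i₁)) ∪ (M ∩ ess (φ i₂)) := by
      rw [← Finset.inter_union_distrib_left]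
      symm
      apply Finset.inter_eq_left.2
      intro m hm
      obtain ⟨i, hiw, hmi⟩ := hfind m hm
      rw [hw] at hiw
      simp only [Finset.mem_insert, Finset.mem_singleton] at hiw
      rcases hiw with rfl | rfl
      · exact Finset.mem_union_left _ hmi
      · exact Finset.mem_union_right _ hmi
    have h1 := hcard i₁ hi₁
    have h2 := hcard i₂ hi₂
    have := Finset.card_union_le (M ∩ ess (φ i₁)) (M ∩ ess (φ i₂))
    rw [← hun] at this
    omega
  · have hMab : M = {a, b} := by
      symm
      apply Finset.eq_of_subset_of_card_le
      · intro k hk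
        simp only [Finset.mem_insert, Finset.mem_singleton] at hk
        rcases hk with rfl | rfl <;> assumption
      · rw [Finset.card_pair hab]; omega
    obtain ⟨h', φ', D', -⟩ := D.toPre.rename D.prime (fun i => if i = i₁ then a else b) (by
      intro i hiw
      rw [hw] at hiw
      simp only [Finset.mem_insert, Finset.mem_singleton] at hiw
      rcases hiw with rfl | rfl
      · simpa using ha
      · simpa [hi.symm] using hb)
    have himg : w.image (fun i => if i = i₁ then a else b) = {a, b} := by
      rw [hw]
      simp [Finset.image_insert, hi.symm]
    rw [himg] at D'
    subst hMab
    obtain ⟨op, -, hreq, hop⟩ := D'.dec.exists_op hab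
    obtain ⟨v, G, P⟩ := hM.pairMod hab
    have haw : a ∈ ({a, b} : Finset V) := by simp
    have hbw : b ∈ ({a, b} : Finset V) := by simp
    have hd := D'.disj a haw b hbw hab
    have ih' : ∀ r', Part f r' → RO l r' → a ∈ ess r' → b ∈ ess r' →
        (ess r').card < (ess r).card → Mod f {a, b} := by
      intro r' hr' hro' ha' hb' hc'
      refine ih _ hc' hr' hro' ?_ rfl
      intro k hk
      simp only [Finset.mem_insert, Finset.mem_singleton] at hk
      rcases hk with rfl | rfl <;> assumption
    by_cases hA : 2 ≤ (ess (φ' a)).card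
    · exact mod_pair_of_agree hfg hl hf hg hgf P hr hreq hop hd (D'.ro a haw) (D'.ro b hbw)
        (D'.mem a haw) (D'.mem b hbw) hA ih'
    by_cases hB : 2 ≤ (ess (φ' b)).card
    · rw [Finset.pair_comm]
      refine mod_pair_of_agree hfg hl hf hg hgf P.swap hr (op := fun s t => op t s) hreq hop.swap
        hd.symm (D'.ro b hbw) (D'.ro a haw) (D'.mem b hbw) (D'.mem a haw) hB ?_
      intro r' h1 h2 h3 h4 h5
      rw [Finset.pair_comm]
      exact ih' r' h1 h2 h4 h3 h5
    have hsing : ∀ i, i ∈ ess (φ' i) → ¬ 2 ≤ (ess (φ' i)).card → ess (φ' i) = {i} := by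
      intro i hi hc
      symm
      apply Finset.eq_of_subset_of_card_le (by simpa using hi)
      simp; omega
    have : ess r = {a, b} := by
      rw [D'.dec.ess_biUnion]
      simp only [Finset.biUnion_insert, Finset.singleton_biUnion]
      rw [hsing a (D'.mem a haw) hA, hsing b (D'.mem b hbw) hB]
      rfl
    rw [← this]
    exact hr.mod

end CommonModules

/-! ### Collapsing a common module; uniqueness -/

section Uniqueness

variable {V : Type*} [Fintype V] [DecidableEq V]

/-- More than `l` variables cannot be distributed one by one over at most `l` arguments, so some
argument has at least two. Descend until such an argument has at most `l` variables. -/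
theorem RO.exists_mod {l : ℕ} {g : Fn V} (hg : RO l g) (hl : l < (ess g).card)
    (h2 : 2 ≤ (ess g).card) : ∃ M ⊆ ess g, 2 ≤ M.card ∧ M.card ≤ l ∧ Mod g M := by
  induction hn : (ess g).card using Nat.strong_induction_on generalizing g with
  | _ n ih =>
  subst hn
  obtain ⟨w, h, φ, D⟩ := hg.exists_nf h2
  obtain ⟨i, hi, hi2⟩ : ∃ i ∈ w, 2 ≤ (ess (φ i)).card := by
    by_contra! hcon
    have : (ess g).card ≤ w.card := by
      rw [D.dec.ess_biUnion]
      refine Finset.card_biUnion_le.trans ?_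
      calc ∑ i ∈ w, (ess (φ i)).card ≤ ∑ i ∈ w, 1 :=
            Finset.sum_le_sum fun i hi => by have := hcon i hi; omega
        _ = w.card := by simp
    have := D.card_le
    omega
  have hp := D.dec.part hi
  by_cases hil : (ess (φ i)).card ≤ l
  · exact ⟨_, hp.1, hi2, hil, hp.mod⟩
  · obtain ⟨M, hM, hM2, hMl, hmod⟩ := ih _ (D.card_ess_lt hi) (D.ro i hi) (by omega) hi2 rfl
    obtain ⟨-, F, hF, hf⟩ := id hp
    exact ⟨M, hM.trans hp.1, hM2, hMl, Mod.trans hM hF hf hmod⟩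

/-- A common module of two functions that agree on a hypercube on which it is relevant carries the
same value in both. -/
theorem Mod.exists_common {f g : Fn V} {M w : Finset V} {p : V → Bool} {a : V} (hf : Mod f M)
    (hg : Mod g M) (ha : a ∈ M) (hMw : M ⊆ w) (hap : a ∈ ess (ReadOnce.res f w p))
    (he : ReadOnce.res f w p = ReadOnce.res g w p) :
    ∃ (u : Fn V) (F G : Bool → Fn V) (c : V → Bool), ess u ⊆ M ∧ (∀ b, Disjoint (ess (F b)) M) ∧
      (∀ b, Disjoint (ess (G b)) M) ∧ (∀ x, f x = F (u x) x) ∧ (∀ x, g x = G (u x) x) ∧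
      ∀ x, (∀ j ∈ M, j ≠ a → x j = c j) → u x = x a := by
  obtain ⟨u, F, c, hu, hF, hfe, huc⟩ := hf.normalize ha (ess_res_subset_right _ _ _ hap)
  obtain ⟨v, G, hv, hG, hge⟩ := hg
  obtain ⟨x, hx⟩ := exists_ne_of_mem_ess hap
  have key : ∀ (f' u' : Fn V) (F' : Bool → Fn V), ess u' ⊆ M → (∀ b, Disjoint (ess (F' b)) M) →
      (∀ x, f' x = F' (u' x) x) → ∀ y, (∀ i, i ∉ M → y i = x i) →
      ReadOnce.res f' w p y = F' (u' y) (w.piecewise x p) := by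
    intro f' u' F' hu' hF' hf' y hy
    simp only [ReadOnce.res]
    rw [hf']
    have e1 : u' (w.piecewise y p) = u' y := eq_of_agree fun i hi => by simp [hMw (hu' hi)]
    rw [e1]
    refine disjoint_ess_iff.1 (hF' _) _ _ fun i hi => ?_
    by_cases hiw : i ∈ w <;> simp [hiw, hy i hi]
  have hne : ∀ b i, i ∉ M → Function.update x a b i = x i := by
    intro b i hi
    have : i ≠ a := fun e => hi (e ▸ ha)
    simp [this]
  have tw : ∀ (u' : Fn V) (F' : Bool → Fn V),
      F' (u' (Function.update x a false)) (w.piecewise x p) ≠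
        F' (u' (Function.update x a true)) (w.piecewise x p) →
      ∃ τ, ∀ c, F' c (w.piecewise x p) = (c ^^ τ) := by
    intro u' F' h
    refine exists_twist (u := fun c => F' c (w.piecewise x p)) ?_
    revert h
    cases u' (Function.update x a false) <;> cases u' (Function.update x a true) <;>
      simp [eq_comm]
  have hx' := he ▸ hx
  rw [key f u F hu hF hfe _ (hne _), key f u F hu hF hfe _ (hne _)] at hx
  rw [key g v G hv hG hge _ (hne _), key g v G hv hG hge _ (hne _)] at hx'
  obtain ⟨τ₁, h₁⟩ := tw u F hx
  obtain ⟨τ₂, h₂⟩ := tw v G hx'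
  have huv : ∀ y, v y = (u y ^^ (τ₁ ^^ τ₂)) := by
    intro y
    have hy : ∀ i, i ∉ M → M.piecewise y x i = x i := fun i hi => by simp [hi]
    have e1 : u (M.piecewise y x) = u y := eq_of_agree fun i hi => by simp [hu hi]
    have e2 : v (M.piecewise y x) = v y := eq_of_agree fun i hi => by simp [hv hi]
    have h3 := key f u F hu hF hfe _ hy
    have h4 := key g v G hv hG hge _ hy
    rw [he, h4, h₁, h₂, e1, e2] at h3
    revert h3
    cases u y <;> cases v y <;> cases τ₁ <;> cases τ₂ <;> simp
  exact ⟨u, F, fun b => G (b ^^ (τ₁ ^^ τ₂)), c, hu, hF, fun b => hG _, hfe,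
    fun x => by rw [hge, huv], huc⟩

/-- The collapsed `f` is a restriction of `f`, so its relevant sets are relevant for `f`, though the
agreed hypercube may fix other values. If `a ∈ w`, then `u` is a literal in `a` there, and its sign
`σ` is undone by a substitution; otherwise `u` is constant and `a` is frozen at that constant. -/
theorem Agree.collapse {l : ℕ} {f g u : Fn V} {F G : Bool → Fn V} {M : Finset V} {a : V}
    {c : V → Bool} (hfg : Agree l f g) (ha : a ∈ M) (hu : ess u ⊆ M)
    (hF : ∀ b, Disjoint (ess (F b)) M) (hG : ∀ b, Disjoint (ess (G b)) M)
    (hf : ∀ x, f x = F (u x) x) (hg : ∀ x, g x = G (u x) x)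
    (hfc : (fun x => F (x a) x) = res f (insert a (Finset.univ \ M)) c) :
    Agree l (fun x => F (x a) x) fun x => G (x a) x := by
  intro w hw ⟨p, hp⟩
  have hwT : w ⊆ insert a (Finset.univ \ M) := by
    refine hp.trans ((ess_res_subset_right _ _ _).trans ?_)
    rw [hfc]
    exact ess_res_subset_left _ _ _
  have hwM : ∀ i ∈ w, i ∈ M → i = a := by
    intro i hi hiM
    have := hwT hi
    simpa [hiM] using this
  rw [hfc, res_res hwT] at hp
  obtain ⟨q, hq, he⟩ := hfg w hw ⟨_, hp⟩
  by_cases haw : a ∈ w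
  · have hux : ∀ x, u (w.piecewise x q) = u (Function.update q a (x a)) := by
      intro x
      refine eq_of_agree fun i hi => ?_
      by_cases hia : i = a
      · subst hia; simp [haw]
      · have : i ∉ w := fun h => hia (hwM i h (hu hi))
        simp [hia, this]
    obtain ⟨x, hx⟩ := exists_ne_of_mem_ess (hq haw)
    have hFe : ∀ (F' : Bool → Fn V), (∀ b, Disjoint (ess (F' b)) M) → ∀ b x s,
        F' b (w.piecewise (Function.update x a s) q) = F' b (w.piecewise x q) := by
      intro F' hF' b x s
      refine disjoint_ess_iff.1 (hF' b) _ _ fun i hi => ?_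
      have : i ≠ a := fun e => hi (e ▸ ha)
      by_cases hiw : i ∈ w <;> simp [hiw, this]
    simp only [res] at hx
    rw [hf, hf, hux, hux, hFe F hF, hFe F hF] at hx
    simp only [Function.update_self] at hx
    obtain ⟨σ, hσ⟩ := exists_twist (u := fun s => u (Function.update q a s))
      fun e => hx (by rw [show u _ = u _ from e])
    have key : ∀ (f' : Fn V) (F' : Bool → Fn V), (∀ b, Disjoint (ess (F' b)) M) →
        (∀ x, f' x = F' (u x) x) → ∀ x, res f' w q x =
          res (fun x => F' (x a) x) w q (Function.update x a (x a ^^ σ)) := by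
      intro f' F' hF' hf' x
      simp only [res]
      rw [hf', hux, show u (Function.update q a (x a)) = _ from hσ _, hFe F' hF']
      simp [haw]
    refine ⟨q, fun i hi => ?_, ?_⟩
    · obtain ⟨x, hx⟩ := exists_ne_of_mem_ess (hq hi)
      rw [key f F hF hf, key f F hF hf] at hx
      obtain ⟨j, hj, hjne⟩ := exists_mem_ess_of_ne hx
      convert hj using 1
      by_contra hne
      by_cases hja : j = a
      · subst hja; simp [Ne.symm hne] at hjne
      · simp [hja, Ne.symm hne] at hjne
    · funext x
      have h1 := congrFun he (Function.update x a (x a ^^ σ))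
      rw [key f F hF hf, key g G hG hg] at h1
      simpa using h1
  · have key : ∀ (f' : Fn V) (F' : Bool → Fn V), (∀ b, Disjoint (ess (F' b)) M) →
        (∀ x, f' x = F' (u x) x) → res (fun x => F' (x a) x) w (Function.update q a (u q)) =
          res f' w q := by
      intro f' F' hF' hf'
      funext x
      simp only [res]
      rw [hf']
      have e1 : u (w.piecewise x q) = u q := by
        refine eq_of_agree fun i hi => ?_
        have : i ∉ w := fun h => haw (hwM i h (hu hi) ▸ h)
        simp [this]
      rw [e1]
      simp only [haw, Finset.piecewise_eq_of_notMem, not_false_eq_true, Function.update_self]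
      refine disjoint_ess_iff.1 (hF' _) _ _ fun i hi => ?_
      have : i ≠ a := fun e => hi (e ▸ ha)
      by_cases hiw : i ∈ w <;> simp [hiw, this]
    refine ⟨Function.update q a (u q), ?_, ?_⟩
    · rw [key f F hF hf]; exact hq
    · rw [key f F hF hf, key g G hG hg, he]

theorem Agree.ess_subset {l : ℕ} {f g : Fn V} (hfg : Agree l f g) (hl1 : 1 ≤ l)
    (hl : l ≤ (ess f).card) : ess f ⊆ ess g := by
  intro i hi
  obtain ⟨x, hx⟩ := exists_ne_of_mem_ess hi
  have h0 : ({i} : Finset V) ⊆ ess (res f {i} x) := by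
    rw [Finset.singleton_subset_iff]
    have e : ∀ b, f (Function.update x i b) = res f {i} x (Function.update x i b) := by
      intro b
      simp only [res]; congr 1; funext k
      by_cases hk : k = i <;> simp [hk]
    rw [e, e] at hx
    exact mem_ess_of_ne hx fun j hj => by simp [hj]
  obtain ⟨w, p, hiw, -, hp, he⟩ := hfg.extend hl ⟨x, h0⟩ (by simpa using hl1)
  rw [he] at hp
  exact ess_res_subset_right _ _ _ (hp (hiw (by simp)))

/-- A read-once function is determined by its values on one relevance hypercube for each set of `l`
variables that has one. -/
theorem eq_of_ro_of_agree {l : ℕ} {f g : Fn V} (hl1 : 1 ≤ l) (hf : RO l f) (hg : RO l g)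
    (hgf : ess g ⊆ ess f) (hl : l ≤ (ess f).card) (hfg : Agree l f g) : f = g := by
  induction hn : (ess f).card using Nat.strong_induction_on generalizing f g with
  | _ n ih =>
  subst hn
  -- With exactly `l` essential variables, restricting to them changes neither `f` nor `g`, and the
  -- agreed hypercube says everything.
  rcases eq_or_lt_of_le hl with heq | hlt
  · obtain ⟨p, -, he⟩ := hfg (ess f) heq.symm
      ⟨fun _ => false, by rw [res_of_ess_subset subset_rfl]⟩
    rwa [res_of_ess_subset subset_rfl, res_of_ess_subset hgf] at he
  have hess : ess f = ess g := (hfg.ess_subset hl1 hl).antisymm hgf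
  have hMex : ∃ m M, M ⊆ ess g ∧ 2 ≤ M.card ∧ M.card ≤ l ∧ Mod g M ∧ M.card = m := by
    obtain ⟨M, h1, h2, h3, h4⟩ := hg.exists_mod (hess ▸ hlt) (by rw [← hess]; omega)
    exact ⟨_, M, h1, h2, h3, h4, rfl⟩
  classical
  obtain ⟨M, hMg, hM2, hMl, hMod, hMc⟩ := Nat.find_spec hMex
  have hmin : ∀ I ⊆ M, Mod g I → 2 ≤ I.card → I = M := by
    intro I hI hIm hI2
    refine Finset.eq_of_subset_of_card_le hI ?_
    rw [hMc]
    exact Nat.find_min' hMex ⟨I, hI.trans hMg, hI2, (Finset.card_le_card hI).trans hMl, hIm, rfl⟩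
  have hMf : M ⊆ ess f := hess ▸ hMg
  have hModf : Mod f M :=
    Mod.of_agree hfg hl hf hg hgf hMod hM2 hMl hmin (Part.refl f) hf hMf
  obtain ⟨a, ha⟩ : M.Nonempty := Finset.card_pos.1 (by omega)
  obtain ⟨p, hp⟩ := hfg.sep_module hl hMod hf (Part.refl f)
  rw [Finset.inter_eq_left.2 hMf] at hp
  obtain ⟨w, q, hMw, -, hq, he⟩ := hfg.extend hl ⟨p, hp⟩ hMl
  obtain ⟨u, F, G, c, hu, hF, hG, hfe, hge, huc⟩ :=
    hModf.exists_common hMod ha hMw (hq (hMw ha)) he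
  have hres : ∀ (f' : Fn V) (F' : Bool → Fn V), (∀ b, Disjoint (ess (F' b)) M) →
      (∀ x, f' x = F' (u x) x) →
      (fun x => F' (x a) x) = res f' (insert a (Finset.univ \ M)) c := by
    intro f' F' hF' hf'
    funext x
    simp only [res]
    rw [hf', huc]
    · simp only [Finset.mem_insert, true_or, Finset.piecewise_eq_of_mem]
      refine disjoint_ess_iff.1 (hF' _) _ _ fun i hi => ?_
      simp [hi]
    · intro j hj hja
      simp [hj, hja]
  have hfc := hres f F hF hfe
  have hgc := hres g G hG hge
  have hef := ess_collapse ha (hMf ha) hu hF hfe huc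
  have heg := ess_collapse ha (hMg ha) hu hG hge huc
  have hupd : ∀ (F' : Bool → Fn V), (∀ b, Disjoint (ess (F' b)) M) → ∀ b x,
      F' b x = (fun x => F' (x a) x) (Function.update x a b) := by
    intro F' hF' b x
    simp only [Function.update_self]
    refine disjoint_ess_iff.1 (hF' b) _ _ fun i hi => ?_
    have : i ≠ a := fun e => hi (e ▸ ha)
    simp [this]
  suffices hFG : ∀ b x, F b x = G b x by
    funext x
    rw [hfe, hge, hFG]
  have hcard : (insert a (ess f \ M)).card < (ess f).card := by
    rw [Finset.card_insert_of_notMem (by simp [ha]), Finset.card_sdiff_of_subset hMf]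
    have := Finset.card_le_card hMf
    omega
  -- The induction hypothesis needs at least `l` variables after the collapse. If fewer remain, they
  -- all fit into one agreed hypercube of `f`, from which `F = G` is read off directly.
  by_cases hsmall : l ≤ (insert a (ess f \ M)).card
  · have := ih _ hcard (f := fun x => F (x a) x) (g := fun x => G (x a) x)
      (by rw [hfc]; exact hf.res _ _) (by rw [hgc]; exact hg.res _ _) (by rw [hef, heg, hess])
      (by rwa [hef]) (hfg.collapse ha hu hF hG hfe hge hfc) (by rw [hef])
    intro b x
    rw [hupd F hF, hupd G hG, this]
  · have hET : insert a (ess f \ M) ⊆ insert a (Finset.univ \ M) :=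
      Finset.insert_subset_insert _ (Finset.sdiff_subset_sdiff (Finset.subset_univ _) subset_rfl)
    have hE : insert a (ess f \ M) ⊆ ess (res f (insert a (ess f \ M))
        ((insert a (Finset.univ \ M)).piecewise c c)) := by
      rw [← res_res hET, ← hfc, res_of_ess_subset hef.subset, hef]
    obtain ⟨w, q, hEw, -, hq, he⟩ := hfg.extend hl ⟨_, hE⟩ (by omega)
    have haw : a ∈ w := hEw (Finset.mem_insert_self _ _)
    have hsub : ∀ (F' : Bool → Fn V), (∀ b, Disjoint (ess (F' b)) M) →
        ess (fun x => F' (x a) x) = insert a (ess f \ M) →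
        ∀ b x y, (∀ i, i ∈ w → i ∉ M → x i = y i) → F' b x = F' b y := by
      intro F' hF' hE' b x y hxy
      rw [hupd F' hF', hupd F' hF']
      refine eq_of_agree (f := fun x => F' (x a) x) fun i hi => ?_
      rw [hE'] at hi
      by_cases hia : i = a
      · subst hia; simp
      · have hiw := hEw hi
        rw [Finset.mem_insert, Finset.mem_sdiff] at hi
        simp [hia, hxy i hiw (hi.resolve_left hia).2]
    intro b x
    obtain ⟨y, hy⟩ := exists_ne_of_mem_ess (hq haw)
    have hun : u (w.piecewise (Function.update y a false) q) ≠
        u (w.piecewise (Function.update y a true) q) := by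
      intro hue
      apply hy
      simp only [res]
      rw [hfe, hfe, hue]
      refine disjoint_ess_iff.1 (hF _) _ _ fun i hi => ?_
      have : i ≠ a := fun e => hi (e ▸ ha)
      by_cases hiw : i ∈ w <;> simp [hiw, this]
    obtain ⟨τ, hτ⟩ := exists_twist (u := fun s => u (w.piecewise (Function.update y a s) q)) hun
    -- On `M` the point `z` is chosen to give `u` the value `b` within the hypercube; outside `M` it
    -- follows the given `x`.
    set z := M.piecewise (Function.update y a (b ^^ τ)) x with hz
    have huz : u (w.piecewise z q) = b := by
      have e1 : u (w.piecewise z q) = u (w.piecewise (Function.update y a (b ^^ τ)) q) := by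
        refine eq_of_agree fun i hi => ?_
        by_cases hiw : i ∈ w <;> simp [hiw, hz, hu hi]
      rw [e1, show u _ = _ from hτ _]
      simp
    have h1 := congrFun he z
    simp only [res] at h1
    rw [hfe, hge, huz] at h1
    rw [hsub F hF hef b x (w.piecewise z q), h1, hsub G hG (hess ▸ heg) b x (w.piecewise z q)]
    all_goals
      intro i hiw hiM
      simp [hiw, hz, hiM]

end Uniqueness

/-! ### From formulas to checking tests; counting -/

section CheckingTests

/-- A gate applied to read-once functions of disjoint variables, its arguments being numbered. -/
theorem RO.of_family {V : Type*} [Fintype V] [DecidableEq V] {l m : ℕ} (hm : m ≤ l)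
    (h : (Fin m → Bool) → Bool) (ψ : Fin m → Fn V) (hψ : ∀ k, RO l (ψ k))
    (hd : ∀ k k', k ≠ k' → Disjoint (ess (ψ k)) (ess (ψ k'))) :
    RO l fun x => h fun k => ψ k x := by
  classical
  -- In `RO` the arguments of a gate are indexed by variables. Each nonconstant argument is named
  -- after one of its variables; the constant ones are absorbed into the gate.
  set K : Finset (Fin m) := Finset.univ.filter fun k => (ess (ψ k)).Nonempty with hK
  have hconst : ∀ k, k ∉ K → ∀ x y, ψ k x = ψ k y := by
    intro k hk
    refine eq_of_ess_eq_empty ?_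
    simpa [hK, Finset.not_nonempty_iff_eq_empty] using hk
  rcases K.eq_empty_or_nonempty with hK0 | ⟨k₀, hk₀⟩
  · have : (fun x => h fun k => ψ k x) = fun _ => h fun k => ψ k fun _ => false := by
      funext x
      congr 1
      funext k
      exact hconst k (by simp [hK0]) _ _
    rw [this]
    exact RO.const l _
  obtain ⟨i₀, -⟩ := (Finset.mem_filter.1 hk₀).2
  have hr : ∀ k, ∃ i, k ∈ K → i ∈ ess (ψ k) := by
    intro k
    by_cases hk : k ∈ K
    · obtain ⟨i, hi⟩ := (Finset.mem_filter.1 hk).2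
      exact ⟨i, fun _ => hi⟩
    · exact ⟨i₀, fun h => absurd h hk⟩
  choose r hr using hr
  have hinj : Set.InjOn r K := by
    intro k hk k' hk' hkk
    by_contra hne
    exact Finset.disjoint_left.1 (hd k k' hne) (hr k hk) (hkk ▸ hr k' hk')
  have : Nonempty (Fin m) := ⟨k₀⟩
  set s := Function.invFunOn r (K : Set (Fin m)) with hs
  have hsr : ∀ k ∈ K, s (r k) = k := fun k hk => hinj.leftInvOn_invFunOn hk
  refine RO.node _ (K.image r)
    (fun y => h fun k => if k ∈ K then y (r k) else ψ k fun _ => false) (fun i => ψ (s i))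
    ?_ ?_ (fun i _ => hψ _) ?_ fun x => ?_
  · exact (Finset.card_image_le.trans (Finset.card_le_univ K)).trans (by simpa using hm)
  · rw [ess_subset_iff]
    intro x y hxy
    congr 1
    funext k
    by_cases hk : k ∈ K
    · simp [hk, hxy (r k) (Finset.mem_image_of_mem r hk)]
    · simp [hk]
  · intro i hi j hj hij
    obtain ⟨k, hk, rfl⟩ := Finset.mem_image.1 hi
    obtain ⟨k', hk', rfl⟩ := Finset.mem_image.1 hj
    rw [hsr k hk, hsr k' hk']
    exact hd k k' fun e => hij (by rw [e])
  · congr 1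
    funext k
    by_cases hk : k ∈ K
    · simp [hk, hsr k hk]
    · simp only [hk, if_false]
      exact hconst k hk _ _

theorem Formula.eval_update {B : Set Gate} {n : ℕ} {i : Fin n} (F : Formula B n)
    (h : F.occurrences i = 0) (x : Fin n → Bool) (b : Bool) :
    F.eval (Function.update x i b) = F.eval x := by
  induction F with
  | var j =>
    have : j ≠ i := by simpa [Formula.occurrences] using h
    simp [Formula.eval, this]
  | app g hB args ih =>
    simp only [Formula.occurrences, Finset.sum_eq_zero_iff, Finset.mem_univ, true_imp_iff] at h
    simp only [Formula.eval]
    exact congrArg g.2 (funext fun k => ih k (h k))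

/-- A variable on which two arguments of a gate depend occurs in both of them, hence at least twice;
so the arguments have disjoint variables. -/
theorem Formula.ro {l n : ℕ} (F : Formula (fullBasis l) n) (h : ∀ i, F.occurrences i ≤ 1) :
    RO l fun x => F.eval x := by
  induction F with
  | var j => exact RO.lit j
  | app g hB args ih =>
    have hpos : ∀ i k, i ∈ ess (fun x => (args k).eval x) → 1 ≤ (args k).occurrences i := by
      intro i k hi
      obtain ⟨x, b, hne⟩ := mem_ess.1 hi
      by_contra hc
      exact hne ((args k).eval_update (by omega) x b)
    refine RO.of_family hB g.2 (fun k x => (args k).eval x) (fun k => ih k fun i => ?_) ?_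
    · refine le_trans ?_ (h i)
      exact Finset.single_le_sum (f := fun k => (args k).occurrences i)
        (fun _ _ => Nat.zero_le _) (Finset.mem_univ k)
    · intro k k' hkk
      rw [Finset.disjoint_left]
      intro i hi hi'
      have h1 := hpos i k hi
      have h2 := hpos i k' hi'
      have h3 : ∑ m ∈ {k, k'}, (args m).occurrences i ≤ ∑ m, (args m).occurrences i :=
        Finset.sum_le_sum_of_subset (Finset.subset_univ _)
      rw [Finset.sum_pair hkk] at h3
      have h4 : ∑ m, (args m).occurrences i ≤ 1 := h i
      omega

theorem IsReadOnce.ro {l n : ℕ} {f : BoolFn n} (hf : IsReadOnce (fullBasis l) f) : RO l f := by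
  obtain ⟨F, hF, he⟩ := hf
  have : f = fun x => F.eval x := funext fun x => (he x).symm
  rw [this]
  exact F.ro hF

theorem Formula.exists_mono {B B' : Set Gate} (hB : B ⊆ B') {n : ℕ} (F : Formula B n) :
    ∃ F' : Formula B' n, (∀ x, F'.eval x = F.eval x) ∧
      ∀ i, F'.occurrences i = F.occurrences i := by
  induction F with
  | var j => exact ⟨.var j, fun _ => rfl, fun _ => rfl⟩
  | app g hg args ih =>
    choose args' h1 h2 using ih
    exact ⟨.app g (hB hg) args', fun x => by simp [Formula.eval, h1],
      fun i => by simp [Formula.occurrences, h2]⟩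

theorem IsReadOnce.mono {B B' : Set Gate} (hB : B ⊆ B') {n : ℕ} {f : BoolFn n}
    (hf : IsReadOnce B f) : IsReadOnce B' f := by
  obtain ⟨F, hF, he⟩ := hf
  obtain ⟨F', h1, h2⟩ := F.exists_mono hB
  exact ⟨F', fun i => by rw [h2]; exact hF i, fun x => by rw [h1, he]⟩

theorem IsCheckingTest.mono {B B' : Set Gate} (hB : B ⊆ B') {n : ℕ} {f : BoolFn n}
    {M : Finset (Fin n → Bool)} (hM : IsCheckingTest B' f M) : IsCheckingTest B f M :=
  fun g hg hne => hM g (hg.mono hB) hne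

theorem testComplexity_le {B : Set Gate} {n : ℕ} {f : BoolFn n} {M : Finset (Fin n → Bool)}
    (hM : IsCheckingTest B f M) : testComplexity B f ≤ M.card :=
  Nat.sInf_le ⟨M, hM, rfl⟩

theorem testComplexity_mono {B B' : Set Gate} (hB : B ⊆ B') {n : ℕ} (f : BoolFn n) :
    testComplexity B f ≤ testComplexity B' f := by
  obtain ⟨M, hM, hc⟩ := Nat.sInf_mem
    (s := {k | ∃ M : Finset (Fin n → Bool), IsCheckingTest B' f M ∧ M.card = k})
    ⟨_, _, isCheckingTest_univ B' f, rfl⟩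
  exact (testComplexity_le (hM.mono hB)).trans hc.le

theorem testComplexity_le_two_pow (B : Set Gate) {n : ℕ} (f : BoolFn n) :
    testComplexity B f ≤ 2 ^ n := by
  refine (testComplexity_le (isCheckingTest_univ B f)).trans ?_
  simp

theorem DependsOnAll.ess_eq {n : ℕ} {f : BoolFn n} (hf : DependsOnAll f) :
    ess f = Finset.univ := by
  rw [Finset.eq_univ_iff_forall]
  intro i
  obtain ⟨α, -, β, -, h, hne⟩ := hf i
  exact mem_ess_of_ne hne h

theorem mem_subcube {n : ℕ} {w : Finset (Fin n)} {p α : Fin n → Bool} :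
    α ∈ subcube w p ↔ ∀ i, i ∉ w → α i = p i := by
  simp [subcube]

theorem card_subcube_le {n : ℕ} (w : Finset (Fin n)) (p : Fin n → Bool) :
    (subcube w p).card ≤ 2 ^ w.card := by
  rw [← Finset.card_powerset]
  refine Finset.card_le_card_of_injOn (fun α => w.filter fun i => α i = true)
    (fun α _ => Finset.mem_powerset.2 (Finset.filter_subset _ _)) ?_
  intro α hα β hβ he
  funext i
  by_cases hi : i ∈ w
  · have := congrArg (fun s => i ∈ s) he
    simp only [Finset.mem_filter, hi, true_and, eq_iff_iff] at this
    revert this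
    cases α i <;> cases β i <;> simp
  · rw [mem_subcube.1 hα i hi, mem_subcube.1 hβ i hi]

theorem isRelevanceHypercube_subcube_iff {n : ℕ} {f : BoolFn n} {w : Finset (Fin n)}
    {p : Fin n → Bool} :
    IsRelevanceHypercube f w (subcube w p) ↔ w ⊆ ess (res f w p) := by
  have hpw : ∀ α ∈ subcube w p, w.piecewise α p = α := by
    intro α hα
    funext i
    by_cases hi : i ∈ w <;> simp [hi]
    exact (mem_subcube.1 hα i hi).symm
  constructor
  · rintro ⟨-, h⟩ i hi
    obtain ⟨α, hα, β, hβ, hab, hne⟩ := h i hi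
    refine mem_ess_of_ne (x := α) (y := β) ?_ hab
    simp only [res]
    rwa [hpw α hα, hpw β hβ]
  · intro h
    refine ⟨⟨p, rfl⟩, fun i hi => ?_⟩
    obtain ⟨x, hx⟩ := exists_ne_of_mem_ess (h hi)
    refine ⟨_, mem_subcube.2 fun j hj => Finset.piecewise_eq_of_notMem w _ p hj, _,
      mem_subcube.2 fun j hj => Finset.piecewise_eq_of_notMem w _ p hj, fun j hj => ?_, hx⟩
    by_cases hjw : j ∈ w <;> simp [hjw, hj]

theorem mem_cubeSets {n l : ℕ} {f : BoolFn n} {w : Finset (Fin n)} :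
    w ∈ cubeSets l f ↔ w.card = l ∧ ∃ p, w ⊆ ess (res f w p) := by
  simp only [cubeSets, Finset.mem_filter, Finset.mem_powersetCard, Finset.subset_univ, true_and]
  refine and_congr_right fun _ => ⟨?_, ?_⟩
  · rintro ⟨_, ⟨⟨p, rfl⟩, h⟩⟩
    exact ⟨p, isRelevanceHypercube_subcube_iff.1 ⟨⟨p, rfl⟩, h⟩⟩
  · rintro ⟨p, hp⟩
    exact ⟨_, isRelevanceHypercube_subcube_iff.2 hp⟩

theorem isCheckingTest_biUnion {l n : ℕ} (hl : 1 ≤ l) (hln : l ≤ n) {f : BoolFn n}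
    (hf : IsReadOnce (fullBasis l) f) (hall : DependsOnAll f)
    {H : Finset (Fin n) → Finset (Fin n → Bool)}
    (hH : ∀ w ∈ cubeSets l f, IsRelevanceHypercube f w (H w)) :
    IsCheckingTest (fullBasis l) f ((cubeSets l f).biUnion H) := by
  intro g hg hne
  by_contra! hcon
  refine hne (eq_of_ro_of_agree hl hf.ro hg.ro ?_ ?_ ?_).symm
  · rw [hall.ess_eq]; exact Finset.subset_univ _
  · rw [hall.ess_eq]; simpa using hln
  · intro w hw hp
    have hwc : w ∈ cubeSets l f := mem_cubeSets.2 ⟨hw, hp⟩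
    have hHw := hH w hwc
    obtain ⟨p, hpe⟩ := hHw.1
    rw [hpe] at hHw
    refine ⟨p, isRelevanceHypercube_subcube_iff.1 hHw, funext fun x => hcon _ ?_⟩
    refine Finset.mem_biUnion.2 ⟨w, hwc, ?_⟩
    rw [hpe]
    exact mem_subcube.2 fun j hj => Finset.piecewise_eq_of_notMem w _ p hj

theorem card_biUnion_cubes_le {l n : ℕ} {f : BoolFn n}
    {H : Finset (Fin n) → Finset (Fin n → Bool)}
    (hH : ∀ w ∈ cubeSets l f, IsRelevanceHypercube f w (H w)) :
    ((cubeSets l f).biUnion H).card ≤ 2 ^ l * n.choose l := by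
  have hc : (cubeSets l f).card ≤ n.choose l := by
    have hsub : cubeSets l f ⊆ Finset.powersetCard l Finset.univ := fun w hw =>
      Finset.mem_powersetCard.2 ⟨Finset.subset_univ _, (mem_cubeSets.1 hw).1⟩
    simpa using Finset.card_le_card hsub
  refine (Finset.card_biUnion_le_card_mul _ _ (2 ^ l) fun w hw => ?_).trans ?_
  · obtain ⟨p, hp⟩ := (hH w hw).1
    rw [hp, ← (mem_cubeSets.1 hw).1]
    exact card_subcube_le w p
  · rw [mul_comm]
    exact Nat.mul_le_mul_left _ hc

theorem testComplexity_fullBasis_le_choose {l n : ℕ} (hl : 1 ≤ l) (hln : l ≤ n) {f : BoolFn n}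
    (hf : IsReadOnce (fullBasis l) f) (hall : DependsOnAll f) :
    testComplexity (fullBasis l) f ≤ 2 ^ l * n.choose l := by
  have hex : ∀ w, ∃ H, w ∈ cubeSets l f → IsRelevanceHypercube f w H := by
    intro w
    by_cases hw : w ∈ cubeSets l f
    · obtain ⟨p, hp⟩ := (mem_cubeSets.1 hw).2
      exact ⟨_, fun _ => isRelevanceHypercube_subcube_iff.2 hp⟩
    · exact ⟨∅, fun h => absurd h hw⟩
  choose H hH using hex
  exact (testComplexity_le (isCheckingTest_biUnion hl hln hf hall hH)).trans
    (card_biUnion_cubes_le hH)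

/-- For `n ≤ l + 1` all `2 ^ n` vectors are few enough; this covers `l = 0` with `n = 1`. For larger
`n` there are at least two essential variables, so a gate of arity at least two exists, whence `1 ≤
l`, and the binomial bound applies. -/
theorem testComplexity_fullBasis_le (l : ℕ) {n : ℕ} (hn : 1 ≤ n) {f : BoolFn n}
    (hf : IsReadOnce (fullBasis l) f) (hall : DependsOnAll f) :
    testComplexity (fullBasis l) f ≤ 2 ^ (l + 1) * n ^ l := by
  have hpos : 1 ≤ n ^ l := Nat.one_le_pow _ _ hn
  by_cases hnl : n ≤ l + 1
  · calc testComplexity (fullBasis l) f ≤ 2 ^ n := testComplexity_le_two_pow _ f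
      _ ≤ 2 ^ (l + 1) := Nat.pow_le_pow_right (by norm_num) hnl
      _ ≤ 2 ^ (l + 1) * n ^ l := Nat.le_mul_of_pos_right _ hpos
  · have hl : 1 ≤ l := by
      have hc : 2 ≤ (ess f).card := by
        rw [hall.ess_eq, Finset.card_univ, Fintype.card_fin]; omega
      obtain ⟨w, h, φ, D⟩ := hf.ro.exists_nf hc
      have := D.two_le
      have := D.card_le
      omega
    calc testComplexity (fullBasis l) f ≤ 2 ^ l * n.choose l :=
          testComplexity_fullBasis_le_choose hl (by omega) hf hall
      _ ≤ 2 ^ (l + 1) * n ^ l :=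
          Nat.mul_le_mul (Nat.pow_le_pow_right (by norm_num) (by omega)) (Nat.choose_le_pow n l)

end CheckingTests

end ReadOnce

theorem mainTheorem2 :
    (∀ l n : ℕ, 1 ≤ l → l ≤ n → ∀ f : ReadOnce.BoolFn n,
      ReadOnce.IsReadOnce (ReadOnce.fullBasis l) f → ReadOnce.DependsOnAll f →
        (∀ H : Finset (Fin n) → Finset (Fin n → Bool),
          (∀ w ∈ ReadOnce.cubeSets l f, ReadOnce.IsRelevanceHypercube f w (H w)) →
            ReadOnce.IsCheckingTest (ReadOnce.fullBasis l) f
              ((ReadOnce.cubeSets l f).biUnion H) ∧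
            ((ReadOnce.cubeSets l f).biUnion H).card ≤ 2 ^ l * n.choose l) ∧
        ReadOnce.testComplexity (ReadOnce.fullBasis l) f ≤ 2 ^ l * n.choose l) ∧
    (∀ l : ℕ, ∃ C : ℕ, ∀ n : ℕ, 1 ≤ n → ∀ f : ReadOnce.BoolFn n,
      ReadOnce.IsReadOnce (ReadOnce.fullBasis l) f → ReadOnce.DependsOnAll f →
        ReadOnce.testComplexity (ReadOnce.fullBasis l) f ≤ C * n ^ l) ∧
    (∀ B : Finset ReadOnce.Gate, ∃ C : ℕ, ∀ n : ℕ, 1 ≤ n → ∀ f : ReadOnce.BoolFn n,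
      ReadOnce.IsReadOnce (B : Set ReadOnce.Gate) f → ReadOnce.DependsOnAll f →
        ReadOnce.testComplexity (B : Set ReadOnce.Gate) f ≤ C * n ^ B.sup Sigma.fst) := by
  refine ⟨fun l n hl hln f hf hall =>
    ⟨fun H hH => ⟨ReadOnce.isCheckingTest_biUnion hl hln hf hall hH,
      ReadOnce.card_biUnion_cubes_le hH⟩,
      ReadOnce.testComplexity_fullBasis_le_choose hl hln hf hall⟩,
    fun l => ⟨2 ^ (l + 1), fun n hn f hf hall =>
      ReadOnce.testComplexity_fullBasis_le l hn hf hall⟩,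
    fun B => ⟨2 ^ (B.sup Sigma.fst + 1), fun n hn f hf hall => ?_⟩⟩
  have hB : (B : Set ReadOnce.Gate) ⊆ ReadOnce.fullBasis (B.sup Sigma.fst) :=
    fun h hh => Finset.le_sup (f := Sigma.fst) hh
  exact (ReadOnce.testComplexity_mono hB f).trans
    (ReadOnce.testComplexity_fullBasis_le _ hn (hf.mono hB) hall)
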